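/- Let $\mathbf k$ be an algebraically closed field and $\Lambda=\mathbf kQ/I$ a (finite-dimensional) gentle algebra; paths are read from right to left, $P(x)=\Lambda e_x$, and all complexes are considered up to isomorphism in the homotopy category of complexes of left $\Lambda$-modules. **Strings, bands, complexes.** A homotopy letter is a nontrivial path $p$ of $Q$ avoiding $I$ (direct letter) or a formal inverse $\bar p$ (inverse letter). A homotopy string $\sigma$ is a walk $\cdots\sigma_{i+1}\sigma_i\cdots$ of homotopy letters such that two consecutive direct (or two consecutive inverse) letters compose to a path with a relation of $I$ at the junction, and consecutive letters of opposite orientation do not cancel. It is finite (possibly trivial, i.e. a single vertex), or infinite; if infinite to the left it ends there in a direct antipath, if infinite to the right it ends there in an inverse antipath. A closed walk is a cyclic word of homotopy letters satisfying these conditions cyclically, with as many direct as inverse letters; it is a homotopy band if it is not a proper power. The string complex $P_\sigma$ is given by the unfolded diagram of $\sigma$: there is one summand $P(x)$ for each vertex $x$ passed by $\sigma$; a direct letter $p$ gives the component "right multiplication by $p$" of the differential from the vertex at its left end to the vertex at its right end, and an inverse letter $\bar p$ gives right multiplication by $p$ from the right end to the left end. The walks are graded by the cohomological degree of their vertices.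 For a closed walk $\sigma$ and $\lambda\in\mathbf k^*$, the complex $B_{\sigma,\lambda}$ is defined in the same way by the cyclic diagram, with coefficient $\lambda$ at one chosen letter. Write $Q_\sigma$ for $P_\sigma$ or $B_{\sigma,\lambda}$. **Quasi-graph maps.** Let $\sigma=\beta\sigma_L\rho\sigma_R\alpha$ and $\tau=\delta\tau_L\rho\tau_R\gamma$ be homotopy strings or bands (a band being rotated so that its word has this form), where $\rho$ is a finite, possibly trivial, common substring lying in the same degrees of $Q_\sigma$ and $\Sigma^{-1}Q_\tau$, and $\sigma_L,\sigma_R,\tau_L,\tau_R$ are homotopy letters; for a string each of them may be empty, and then so is the adjacent one of $\beta,\alpha,\delta,\gamma$. This is a quasi-graph map $\varphi:Q_\sigma\rightsquigarrow\Sigma^{-1}Q_\tau$ if on the right one of the following holds, and on the left the mirror image of one of them: * (RQ1) $\sigma_R,\tau_R$ are direct and $\sigma_R=\tau_R\tau_R'$ with $\tau_R'$ nontrivial; * (RQ2) $\sigma_R=\bar\omega$, $\tau_R=\bar\omega\,\bar\omega'$ are inverse, with $\omega'$ nontrivial; * (RQ3) $\sigma_R$ is inverse or empty and $\tau_R$ is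 direct or empty, not both empty. If $\rho$ is trivial, $\sigma$ and $\tau$ are compatibly oriented for $\varphi$ if on the right: when $\sigma_R=\bar p$ is inverse, $\tau_R$ is empty, or $\tau_R=q$ is direct with $pq\notin I$, or $\tau_R$ is inverse and $\tau_R=\sigma_R\sigma_R'$ with $\sigma'_R$ nontrivial; when $\sigma_R$ is direct, $\tau_R$ is direct and $\sigma_R=\tau_R\tau'_R$ with $\tau'_R$ nontrivial; when $\sigma_R$ is empty, $\tau_R$ is direct; and the mirror image holds on the left. If $\rho$ is nontrivial this is no condition. The quasi-graph map $\varphi$ determines the following single and double maps $Q_\sigma\to Q_\tau$ (those of them that are chain maps): for a letter $\rho_i$ of $\rho$, the map whose only component is $\rho_i$ (or $\bar\rho_i$ if $\rho_i$ is inverse), from the source of this letter in $Q_\sigma$ to its target in $Q_\tau$; at the right end of $\rho$, the map with single component $\tau_R$ in case (RQ1), with single component $\omega$ (from the far end of $\sigma_R$ to the right end of $\rho$ in $\tau$) in case (RQ2), and with the components $\overline{\sigma_R}$ and $\tau_R$, each with its coefficient in the diagram, or the one of them that exists, in case (RQ3); and dually at the left end. A chain map $f:Q_\sigma\to Q_\tau$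 represents the homotopy class determined by $\varphi$ if it is homotopic to a nonzero scalar multiple of one of these maps. **Proposition.** Let $\varphi:Q_\sigma\rightsquigarrow\Sigma^{-1}Q_\tau$ be a quasi-graph map as above, with $\sigma$ and $\tau$ compatibly oriented for $\varphi$, let $f:Q_\sigma\to Q_\tau$ be a representative of the homotopy class determined by $\varphi$, and let $M_f$ be its mapping cone, $M_f^n=Q_\sigma^{n+1}\oplus Q_\tau^n$. 1. If $\sigma$ and $\tau$ are homotopy strings, then $c_1=\beta\sigma_L\rho\tau_R\gamma$ and $c_2=\delta\tau_L\rho\sigma_R\alpha$ are homotopy strings and $M_f\cong P_{c_1}\oplus P_{c_2}$. 2. If $\sigma$ and $\tau$ are homotopy bands, with scalar $\lambda$ placed on a direct letter of $\sigma$ and scalar $\mu$ placed on an inverse letter of $\tau$ (a direct letter of $\bar\tau$), then $c=\beta\sigma_L\rho\tau_R\gamma\delta\tau_L\rho\sigma_R\alpha$ is a closed walk and $M_f\cong B_{c,-\lambda\mu^{-1}}$, where $-\lambda\mu^{-1}$ is placed on any direct letter of $c$; equivalently, $(-\lambda\mu^{-1})^{-1}$ is placed on any inverse letter of $c$. (Here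 $c$ is a homotopy band unless it is a proper power.) 3. If $\sigma$ is a homotopy band and $\tau$ a homotopy string, then $c=\delta\tau_L\rho\sigma_R\alpha\beta\sigma_L\rho\tau_R\gamma$ is a homotopy string and $M_f\cong P_c$. 4. If $\sigma$ is a homotopy string and $\tau$ a homotopy band, then $c=\beta\sigma_L\rho\tau_R\gamma\delta\tau_L\rho\sigma_R\alpha$ is a homotopy string and $M_f\cong P_c$. In each case the strings and closed walks $c_1,c_2,c$ carry the degrees of the vertices of $\sigma$ and $\tau$ in $M_f$. -/

import Mathlib

open CategoryTheory CategoryTheory.Limits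

noncomputable section

namespace Gentle

/-- A gentle bound quiver `(Q, I)` with vertex set `V` and arrow set `A`. An arrow `a` starts at
`s a` and ends at `e a`; paths are read from right to left, so that `b a` is a path of length two
when `s b = e a`. The ideal `I` is generated by the paths `b a` with `rel b a`. -/
structure GentleQuiver (V A : Type*) where
  s : A → V
  e : A → V
  rel : A → A → Prop
  rel_comp : ∀ b a, rel b a → s b = e a
  two_out : ∀ x, {a | s a = x}.encard ≤ 2
  two_in : ∀ x, {a | e a = x}.encard ≤ 2
  nonrel_left : ∀ a, {b | s b = e a ∧ ¬ rel b a}.Subsingleton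
  nonrel_right : ∀ a, {c | s a = e c ∧ ¬ rel a c}.Subsingleton
  rel_left : ∀ a, {b | rel b a}.Subsingleton
  rel_right : ∀ a, {c | rel a c}.Subsingleton
  /-- `I` is admissible: paths avoiding the relations have bounded length. -/
  admissible : ∃ N : ℕ, ∀ p : List A,
    List.IsChain (fun b a => s b = e a ∧ ¬ rel b a) p → p.length < N

variable (k : Type*) [Field k] {V A : Type*} [Fintype V] (Q : GentleQuiver V A)

/-- The relations of `Λ = kQ/I` on the generators `e_x` (`x` a vertex) and `a` (an arrow). -/
inductive PathRel : FreeAlgebra k (V ⊕ A) → FreeAlgebra k (V ⊕ A) → Prop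
  | idem (x : V) :
      PathRel (FreeAlgebra.ι k (Sum.inl x) * FreeAlgebra.ι k (Sum.inl x))
        (FreeAlgebra.ι k (Sum.inl x))
  | orth (x y : V) (h : x ≠ y) :
      PathRel (FreeAlgebra.ι k (Sum.inl x) * FreeAlgebra.ι k (Sum.inl y)) 0
  | sum_one : PathRel (∑ x : V, FreeAlgebra.ι k (Sum.inl x)) 1
  | target (a : A) :
      PathRel (FreeAlgebra.ι k (Sum.inl (Q.e a)) * FreeAlgebra.ι k (Sum.inr a))
        (FreeAlgebra.ι k (Sum.inr a))
  | source (a : A) :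
      PathRel (FreeAlgebra.ι k (Sum.inr a) * FreeAlgebra.ι k (Sum.inl (Q.s a)))
        (FreeAlgebra.ι k (Sum.inr a))
  | rel (b a : A) (h : Q.rel b a) :
      PathRel (FreeAlgebra.ι k (Sum.inr b) * FreeAlgebra.ι k (Sum.inr a)) 0

/-- The gentle algebra `Λ = kQ/I`, by generators and relations. -/
abbrev Alg := RingQuot (PathRel k Q)

/-- The class of the trivial path at `x`. -/
def idem (x : V) : Alg k Q := RingQuot.mkAlgHom k (PathRel k Q) (FreeAlgebra.ι k (Sum.inl x))

/-- The class of the arrow `a`. -/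
def arrow (a : A) : Alg k Q := RingQuot.mkAlgHom k (PathRel k Q) (FreeAlgebra.ι k (Sum.inr a))

lemma arrow_mul_idem (a : A) : arrow k Q a * idem k Q (Q.s a) = arrow k Q a := by
  have h := RingQuot.mkAlgHom_rel k (PathRel.source (k := k) (Q := Q) a)
  rwa [map_mul] at h

lemma arrow_mul_arrow {b a : A} (h : Q.rel b a) : arrow k Q b * arrow k Q a = 0 := by
  have h := RingQuot.mkAlgHom_rel k (PathRel.rel (k := k) (Q := Q) b a h)
  rwa [map_mul, map_zero] at h

/-- A homotopy letter: a nontrivial path `p = a_n ⋯ a_1` of `(Q, I)`, stored as the list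
`[a_n, …, a_1]`. It stands for `p` (a direct letter) if `inv = false`, and for the formal inverse
of `p` (an inverse letter) if `inv = true`. -/
structure Letter where
  inv : Bool
  path : List A
  ne : path ≠ []
  chain : List.IsChain (fun b a => Q.s b = Q.e a ∧ ¬ Q.rel b a) path

variable {Q}

namespace Letter

/-- For `p = a_n ⋯ a_1`, the arrow `a_n`. -/
def hd (l : Letter Q) : A := l.path.head l.ne

/-- For `p = a_n ⋯ a_1`, the arrow `a_1`. -/
def lst (l : Letter Q) : A := l.path.getLast l.ne

/-- The vertex at the left end of the letter. -/
def left (l : Letter Q) : V := if l.inv then Q.s l.lst else Q.e l.hd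

/-- The vertex at the right end of the letter. -/
def right (l : Letter Q) : V := if l.inv then Q.e l.hd else Q.s l.lst

/-- The formal inverse letter. -/
def bar (l : Letter Q) : Letter Q := { l with inv := !l.inv }

/-- The underlying path as an element of `Λ`. -/
def elt (l : Letter Q) : Alg k Q := (l.path.map (arrow k Q)).prod

/-- `l l'` may be consecutive letters of a homotopy string: between two direct or two inverse
letters there is a relation, and between letters of different orientation there is no
cancellation. (That the letters meet at a vertex is required separately.) -/
def Junction (l l' : Letter Q) : Prop :=
  match l.inv, l'.inv with
  | false, false => Q.rel l.lst l'.hd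
  | true, true => Q.rel l'.lst l.hd
  | false, true => l.lst ≠ l'.lst
  | true, false => l.hd ≠ l'.hd

lemma elt_mul_idem (l : Letter Q) : l.elt k * idem k Q (Q.s l.lst) = l.elt k := by
  have h : l.elt k = (l.path.dropLast.map (arrow k Q)).prod * arrow k Q l.lst := by
    unfold elt lst
    conv_lhs => rw [← List.dropLast_append_getLast l.ne]
    simp
  rw [h, mul_assoc, arrow_mul_idem]

lemma elt_mul_elt {l l' : Letter Q} (h : Q.rel l.lst l'.hd) : l.elt k * l'.elt k = 0 := by
  unfold elt
  rw [← List.dropLast_append_getLast l.ne, ← List.cons_head_tail l'.ne]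
  have := arrow_mul_arrow k Q h
  simp only [lst, hd] at this
  simp only [List.map_append, List.map_cons, List.map_nil, List.prod_append, List.prod_cons,
    List.prod_nil, mul_one]
  rw [mul_assoc, ← mul_assoc (arrow k Q _) (arrow k Q _), this, zero_mul, mul_zero]

end Letter

variable (Q) in
/-- A graded homotopy walk, drawn from left to right as an unfolded diagram. The positions are the
elements of `ZMod m`: for `m = 0` this is `ℤ` and the walk is linear, for `m > 0` the walk is
closed. `dom i` says that `i` is a position of the walk, `vtx i` is the vertex there, `deg i` the
cohomological degree, and `letter i` is the homotopy letter between the positions `i` and `i + 1`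
(`none` where the walk has no letter). -/
structure Walk (m : ℕ) where
  dom : ZMod m → Prop
  vtx : ZMod m → V
  deg : ZMod m → ℤ
  letter : ZMod m → Option (Letter Q)
  letter_isSome : ∀ i, (letter i).isSome ↔ dom i ∧ dom (i + 1)
  vtx_left : ∀ i l, letter i = some l → vtx i = l.left
  vtx_right : ∀ i l, letter i = some l → vtx (i + 1) = l.right
  deg_step : ∀ i l, letter i = some l → deg (i + 1) = deg i + (if l.inv then -1 else 1)
  junction : ∀ i l l', letter i = some l → letter (i + 1) = some l' → l.Junction l'

namespace Walk

variable {m n : ℕ} (w : Walk Q m)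

/-- The walk is a (finite or infinite) homotopy string: its positions form a nonempty interval of
`ℤ`; if it is infinite to the left it ends there in a direct antipath, and if it is infinite to the
right it ends there in an inverse antipath. -/
structure IsString (w : Walk Q 0) : Prop where
  nonempty : ∃ i : ℤ, w.dom (i : ZMod 0)
  interval : ∀ i j l : ℤ, i ≤ j → j ≤ l →
    w.dom (i : ZMod 0) → w.dom (l : ZMod 0) → w.dom (j : ZMod 0)
  left_tail : (∀ N : ℤ, ∃ i : ℤ, i < N ∧ w.dom (i : ZMod 0)) →
    ∃ N : ℤ, ∀ i : ℤ, i < N →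
      ∃ l, w.letter (i : ZMod 0) = some l ∧ l.inv = false ∧ l.path.length = 1
  right_tail : (∀ N : ℤ, ∃ i : ℤ, N < i ∧ w.dom (i : ZMod 0)) →
    ∃ N : ℤ, ∀ i : ℤ, N < i →
      ∃ l, w.letter (i : ZMod 0) = some l ∧ l.inv = true ∧ l.path.length = 1

/-- The walk is closed: it has `m > 0` letters, arranged in a cycle. Since the degrees are
indexed by `ZMod m`, it has as many direct as inverse letters. -/
def IsClosed (w : Walk Q m) : Prop := 0 < m ∧ ∀ i, w.dom i

/-- The walk is a homotopy band: closed, and not a proper power of a shorter walk. -/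
def IsBand (w : Walk Q m) : Prop :=
  w.IsClosed ∧ ∀ d : ℕ, d ∣ m → (∀ i, w.letter (i + d) = w.letter i) → d = m

/-- There is a direct letter to the right of position `i`. -/
def DirectAt (i : ZMod m) : Prop := ∃ l, w.letter i = some l ∧ l.inv = false

/-- There is an inverse letter to the right of position `i`. -/
def InverseAt (i : ZMod m) : Prop := ∃ l, w.letter i = some l ∧ l.inv = true

variable {k}

/-- The entry of the differential from position `i` to position `i + 1`: the letter between them,
with its coefficient, if this letter is direct, and `0` otherwise. -/
def fwd (χ : ZMod m → kˣ) (i : ZMod m) : Alg k Q :=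
  (w.letter i).elim 0 fun l => if l.inv then 0 else (χ i : k) • l.elt k

/-- The entry of the differential from position `i + 1` to position `i`: the path underlying the
letter between them, with its coefficient, if this letter is inverse, and `0` otherwise. -/
def bwd (χ : ZMod m → kˣ) (i : ZMod m) : Alg k Q :=
  (w.letter i).elim 0 fun l => if l.inv then (χ i : k) • l.elt k else 0

variable (k) in
/-- The term in degree `d`: the direct sum of the left ideals `P(x) = Λ e_x`, where `x` runs
through the vertices at the positions of degree `d`. Its elements are written as families
`z` with `z i ∈ Λ e_x` for `x = vtx i`, which vanish off these positions. (A homotopy string or a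
closed walk has only finitely many positions of each degree.) -/
def term (d : ℤ) : Submodule (Alg k Q) (ZMod m → Alg k Q) where
  carrier := {z | ∀ i, z i * idem k Q (w.vtx i) = z i ∧ (z i ≠ 0 → w.dom i ∧ w.deg i = d)}
  add_mem' := by
    intro x y hx hy i
    refine ⟨by simp [add_mul, (hx i).1, (hy i).1], fun h => ?_⟩
    by_cases h' : x i = 0
    · exact (hy i).2 (by simpa [h'] using h)
    · exact (hx i).2 h'
  zero_mem' := by intro i; simp
  smul_mem' := by
    intro c x hx i
    refine ⟨by simp [mul_assoc, (hx i).1], fun h => (hx i).2 fun h' => h ?_⟩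
    simp [h']

/-- The differential: multiplication from the right by the entries of the unfolded diagram. -/
def diff (χ : ZMod m → kˣ) : (ZMod m → Alg k Q) →ₗ[Alg k Q] (ZMod m → Alg k Q) where
  toFun z j := z (j - 1) * w.fwd χ (j - 1) + z (j + 1) * w.bwd χ j
  map_add' x y := by ext j; simp only [Pi.add_apply, add_mul]; abel
  map_smul' c x := by ext j; simp [mul_add, mul_assoc]

lemma fwd_mul_idem (χ : ZMod m → kˣ) (i : ZMod m) :
    w.fwd χ i * idem k Q (w.vtx (i + 1)) = w.fwd χ i := by
  unfold fwd
  rcases h : w.letter i with _ | l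
  · simp
  · rcases hl : l.inv
    · simp [hl, w.vtx_right i l h, Letter.right, Letter.elt_mul_idem]
    · simp [hl]

lemma bwd_mul_idem (χ : ZMod m → kˣ) (i : ZMod m) :
    w.bwd χ i * idem k Q (w.vtx i) = w.bwd χ i := by
  unfold bwd
  rcases h : w.letter i with _ | l
  · simp
  · rcases hl : l.inv
    · simp [hl]
    · simp [hl, w.vtx_left i l h, Letter.left, Letter.elt_mul_idem]

lemma of_fwd_ne (χ : ZMod m → kˣ) {i : ZMod m} (h : w.fwd χ i ≠ 0) :
    w.dom (i + 1) ∧ w.deg (i + 1) = w.deg i + 1 := by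
  unfold fwd at h
  rcases hi : w.letter i with _ | l
  · simp [hi] at h
  · rcases hl : l.inv
    · exact ⟨((w.letter_isSome i).1 (by simp [hi])).2, by simp [w.deg_step i l hi, hl]⟩
    · simp [hi, hl] at h

lemma of_bwd_ne (χ : ZMod m → kˣ) {i : ZMod m} (h : w.bwd χ i ≠ 0) :
    w.dom i ∧ w.deg i = w.deg (i + 1) + 1 := by
  unfold bwd at h
  rcases hi : w.letter i with _ | l
  · simp [hi] at h
  · rcases hl : l.inv
    · simp [hi, hl] at h
    · exact ⟨((w.letter_isSome i).1 (by simp [hi])).1, by simp [w.deg_step i l hi, hl]⟩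

lemma diff_mem (χ : ZMod m → kˣ) {d d' : ℤ} (hd : d + 1 = d') :
    ∀ z ∈ w.term k d, w.diff χ z ∈ w.term k d' := by
  intro z hz j
  have e1 := w.fwd_mul_idem χ (j - 1)
  rw [sub_add_cancel] at e1
  refine ⟨by simp [diff, add_mul, mul_assoc, e1, w.bwd_mul_idem χ j], fun h => ?_⟩
  by_cases h1 : z (j - 1) * w.fwd χ (j - 1) = 0
  · have h2 : z (j + 1) * w.bwd χ j ≠ 0 := by simpa [diff, h1] using h
    obtain ⟨a, b⟩ := w.of_bwd_ne χ (right_ne_zero_of_mul h2)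
    have c := ((hz (j + 1)).2 (left_ne_zero_of_mul h2)).2
    exact ⟨a, by rw [b, c, hd]⟩
  · obtain ⟨a, b⟩ := w.of_fwd_ne χ (right_ne_zero_of_mul h1)
    have c := ((hz (j - 1)).2 (left_ne_zero_of_mul h1)).2
    rw [sub_add_cancel] at a b
    exact ⟨a, by rw [b, c, hd]⟩

lemma fwd_mul_fwd (χ : ZMod m → kˣ) (i : ZMod m) : w.fwd χ i * w.fwd χ (i + 1) = 0 := by
  unfold fwd
  rcases h : w.letter i with _ | l
  · simp
  rcases h' : w.letter (i + 1) with _ | l'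
  · simp
  have := w.junction i l l' h h'
  rcases hl : l.inv <;> rcases hl' : l'.inv <;> simp [hl, hl']
  simp only [Letter.Junction, hl, hl'] at this
  simp [Letter.elt_mul_elt k this]

lemma bwd_mul_bwd (χ : ZMod m → kˣ) (i : ZMod m) : w.bwd χ (i + 1) * w.bwd χ i = 0 := by
  unfold bwd
  rcases h : w.letter i with _ | l
  · simp
  rcases h' : w.letter (i + 1) with _ | l'
  · simp
  have := w.junction i l l' h h'
  rcases hl : l.inv <;> rcases hl' : l'.inv <;> simp [hl, hl']
  simp only [Letter.Junction, hl, hl'] at this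
  simp [Letter.elt_mul_elt k this]

lemma fwd_mul_bwd (χ : ZMod m → kˣ) (i : ZMod m) : w.fwd χ i * w.bwd χ i = 0 := by
  unfold fwd bwd
  rcases w.letter i with _ | l
  · simp
  · rcases hl : l.inv <;> simp [hl]

lemma bwd_mul_fwd (χ : ZMod m → kˣ) (i : ZMod m) : w.bwd χ i * w.fwd χ i = 0 := by
  unfold fwd bwd
  rcases w.letter i with _ | l
  · simp
  · rcases hl : l.inv <;> simp [hl]

lemma diff_diff (χ : ZMod m → kˣ) (z : ZMod m → Alg k Q) : w.diff χ (w.diff χ z) = 0 := by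
  ext j
  have e1 := w.fwd_mul_fwd χ (j - 1 - 1)
  have e2 := w.bwd_mul_fwd χ (j - 1)
  have e3 := w.fwd_mul_bwd χ j
  have e4 := w.bwd_mul_bwd χ j
  rw [sub_add_cancel] at e1
  simp [diff, add_mul, mul_assoc, e1, e2, e3, e4]

/-- The complex of left `Λ`-modules with the unfolded diagram `w`, in which the letter to the right
of position `i` carries the coefficient `χ i`. -/
def complex (χ : ZMod m → kˣ) : CochainComplex (ModuleCat (Alg k Q)) ℤ where
  X d := ModuleCat.of (Alg k Q) (w.term k d)
  d i j := if h : i + 1 = j then ModuleCat.ofHom ((w.diff χ).restrict (w.diff_mem χ h)) else 0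
  shape i j h := dif_neg h
  d_comp_d' i j l hij hjl := by
    simp only [ComplexShape.up_Rel] at hij hjl
    rw [dif_pos hij, dif_pos hjl]
    ext z
    exact congrFun (w.diff_diff χ z.1) _

variable (k) in
/-- The string complex `P_σ` of a homotopy string (all coefficients are `1`). -/
def stringComplex (σ : Walk Q 0) : CochainComplex (ModuleCat (Alg k Q)) ℤ :=
  σ.complex (1 : ZMod 0 → kˣ)

/-- The coefficients of a band complex: `c` on the letter to the right of position `i`, and `1` on
all other letters. -/
def scalarAt (i : ZMod m) (c : kˣ) : ZMod m → kˣ := Pi.mulSingle i c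

/-- The band complex of a closed walk, with the scalar `c` placed on the letter to the right of
position `i`. -/
def bandComplex (i : ZMod m) (c : kˣ) : CochainComplex (ModuleCat (Alg k Q)) ℤ :=
  w.complex (scalarAt i c)

end Walk

/-- The right endpoint conditions of a quasi-graph map for `σ_R = x` and `τ_R = y`. -/
inductive EndRight : Option (Letter Q) → Option (Letter Q) → Prop
  /-- both are direct and `σ_R = τ_R τ'_R` -/
  | rq1 (x y : Letter Q) (hx : x.inv = false) (hy : y.inv = false) (p : List A) (hp : p ≠ [])
      (h : x.path = y.path ++ p) : EndRight (some x) (some y)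
  /-- both are inverse, `σ_R` inverse to `ω` and `τ_R` inverse to `ω' ω` -/
  | rq2 (x y : Letter Q) (hx : x.inv = true) (hy : y.inv = true) (p : List A) (hp : p ≠ [])
      (h : y.path = p ++ x.path) : EndRight (some x) (some y)
  /-- `σ_R` is inverse and `τ_R` is direct; one of them may be absent -/
  | rq3 (x y : Letter Q) (hx : x.inv = true) (hy : y.inv = false) : EndRight (some x) (some y)
  | rq3_left (x : Letter Q) (hx : x.inv = true) : EndRight (some x) none
  | rq3_right (y : Letter Q) (hy : y.inv = false) : EndRight none (some y)

/-- The left endpoint conditions for `σ_L = x` and `τ_L = y`: the mirror images of the right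
ones. -/
def EndLeft (x y : Option (Letter Q)) : Prop := EndRight (x.map Letter.bar) (y.map Letter.bar)

/-- `σ_R = x` and `τ_R = y` are compatibly oriented on the right. -/
def CompatRight (x y : Option (Letter Q)) : Prop :=
  (∀ l, x = some l → l.inv = true → y = none ∨ ∃ l', y = some l' ∧
    ((l'.inv = false ∧ ¬ Q.rel l.lst l'.hd) ∨
      (l'.inv = true ∧ ∃ p, p ≠ [] ∧ l'.path = p ++ l.path))) ∧
  (∀ l, x = some l → l.inv = false → ∃ l', y = some l' ∧ l'.inv = false ∧
    ∃ p, p ≠ [] ∧ l.path = l'.path ++ p) ∧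
  (x = none → ∃ l', y = some l' ∧ l'.inv = false)

/-- `σ_L = x` and `τ_L = y` are compatibly oriented on the left: the mirror image. -/
def CompatLeft (x y : Option (Letter Q)) : Prop :=
  CompatRight (x.map Letter.bar) (y.map Letter.bar)

/-- A quasi-graph map `Q_σ ⇝ Σ⁻¹ Q_τ`: an occurrence `σ = β σ_L ρ σ_R α`, `τ = δ τ_L ρ τ_R γ` of a
common homotopy substring `ρ` with `len` letters, which starts at position `a` of `σ` and at
position `b` of `τ`, lies in the same degrees of `σ` and of the shift of `τ`, and satisfies the
quasi-graph map endpoint conditions (these make `ρ` maximal). Thus `σ_L`, `σ_R` are the letters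
`a - 1` and `a + len` of `σ`, and `τ_L`, `τ_R` are the letters `b - 1` and `b + len` of `τ`. In a
closed walk, `σ_L ρ σ_R` has to fit into one turn. -/
structure QuasiGraphMap {m n : ℕ} (σ : Walk Q m) (τ : Walk Q n) where
  a : ℤ
  b : ℤ
  len : ℕ
  fits_left : 0 < m → len + 2 ≤ m
  fits_right : 0 < n → len + 2 ≤ n
  dom_left : σ.dom (a : ZMod m)
  dom_right : τ.dom (b : ZMod n)
  vtx_eq : σ.vtx (a : ZMod m) = τ.vtx (b : ZMod n)
  deg_eq : σ.deg (a : ZMod m) = τ.deg (b : ZMod n) + 1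
  overlap : ∀ t : ℕ, t < len → ∃ l,
    σ.letter ((a + t : ℤ) : ZMod m) = some l ∧ τ.letter ((b + t : ℤ) : ZMod n) = some l
  end_right : EndRight (σ.letter ((a + len : ℤ) : ZMod m)) (τ.letter ((b + len : ℤ) : ZMod n))
  end_left : EndLeft (σ.letter ((a - 1 : ℤ) : ZMod m)) (τ.letter ((b - 1 : ℤ) : ZMod n))

namespace QuasiGraphMap

variable {k} {m n : ℕ} {σ : Walk Q m} {τ : Walk Q n} (φ : QuasiGraphMap σ τ)

/-- `σ` and `τ` are compatibly oriented for `φ`: a condition only if `ρ` is trivial. -/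
def CompatiblyOriented : Prop :=
  φ.len = 0 →
    CompatLeft (σ.letter ((φ.a - 1 : ℤ) : ZMod m)) (τ.letter ((φ.b - 1 : ℤ) : ZMod n)) ∧
    CompatRight (σ.letter (φ.a : ZMod m)) (τ.letter (φ.b : ZMod n))

variable (χ : ZMod m → kˣ) (ψ : ZMod n → kˣ)

/-- The components next to the matched positions `φ.a + t` and `φ.b + t`, on their right: from
position `φ.a + t + 1` to `φ.b + t` along the letter of `σ` if this letter is inverse, and from
`φ.a + t` to `φ.b + t + 1` along the letter of `τ` if this letter is direct. For `t < len` this is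
the single component given by a letter of `ρ`; for `t = len` it is the single component `τ_R` if
`σ_R`, `τ_R` are direct, the single component `ω` if they are inverse, and if `σ_R` is inverse or
absent and `τ_R` direct or absent it is the pair of components `σ_R`, `τ_R`, or the one of them that
exists. -/
def rightComponents (t : ℕ) (z : ZMod m → Alg k Q) : ZMod n → Alg k Q :=
  let i : ZMod m := ((φ.a + t : ℤ) : ZMod m)
  let j : ZMod n := ((φ.b + t : ℤ) : ZMod n)
  Pi.single j (z (i + 1) * σ.bwd χ i) + Pi.single (j + 1) (z i * τ.fwd ψ j)

/-- The mirror image at the left end of `ρ`. -/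
def leftComponents (z : ZMod m → Alg k Q) : ZMod n → Alg k Q :=
  let i : ZMod m := (φ.a : ZMod m)
  let j : ZMod n := (φ.b : ZMod n)
  Pi.single j (z (i - 1) * σ.fwd χ (i - 1)) + Pi.single (j - 1) (z i * τ.bwd ψ (j - 1))

/-- The chain map `g` has the components prescribed by `F` in every degree. -/
def HasComponents (g : σ.complex χ ⟶ τ.complex ψ)
    (F : (ZMod m → Alg k Q) → (ZMod n → Alg k Q)) : Prop :=
  ∀ (d : ℤ) (z : σ.term k d),
    (show τ.term k d from (g.f d).hom (show (σ.complex χ).X d from z)).1 = F z.1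

/-- `g` is one of the single or double maps given by `φ`: its components are, up to a common
nonzero scalar, those given by a letter of `ρ` or by the right or the left end of `ρ`. -/
def IsSingleOrDouble (g : σ.complex χ ⟶ τ.complex ψ) : Prop :=
  ∃ c : kˣ,
    (∃ t : ℕ, t ≤ φ.len ∧ HasComponents χ ψ g fun z => (c : k) • φ.rightComponents χ ψ t z) ∨
    HasComponents χ ψ g fun z => (c : k) • φ.leftComponents χ ψ z

/-- `f` represents the homotopy class determined by `φ`. -/
def IsRepresentative (f : σ.complex χ ⟶ τ.complex ψ) : Prop :=
  ∃ g, φ.IsSingleOrDouble χ ψ g ∧ Nonempty (Homotopy f g)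

end QuasiGraphMap

/-- Isomorphism in the homotopy category of complexes of left `Λ`-modules. -/
def IsoK {R : Type*} [Ring R] (X Y : CochainComplex (ModuleCat R) ℤ) : Prop :=
  Nonempty ((HomotopyCategory.quotient (ModuleCat R) (ComplexShape.up ℤ)).obj X ≅
    (HomotopyCategory.quotient (ModuleCat R) (ComplexShape.up ℤ)).obj Y)

/-- The linear walk `c` passes at position `p` through the vertex `x` in degree `d`. -/
def Walk.Through (c : Walk Q 0) (p : ℤ) (x : V) (d : ℤ) : Prop :=
  c.dom (p : ZMod 0) ∧ c.vtx (p : ZMod 0) = x ∧ c.deg (p : ZMod 0) = d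

end Gentle

end

set_option linter.unusedSectionVars false

noncomputable section

namespace Gentle

/-! The cone of a suitable representative is, after a unipotent change of basis, the complex
obtained from `σ` and `τ` by crossing them over at the right end of `ρ`. Choice of representative: a
degree `-1` map with one scalar component between matched positions of `ρ` has as boundary the
components on the left of these positions plus those on the right. On a letter of `ρ` the components
to its left and to its right are proportional, so homotopies move any single or double map along `ρ`
to `e` times the map at its right end (`IsRepresentative.exists_homotopy`). Homotopic maps have
isomorphic cones in the homotopy category, so only this representative `g` has to be treated.
Crossing: let `X` and `Y` be the positions of `σ` and `τ` at the right end of `ρ`. They carry the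
same vertex and, in the cone, the same degree, so `τ_R` can be attached to `X` and `σ_R` to `Y`. The
new junctions are admissible: if `ρ` is nontrivial, its last letter precedes both continuations; if
`ρ` is trivial, this follows from compatible orientation, from gentleness and, where a letter is
missing, from `g` being a chain map, because a vanishing product of paths forces a relation
(`crossing_junction`). Change of basis: a map `N` from the terms of `τ` to those of `σ`, raising
degree by one, has alternating scalars along `ρ` and, beyond its ends, the paths by which the
neighbouring letters of the two walks differ (`exists_conjugator`). Two identities make `(x, y) ↦ (x
+ N y, y)` an isomorphism from the cone to the crossed complex: `N g` is exactly the part of the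
differential of `σ` along `σ_R`, and `N d + d N` vanishes except at the right end, where it is twice
the contribution needed for the new letters (`map_rightEnd`, `map_diff_add_diff_map`,
`nonempty_iso`). Reading off the result: crossing composes the successor permutation with a
transposition. Two lines give two lines, a line and a cycle give one line, and two cycles give one
cycle. Coefficients on a line can be scaled away. On a cycle only their product matters, with those
of inverse letters inverted; the shift signs on `σ`, which has an even number of letters, leave a
single `-1`, whence `-λμ⁻¹` (`prod_orient_crossingCoeff`). -/

variable {k : Type*} [Field k] {V A : Type*} [Fintype V] {Q : GentleQuiver V A}

/-! ### Diagrams: complexes of disjoint unions of walks -/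

/-- A disjoint union of walks: a permutation `next` of the set `P` of positions takes the place of
the successor function of a walk. -/
structure Diagram (Q : GentleQuiver V A) (P : Type) where
  next : Equiv.Perm P
  dom : P → Prop
  vtx : P → V
  deg : P → ℤ
  letter : P → Option (Letter Q)
  letter_isSome : ∀ i, (letter i).isSome ↔ dom i ∧ dom (next i)
  vtx_left : ∀ i l, letter i = some l → vtx i = l.left
  vtx_right : ∀ i l, letter i = some l → vtx (next i) = l.right
  deg_step : ∀ i l, letter i = some l → deg (next i) = deg i + (if l.inv then -1 else 1)
  junction : ∀ i l l', letter i = some l → letter (next i) = some l' → l.Junction l'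

namespace Diagram

variable {P : Type} (D : Diagram Q P)

/-- The entry of the differential from `i` to `next i`. -/
def fwd (χ : P → kˣ) (i : P) : Alg k Q :=
  (D.letter i).elim 0 fun l => if l.inv then 0 else (χ i : k) • l.elt k

/-- The entry of the differential from `next i` to `i`. -/
def bwd (χ : P → kˣ) (i : P) : Alg k Q :=
  (D.letter i).elim 0 fun l => if l.inv then (χ i : k) • l.elt k else 0

variable (k) in
/-- The term in degree `d` of the complex of a diagram. -/
def term (d : ℤ) : Submodule (Alg k Q) (P → Alg k Q) where
  carrier := {z | ∀ i, z i * idem k Q (D.vtx i) = z i ∧ (z i ≠ 0 → D.dom i ∧ D.deg i = d)}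
  add_mem' := by
    intro x y hx hy i
    refine ⟨by simp [add_mul, (hx i).1, (hy i).1], fun h => ?_⟩
    by_cases h' : x i = 0
    · exact (hy i).2 (by simpa [h'] using h)
    · exact (hx i).2 h'
  zero_mem' := by intro i; simp
  smul_mem' := by
    intro c x hx i
    refine ⟨by simp [mul_assoc, (hx i).1], fun h => (hx i).2 fun h' => h ?_⟩
    simp [h']

/-- The differential of the complex of a diagram. -/
def diff (χ : P → kˣ) : (P → Alg k Q) →ₗ[Alg k Q] (P → Alg k Q) where
  toFun z j := z (D.next.symm j) * D.fwd χ (D.next.symm j) + z (D.next j) * D.bwd χ j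
  map_add' x y := by ext j; simp only [Pi.add_apply, add_mul]; abel
  map_smul' c x := by ext j; simp [mul_add, mul_assoc]

lemma fwd_mul_idem (χ : P → kˣ) (i : P) :
    D.fwd χ i * idem k Q (D.vtx (D.next i)) = D.fwd χ i := by
  unfold fwd
  rcases h : D.letter i with _ | l
  · simp
  · rcases hl : l.inv
    · simp [hl, D.vtx_right i l h, Letter.right, Letter.elt_mul_idem]
    · simp [hl]

lemma bwd_mul_idem (χ : P → kˣ) (i : P) :
    D.bwd χ i * idem k Q (D.vtx i) = D.bwd χ i := by
  unfold bwd
  rcases h : D.letter i with _ | l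
  · simp
  · rcases hl : l.inv
    · simp [hl]
    · simp [hl, D.vtx_left i l h, Letter.left, Letter.elt_mul_idem]

lemma of_fwd_ne (χ : P → kˣ) {i : P} (h : D.fwd χ i ≠ 0) :
    D.dom (D.next i) ∧ D.deg (D.next i) = D.deg i + 1 := by
  unfold fwd at h
  rcases hi : D.letter i with _ | l
  · simp [hi] at h
  · rcases hl : l.inv
    · exact ⟨((D.letter_isSome i).1 (by simp [hi])).2, by simp [D.deg_step i l hi, hl]⟩
    · simp [hi, hl] at h

lemma of_bwd_ne (χ : P → kˣ) {i : P} (h : D.bwd χ i ≠ 0) :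
    D.dom i ∧ D.deg i = D.deg (D.next i) + 1 := by
  unfold bwd at h
  rcases hi : D.letter i with _ | l
  · simp [hi] at h
  · rcases hl : l.inv
    · simp [hi, hl] at h
    · exact ⟨((D.letter_isSome i).1 (by simp [hi])).1, by simp [D.deg_step i l hi, hl]⟩

lemma diff_mem (χ : P → kˣ) {d d' : ℤ} (hd : d + 1 = d') :
    ∀ z ∈ D.term k d, D.diff χ z ∈ D.term k d' := by
  intro z hz j
  have e1 := D.fwd_mul_idem χ (D.next.symm j)
  rw [Equiv.apply_symm_apply] at e1
  refine ⟨by simp [diff, add_mul, mul_assoc, e1, D.bwd_mul_idem χ j], fun h => ?_⟩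
  by_cases h1 : z (D.next.symm j) * D.fwd χ (D.next.symm j) = 0
  · have h2 : z (D.next j) * D.bwd χ j ≠ 0 := by simpa [diff, h1] using h
    obtain ⟨a, b⟩ := D.of_bwd_ne χ (right_ne_zero_of_mul h2)
    have c := ((hz (D.next j)).2 (left_ne_zero_of_mul h2)).2
    exact ⟨a, by rw [b, c, hd]⟩
  · obtain ⟨a, b⟩ := D.of_fwd_ne χ (right_ne_zero_of_mul h1)
    have c := ((hz (D.next.symm j)).2 (left_ne_zero_of_mul h1)).2
    rw [Equiv.apply_symm_apply] at a b
    exact ⟨a, by rw [b, c, hd]⟩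

lemma fwd_mul_fwd (χ : P → kˣ) (i : P) : D.fwd χ i * D.fwd χ (D.next i) = 0 := by
  unfold fwd
  rcases h : D.letter i with _ | l
  · simp
  rcases h' : D.letter (D.next i) with _ | l'
  · simp
  have := D.junction i l l' h h'
  rcases hl : l.inv <;> rcases hl' : l'.inv <;> simp [hl, hl']
  simp only [Letter.Junction, hl, hl'] at this
  simp [Letter.elt_mul_elt k this]

lemma bwd_mul_bwd (χ : P → kˣ) (i : P) : D.bwd χ (D.next i) * D.bwd χ i = 0 := by
  unfold bwd
  rcases h : D.letter i with _ | l
  · simp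
  rcases h' : D.letter (D.next i) with _ | l'
  · simp
  have := D.junction i l l' h h'
  rcases hl : l.inv <;> rcases hl' : l'.inv <;> simp [hl, hl']
  simp only [Letter.Junction, hl, hl'] at this
  simp [Letter.elt_mul_elt k this]

lemma fwd_mul_bwd (χ : P → kˣ) (i : P) : D.fwd χ i * D.bwd χ i = 0 := by
  unfold fwd bwd
  rcases D.letter i with _ | l
  · simp
  · rcases hl : l.inv <;> simp [hl]

lemma bwd_mul_fwd (χ : P → kˣ) (i : P) : D.bwd χ i * D.fwd χ i = 0 := by
  unfold fwd bwd
  rcases D.letter i with _ | l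
  · simp
  · rcases hl : l.inv <;> simp [hl]

lemma diff_diff (χ : P → kˣ) (z : P → Alg k Q) : D.diff χ (D.diff χ z) = 0 := by
  ext j
  have e1 := D.fwd_mul_fwd χ (D.next.symm (D.next.symm j))
  have e2 := D.bwd_mul_fwd χ (D.next.symm j)
  have e3 := D.fwd_mul_bwd χ j
  have e4 := D.bwd_mul_bwd χ j
  rw [Equiv.apply_symm_apply] at e1
  simp [diff, add_mul, mul_assoc, e1, e2, e3, e4]

/-- The complex of a diagram whose letters carry the coefficients `χ`. -/
def complex (χ : P → kˣ) : CochainComplex (ModuleCat (Alg k Q)) ℤ where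
  X d := ModuleCat.of (Alg k Q) (D.term k d)
  d i j := if h : i + 1 = j then ModuleCat.ofHom ((D.diff χ).restrict (D.diff_mem χ h)) else 0
  shape i j h := dif_neg h
  d_comp_d' i j l hij hjl := by
    simp only [ComplexShape.up_Rel] at hij hjl
    rw [dif_pos hij, dif_pos hjl]
    ext z
    exact congrFun (D.diff_diff χ z.1) _

lemma complex_d (χ : P → kˣ) {i j : ℤ} (h : i + 1 = j) :
    (D.complex χ).d i j = ModuleCat.ofHom ((D.diff χ).restrict (D.diff_mem χ h)) :=
  dif_pos h

variable {P' : Type} (D' : Diagram Q P')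

/-- The chain map given by a linear map of families which respects the terms and the
differentials. -/
def homOf (χ : P → kˣ) (χ' : P' → kˣ) (F : (P → Alg k Q) →ₗ[Alg k Q] (P' → Alg k Q))
    (hF : ∀ d, ∀ z ∈ D.term k d, F z ∈ D'.term k d)
    (hc : ∀ d, ∀ z ∈ D.term k d, D'.diff χ' (F z) = F (D.diff χ z)) :
    D.complex χ ⟶ D'.complex χ' where
  f d := ModuleCat.ofHom (F.restrict (hF d))
  comm' i j hij := by
    rw [complex_d _ _ hij, complex_d _ _ hij]
    ext z
    exact Subtype.ext (hc i z.1 z.2)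

/-- The isomorphism of complexes given by mutually inverse linear maps of families. -/
def isoOf (χ : P → kˣ) (χ' : P' → kˣ) (F : (P → Alg k Q) →ₗ[Alg k Q] (P' → Alg k Q))
    (G : (P' → Alg k Q) →ₗ[Alg k Q] (P → Alg k Q))
    (hF : ∀ d, ∀ z ∈ D.term k d, F z ∈ D'.term k d)
    (hG : ∀ d, ∀ z ∈ D'.term k d, G z ∈ D.term k d)
    (hc : ∀ d, ∀ z ∈ D.term k d, D'.diff χ' (F z) = F (D.diff χ z))
    (h1 : ∀ z, G (F z) = z) (h2 : ∀ z, F (G z) = z) :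
    D.complex χ ≅ D'.complex χ' where
  hom := homOf D D' χ χ' F hF hc
  -- Only the forward map is assumed to commute with the differentials; applying `G` to that
  -- identity at `G z` gives the same for `G`.
  inv := homOf D' D χ' χ G hG fun d z hz => by
    have := congrArg G (hc d (G z) (hG d z hz))
    rw [h1, h2] at this
    exact this.symm
  hom_inv_id := by
    ext d z
    exact Subtype.ext (h1 z.1)
  inv_hom_id := by
    ext d z
    exact Subtype.ext (h2 z.1)

end Diagram

namespace Walk

/-- A walk as a diagram with the positions `ZMod m`. -/
def toDiagram {m : ℕ} (w : Walk Q m) : Diagram Q (ZMod m) where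
  next := ⟨fun i => i + 1, fun i => i - 1, fun i => add_sub_cancel_right i 1,
    fun i => sub_add_cancel i 1⟩
  dom := w.dom
  vtx := w.vtx
  deg := w.deg
  letter := w.letter
  letter_isSome := w.letter_isSome
  vtx_left := w.vtx_left
  vtx_right := w.vtx_right
  deg_step := w.deg_step
  junction := w.junction

end Walk

/-! ### Letters and the path connecting two letters at an end of `ρ` -/

namespace Letter

variable (k) in
/-- The path of a direct letter, and `0` if the letter is inverse or absent. -/
def fw (X : Option (Letter Q)) : Alg k Q := X.elim 0 fun l => if l.inv then 0 else l.elt k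

variable (k) in
/-- The path of an inverse letter, and `0` if the letter is direct or absent. -/
def bw (X : Option (Letter Q)) : Alg k Q := X.elim 0 fun l => if l.inv then l.elt k else 0

lemma fw_bar (X : Option (Letter Q)) : fw k (X.map bar) = bw k X := by
  rcases X with _ | l
  · rfl
  · rcases hl : l.inv <;> simp [fw, bw, bar, hl, elt]

lemma bw_bar (X : Option (Letter Q)) : bw k (X.map bar) = fw k X := by
  rcases X with _ | l
  · rfl
  · rcases hl : l.inv <;> simp [fw, bw, bar, hl, elt]

lemma junction_bar {l l' : Letter Q} : l'.bar.Junction l.bar ↔ l.Junction l' := by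
  rcases hl : l.inv <;> rcases hl' : l'.inv <;> simp [Junction, bar, hl, hl', hd, lst, ne_comm]

lemma left_bar (l : Letter Q) : l.bar.left = l.right := by
  rcases hl : l.inv <;> simp [left, right, bar, hl, hd, lst]

lemma right_bar (l : Letter Q) : l.bar.right = l.left := by
  rcases hl : l.inv <;> simp [left, right, bar, hl, hd, lst]

lemma exists_of_append {p q : List A} (hp : p ≠ []) (hq : q ≠ [])
    (h : List.IsChain (fun b a => Q.s b = Q.e a ∧ ¬ Q.rel b a) (p ++ q)) :
    ∃ P R : Letter Q, P.path = p ∧ R.path = q ∧ Q.s P.lst = Q.e R.hd ∧ ¬ Q.rel P.lst R.hd := by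
  rw [List.isChain_append] at h
  refine ⟨⟨false, p, hp, h.1⟩, ⟨false, q, hq, h.2.1⟩, rfl, rfl, ?_⟩
  exact h.2.2 _ (List.getLast_mem_getLast? hp) _ (List.head_mem_head? hq)

lemma hd_congr {l l' : Letter Q} (h : l.path = l'.path) : l.hd = l'.hd := by
  simp [hd, h]

lemma lst_congr {l l' : Letter Q} (h : l.path = l'.path) : l.lst = l'.lst := by
  simp [lst, h]

lemma elt_append {l l' m : Letter Q} (h : m.path = l.path ++ l'.path) :
    m.elt k = l.elt k * l'.elt k := by
  simp [elt, h]

lemma hd_append {l l' m : Letter Q} (h : m.path = l.path ++ l'.path) : m.hd = l.hd := by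
  simp [hd, h, List.head_append_of_ne_nil l.ne]

lemma lst_append {l l' m : Letter Q} (h : m.path = l.path ++ l'.path) : m.lst = l'.lst := by
  simp [lst, h, List.getLast_append_of_ne_nil _ l'.ne]

end Letter

/-- The element `r` is the path by which the two letters differ: `τ'_R` in the first endpoint
condition, `ω'` in the second, rescaled by the ratio of the coefficients, and `0` in the third. The
annihilation clauses ensure that `r` creates no components beyond the next letters. One of them is a
relation already present at a junction; the other comes from gentleness, since at most one arrow
continues a given arrow without a relation and the junction condition excludes that arrow. -/
lemma EndRight.exists_connector {X Y : Option (Letter Q)} (h : EndRight X Y) (χ ψ : kˣ) :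
    ∃ r : Alg k Q, ((ψ : k) • Letter.fw k Y) * r = (χ : k) • Letter.fw k X ∧
      r * ((χ : k) • Letter.bw k X) = (ψ : k) • Letter.bw k Y ∧
      (r = 0 ∨ ∃ x y, X = some x ∧ Y = some y ∧ x.inv = y.inv ∧ r * idem k Q x.right = r ∧
        (∀ l : Letter Q, y.right = l.left → y.Junction l → Letter.bw k (some l) * r = 0) ∧
        (∀ l : Letter Q, x.right = l.left → x.Junction l → r * Letter.fw k (some l) = 0)) := by
  rcases h with ⟨x, y, hx, hy, p, hp, h⟩ | ⟨x, y, hx, hy, p, hp, h⟩ | ⟨x, y, hx, hy⟩ | ⟨x, hx⟩ |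
    ⟨y, hy⟩
  · obtain ⟨P, R, hP, hR, hs, hn⟩ := Letter.exists_of_append y.ne hp (h ▸ x.chain)
    have hx' : x.path = y.path ++ R.path := by rw [h, hR]
    rw [Letter.lst_congr hP] at hs hn
    refine ⟨((χ / ψ : kˣ) : k) • R.elt k, ?_, ?_,
      Or.inr ⟨x, y, rfl, rfl, by rw [hx, hy], ?_, ?_, ?_⟩⟩
    · simp [Letter.fw, hx, hy, Letter.elt_append (k := k) hx', smul_smul]
    · simp [Letter.bw, hx, hy]
    · simp [Letter.right, hx, Letter.lst_append hx', Letter.elt_mul_idem]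
    · intro l hv hj
      rcases hl : l.inv
      · simp [Letter.bw, hl]
      · simp only [Letter.Junction, Letter.right, Letter.left, hl, hy] at hj hv
        -- Both `y.lst` and `l.lst` compose with `R.hd`, and `y.lst` does so without a relation. If
        -- `l.lst` did too, uniqueness would make the two arrows equal, which the junction `y l`
        -- forbids.
        have : Q.rel l.lst R.hd := by
          by_contra h'
          exact hj (Q.nonrel_left R.hd ⟨hs, hn⟩ ⟨by simpa [← hs] using hv.symm, h'⟩)
        simp [Letter.bw, hl, Letter.elt_mul_elt k this]
    · intro l hv hj
      rcases hl : l.inv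
      · simp only [Letter.Junction, hl, hx, Letter.lst_append hx'] at hj
        simp [Letter.fw, hl, Letter.elt_mul_elt k hj]
      · simp [Letter.fw, hl]
  · obtain ⟨R, P, hR, hP, hs, hn⟩ := Letter.exists_of_append hp x.ne (h ▸ y.chain)
    have hy' : y.path = R.path ++ x.path := by rw [h, hR]
    rw [Letter.hd_congr hP] at hs hn
    refine ⟨((ψ / χ : kˣ) : k) • R.elt k, ?_, ?_,
      Or.inr ⟨x, y, rfl, rfl, by rw [hx, hy], ?_, ?_, ?_⟩⟩
    · simp [Letter.fw, hx, hy]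
    · simp [Letter.bw, hx, hy, Letter.elt_append (k := k) hy', smul_smul,
        mul_div_cancel₀]
    · simp [Letter.right, hx, ← hs, Letter.elt_mul_idem]
    · intro l hv hj
      rcases hl : l.inv
      · simp [Letter.bw, hl]
      · simp only [Letter.Junction, hl, hy, Letter.hd_append hy'] at hj
        simp [Letter.bw, hl, Letter.elt_mul_elt k hj]
    · intro l hv hj
      rcases hl : l.inv
      · simp only [Letter.Junction, Letter.right, Letter.left, hl, hx] at hj hv
        have : Q.rel R.lst l.hd := by
          by_contra h'
          exact hj (Q.nonrel_right R.lst ⟨hs, hn⟩ ⟨by simpa [hs] using hv, h'⟩)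
        simp [Letter.fw, hl, Letter.elt_mul_elt k this]
      · simp [Letter.fw, hl]
  · exact ⟨0, by simp [Letter.fw, hx], by simp [Letter.bw, hy], Or.inl rfl⟩
  · exact ⟨0, by simp [Letter.fw, hx], by simp [Letter.bw], Or.inl rfl⟩
  · exact ⟨0, by simp [Letter.fw], by simp [Letter.bw, hy], Or.inl rfl⟩

/-! ### Paths avoiding the relations are nonzero in the algebra -/

section ShiftRepresentation

variable (Q)

/-- The action of the generators of `Λ` on `ℕ → k` by truncated shifts, for a walk along arrows
`step i` from the vertex `v i` to the vertex `v (i + 1)`. -/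
def shiftAction (k : Type*) [Field k] (step : ℕ → Option A) (v : ℕ → V) :
    V ⊕ A → Module.End k (ℕ → k) := by
  classical
  exact Sum.elim
    (fun x => LinearMap.pi fun i => if v i = x then LinearMap.proj i else 0)
    (fun a => LinearMap.pi fun i => if i ≠ 0 ∧ step (i - 1) = some a then LinearMap.proj (i - 1)
      else 0)

/-- Each index lies over exactly one vertex, so the idempotents act as orthogonal projections with
sum `1`; a product of two arrows acts nontrivially only where they are consecutive steps, which is
never the case for a pair with a relation. -/
lemma shiftAction_rel {step : ℕ → Option A} {v : ℕ → V}
    (h1 : ∀ i a, step i = some a → v i = Q.s a ∧ v (i + 1) = Q.e a)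
    (h2 : ∀ i a b, step i = some a → step (i + 1) = some b → ¬ Q.rel b a)
    {x y : FreeAlgebra k (V ⊕ A)} (h : PathRel k Q x y) :
    FreeAlgebra.lift k (shiftAction k step v) x = FreeAlgebra.lift k (shiftAction k step v) y := by
  classical
  rcases h with x | ⟨x, y, hxy⟩ | _ | a | a | ⟨b, a, hr⟩
  · ext f i
    by_cases h : v i = x <;> simp [shiftAction, h]
  · ext f i
    by_cases h : v i = x
    · have : v i ≠ y := fun h' => hxy (h.symm.trans h')
      simp [shiftAction, h, hxy]
    · simp [shiftAction, h]
  · ext f i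
    simp only [shiftAction, map_sum, FreeAlgebra.lift_ι_apply, Sum.elim_inl, map_one,
      LinearMap.sum_apply, Finset.sum_apply, LinearMap.pi_apply, Module.End.one_apply]
    rw [Finset.sum_eq_single (v i)]
    · simp
    · intro b _ hb
      simp [hb.symm]
    · simp
  · ext f i
    by_cases h : i ≠ 0 ∧ step (i - 1) = some a
    · have := (h1 _ _ h.2).2
      rw [Nat.sub_add_cancel (Nat.pos_of_ne_zero h.1)] at this
      simp [shiftAction, h, this]
    · by_cases hv : v i = Q.e a <;> simp [shiftAction, h, hv]
  · ext f i
    by_cases h : i ≠ 0 ∧ step (i - 1) = some a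
    · simp [shiftAction, h, (h1 _ _ h.2).1]
    · simp [shiftAction, h]
  · ext f i
    by_cases h : i ≠ 0 ∧ step (i - 1) = some b
    · by_cases h' : i - 1 ≠ 0 ∧ step (i - 1 - 1) = some a
      · refine absurd hr (h2 _ _ _ h'.2 ?_)
        rw [Nat.sub_add_cancel (Nat.pos_of_ne_zero h'.1)]
        exact h.2
      · simp [shiftAction, h, h']
    · simp [shiftAction, h]

end ShiftRepresentation

variable (k) in
/-- A path of `Q` which avoids the relations is nonzero in `Λ`. -/
lemma Letter.elt_ne_zero (l : Letter Q) : l.elt k ≠ 0 := by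
  classical
  set q := l.path.reverse with hq
  have hc : List.IsChain (fun a b => Q.s b = Q.e a ∧ ¬ Q.rel b a) q := by
    rw [hq, List.isChain_reverse]; exact l.chain
  -- The list is reversed because its last arrow acts first. All indices from the end of the path
  -- onwards lie over its target vertex; no arrow starts there in the representation.
  let v : ℕ → V := fun i => (q[i]?).elim (Q.e l.hd) Q.s
  have h0 : ∀ i a b, q[i]? = some a → q[i + 1]? = some b → Q.s b = Q.e a ∧ ¬ Q.rel b a := by
    intro i a b ha hb
    obtain ⟨hb1, hb2⟩ := List.getElem?_eq_some_iff.1 hb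
    obtain ⟨ha1, ha2⟩ := List.getElem?_eq_some_iff.1 ha
    have := List.isChain_iff_getElem.1 hc i hb1
    rwa [ha2, hb2] at this
  have h1 : ∀ i a, q[i]? = some a → v i = Q.s a ∧ v (i + 1) = Q.e a := by
    intro i a ha
    refine ⟨by simp [v, ha], ?_⟩
    rcases hb : q[i + 1]? with _ | b
    · obtain ⟨ha1, ha2⟩ := List.getElem?_eq_some_iff.1 ha
      have hi : i = q.length - 1 := by
        have := List.getElem?_eq_none_iff.1 hb
        omega
      have : a = l.hd := by
        rw [← ha2, Letter.hd]
        simp only [hq, List.getElem_reverse, List.head_eq_getElem]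
        congr 1
        simp only [hq, List.length_reverse] at hi ha1
        omega
      simp [v, hb, this]
    · simp [v, hb, (h0 i a b ha hb).1]
  let Φ : Alg k Q →ₐ[k] Module.End k (ℕ → k) :=
    RingQuot.liftAlgHom k ⟨FreeAlgebra.lift k (shiftAction k (fun i => q[i]?) v), fun _ _ h =>
      shiftAction_rel Q h1 (fun i a b ha hb => (h0 i a b ha hb).2) h⟩
  have hΦ : ∀ a, Φ (arrow k Q a) = shiftAction k (fun i => q[i]?) v (Sum.inr a) := by
    intro a
    simp [Φ, arrow]
  -- A terminal segment `p` of the path moves the basis vector at `0` to the one at `p.length`, so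
  -- the whole path does not act by zero.
  have key : ∀ (p : List A) (p' : List A), l.path = p' ++ p →
      Φ (p.map (arrow k Q)).prod (Pi.single 0 1) = Pi.single p.length 1 := by
    intro p
    induction p with
    | nil => intro p' _; simp
    | cons a p ih =>
      intro p' hp
      have ha : q[p.length]? = some a := by
        rw [hq, hp]; simp
      rw [List.map_cons, List.prod_cons, map_mul, Module.End.mul_apply,
        ih (p' ++ [a]) (by simp [hp]), hΦ]
      ext i
      rcases i with _ | i
      · simp [shiftAction]
      · by_cases hi : i = p.length
        · simp [shiftAction, hi, ha]
        · by_cases hs : q[i]? = some a <;> simp [shiftAction, hs, hi]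
  intro h
  have := key l.path [] rfl
  rw [← Letter.elt, h, map_zero] at this
  simpa using congrFun this l.path.length

/-! ### Moving a representative to the right end of `ρ` -/

namespace Walk

variable {m : ℕ} (w : Walk Q m) (χ : ZMod m → kˣ)

lemma fwd_eq (i : ZMod m) : w.fwd χ i = (χ i : k) • Letter.fw k (w.letter i) := by
  unfold fwd Letter.fw
  rcases w.letter i with _ | l
  · simp
  · rcases hl : l.inv <;> simp [hl]

lemma bwd_eq (i : ZMod m) : w.bwd χ i = (χ i : k) • Letter.bw k (w.letter i) := by
  unfold bwd Letter.bw
  rcases w.letter i with _ | l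
  · simp
  · rcases hl : l.inv <;> simp [hl]

lemma diff_apply (z : ZMod m → Alg k Q) (j : ZMod m) :
    w.diff χ z j = z (j - 1) * w.fwd χ (j - 1) + z (j + 1) * w.bwd χ j := rfl

lemma diff_single (q : ZMod m) (u : Alg k Q) : w.diff χ (Pi.single q u) =
    Pi.single (q + 1) (u * w.fwd χ q) + Pi.single (q - 1) (u * w.bwd χ (q - 1)) := by
  ext j
  rw [diff_apply, Pi.add_apply]
  congr 1
  · by_cases h : j - 1 = q
    · have : j = q + 1 := by rw [← h, sub_add_cancel]
      simp [this]
    · have : j ≠ q + 1 := fun h' => h (by rw [h', add_sub_cancel_right])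
      simp [h, this]
  · by_cases h : j + 1 = q
    · have : j = q - 1 := by rw [← h, add_sub_cancel_right]
      simp [this]
    · have : j ≠ q - 1 := fun h' => h (by rw [h', sub_add_cancel])
      simp [h, this]

lemma complex_d {i j : ℤ} (h : i + 1 = j) :
    (w.complex χ).d i j = ModuleCat.ofHom ((w.diff χ).restrict (w.diff_mem χ h)) :=
  dif_pos h

end Walk

namespace QuasiGraphMap

variable {m n : ℕ} {σ : Walk Q m} {τ : Walk Q n} (φ : QuasiGraphMap σ τ)

/-- The position of `σ` at distance `t` from the beginning of `ρ`. -/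
def pos (t : ℤ) : ZMod m := ((φ.a + t : ℤ) : ZMod m)

/-- The position of `τ` at distance `t` from the beginning of `ρ`. -/
def pos' (t : ℤ) : ZMod n := ((φ.b + t : ℤ) : ZMod n)

lemma pos_add_one (t : ℤ) : φ.pos t + 1 = φ.pos (t + 1) := by
  simp [pos, add_assoc]

lemma pos'_add_one (t : ℤ) : φ.pos' t + 1 = φ.pos' (t + 1) := by
  simp [pos', add_assoc]

lemma pos_sub_one (t : ℤ) : φ.pos t - 1 = φ.pos (t - 1) := by
  simp [pos, add_sub_assoc]

lemma pos'_sub_one (t : ℤ) : φ.pos' t - 1 = φ.pos' (t - 1) := by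
  simp [pos', add_sub_assoc]

lemma pos_zero : φ.pos 0 = (φ.a : ZMod m) := by simp [pos]

lemma pos'_zero : φ.pos' 0 = (φ.b : ZMod n) := by simp [pos']

lemma letter_overlap {t : ℕ} (ht : t < φ.len) : ∃ l,
    σ.letter (φ.pos t) = some l ∧ τ.letter (φ.pos' t) = some l := φ.overlap t ht

lemma letter_eq {t : ℕ} (ht : t < φ.len) : σ.letter (φ.pos t) = τ.letter (φ.pos' t) := by
  obtain ⟨l, h, h'⟩ := φ.letter_overlap ht
  rw [h, h']

lemma matched {t : ℕ} (ht : t ≤ φ.len) : σ.dom (φ.pos t) ∧ τ.dom (φ.pos' t) ∧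
    σ.vtx (φ.pos t) = τ.vtx (φ.pos' t) ∧ σ.deg (φ.pos t) = τ.deg (φ.pos' t) + 1 := by
  induction t with
  | zero =>
    rw [Nat.cast_zero, pos_zero, pos'_zero]
    exact ⟨φ.dom_left, φ.dom_right, φ.vtx_eq, φ.deg_eq⟩
  | succ t ih =>
    obtain ⟨l, h, h'⟩ := φ.letter_overlap ht
    have e := (σ.letter_isSome (φ.pos t)).1 (by simp [h])
    have e' := (τ.letter_isSome (φ.pos' t)).1 (by simp [h'])
    have v := σ.vtx_right _ _ h
    have v' := τ.vtx_right _ _ h'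
    have d := σ.deg_step _ _ h
    have d' := τ.deg_step _ _ h'
    rw [pos_add_one] at e v d
    rw [pos'_add_one] at e' v' d'
    rw [Nat.cast_succ]
    refine ⟨e.2, e'.2, v.trans v'.symm, ?_⟩
    rw [d, d', (ih (by omega)).2.2.2]
    ring

variable (χ : ZMod m → kˣ) (ψ : ZMod n → kˣ)

lemma rightComponents_eq (t : ℕ) (z : ZMod m → Alg k Q) : φ.rightComponents χ ψ t z =
    Pi.single (φ.pos' t) (z (φ.pos (t + 1)) * σ.bwd χ (φ.pos t)) +
      Pi.single (φ.pos' (t + 1)) (z (φ.pos t) * τ.fwd ψ (φ.pos' t)) := by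
  rw [← pos_add_one, ← pos'_add_one]
  rfl

/-- The components next to the matched positions `φ.pos t` and `φ.pos' t`, on their left. -/
def leftComponentsAt (t : ℤ) (z : ZMod m → Alg k Q) : ZMod n → Alg k Q :=
  Pi.single (φ.pos' t) (z (φ.pos (t - 1)) * σ.fwd χ (φ.pos (t - 1))) +
    Pi.single (φ.pos' (t - 1)) (z (φ.pos t) * τ.bwd ψ (φ.pos' (t - 1)))

lemma leftComponents_eq (z : ZMod m → Alg k Q) :
    φ.leftComponents χ ψ z = φ.leftComponentsAt χ ψ 0 z := by
  unfold leftComponentsAt leftComponents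
  rw [← pos_sub_one, ← pos'_sub_one, pos_zero, pos'_zero]

/-- Up to a scalar, the components to the left and to the right of a letter of `ρ` agree. -/
lemma exists_leftComponentsAt_eq {t : ℕ} (ht : t < φ.len) : ∃ c : kˣ, ∀ z,
    φ.rightComponents χ ψ t z = (c : k) • φ.leftComponentsAt χ ψ (t + 1) z := by
  obtain ⟨l, h, h'⟩ := φ.letter_overlap ht
  rcases hl : l.inv
  · refine ⟨ψ (φ.pos' t) / χ (φ.pos t), fun z => ?_⟩
    rw [rightComponents_eq, leftComponentsAt, add_sub_cancel_right, σ.fwd_eq, τ.fwd_eq, σ.bwd_eq,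
      τ.bwd_eq, h, h']
    simp only [Letter.fw, Letter.bw, Option.elim, hl]
    simp [← Pi.single_smul, smul_smul]
  · refine ⟨χ (φ.pos t) / ψ (φ.pos' t), fun z => ?_⟩
    rw [rightComponents_eq, leftComponentsAt, add_sub_cancel_right, σ.fwd_eq, τ.fwd_eq, σ.bwd_eq,
      τ.bwd_eq, h, h']
    simp only [Letter.fw, Letter.bw, Option.elim, hl]
    simp [← Pi.single_smul, smul_smul]

/-- The map with the only component `e`, from `φ.pos t` to `φ.pos' t`. -/
def matching (e : k) (t : ℤ) : (ZMod m → Alg k Q) →ₗ[Alg k Q] (ZMod n → Alg k Q) where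
  toFun z := Pi.single (φ.pos' t) (e • z (φ.pos t))
  map_add' x y := by simp [Pi.single_add]
  map_smul' c x := by
    rw [RingHom.id_apply, ← Pi.single_smul, Pi.smul_apply, smul_comm]

lemma matching_mem (e : k) {t : ℕ} (ht : t ≤ φ.len) {i j : ℤ} (hij : j + 1 = i) :
    ∀ z ∈ σ.term k i, φ.matching e t z ∈ τ.term k j := by
  intro z hz q
  obtain ⟨-, h2, h3, h4⟩ := φ.matched ht
  by_cases hq : q = φ.pos' t
  · subst hq
    simp only [matching, LinearMap.coe_mk, AddHom.coe_mk, Pi.single_eq_same]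
    refine ⟨by rw [← h3, smul_mul_assoc, (hz _).1], fun h => ⟨h2, ?_⟩⟩
    have := ((hz (φ.pos t)).2 fun h' => h (by rw [h', smul_zero])).2
    omega
  · simp [matching, hq]

/-- The boundary of the one-component map `matching` lives only on the letters adjacent to the
matched positions, and it is the sum of the left and the right components there. Subtracting it
allows one side to be traded for the other. -/
lemma exists_homotopy (g : σ.complex χ ⟶ τ.complex ψ)
    {F : (ZMod m → Alg k Q) → (ZMod n → Alg k Q)} (hg : HasComponents χ ψ g F) (e : k) {t : ℕ}
    (ht : t ≤ φ.len) : ∃ g' : σ.complex χ ⟶ τ.complex ψ, Nonempty (Homotopy g g') ∧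
      HasComponents χ ψ g' fun z =>
        F z - e • (φ.leftComponentsAt χ ψ t z + φ.rightComponents χ ψ t z) := by
  let h : ∀ i j : ℤ, (ComplexShape.up ℤ).Rel j i → ((σ.complex χ).X i ⟶ (τ.complex ψ).X j) :=
    fun i j hij => ModuleCat.ofHom ((φ.matching e t).restrict (φ.matching_mem e ht hij))
  refine ⟨g - Homotopy.nullHomotopicMap' h, ⟨(Homotopy.equivSubZero).symm ?_⟩, ?_⟩
  · rw [sub_sub_cancel]
    exact Homotopy.nullHomotopy' h
  · intro d z
    have e1 : (ComplexShape.up ℤ).Rel d (d + 1) := rfl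
    have e2 : (ComplexShape.up ℤ).Rel (d - 1) d := sub_add_cancel d 1
    have e3 : (Homotopy.nullHomotopicMap' h).f d =
        ModuleCat.ofHom (((φ.matching e t).restrict (φ.matching_mem e ht e1)).comp
          ((σ.diff χ).restrict (σ.diff_mem χ e1)) + ((τ.diff ψ).restrict (τ.diff_mem ψ e2)).comp
          ((φ.matching e t).restrict (φ.matching_mem e ht e2))) := by
      rw [Homotopy.nullHomotopicMap'_f e2 e1, Walk.complex_d _ _ e1, Walk.complex_d _ _ e2]
      rfl
    have e4 : φ.matching e t (σ.diff χ z.1) + τ.diff ψ (φ.matching e t z.1) =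
        e • (φ.leftComponentsAt χ ψ t z.1 + φ.rightComponents χ ψ t z.1) := by
      simp only [matching, LinearMap.coe_mk, AddHom.coe_mk, Walk.diff_apply, Walk.diff_single,
        rightComponents_eq, leftComponentsAt, pos_add_one, pos'_add_one, pos_sub_one, pos'_sub_one,
        smul_add, ← Pi.single_smul, Pi.single_add, smul_mul_assoc]
      abel
    have e5 := hg d z
    simp only at e5
    change _ = F z.1 - e • (φ.leftComponentsAt χ ψ t z.1 + φ.rightComponents χ ψ t z.1)
    rw [← e4, ← e5, HomologicalComplex.sub_f_apply, e3]
    rfl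

lemma HasComponents.congr {g : σ.complex χ ⟶ τ.complex ψ}
    {F F' : (ZMod m → Alg k Q) → (ZMod n → Alg k Q)} (hg : HasComponents χ ψ g F)
    (h : ∀ z, F z = F' z) : HasComponents χ ψ g F' := funext h ▸ hg

/-- Taking the homotopy with the same scalar `e` cancels the left components and leaves `-e` times
the right ones. -/
lemma exists_rightComponents_of_left (g : σ.complex χ ⟶ τ.complex ψ) (e : kˣ) {t : ℕ}
    (ht : t ≤ φ.len)
    (hg : HasComponents χ ψ g fun z => (e : k) • φ.leftComponentsAt χ ψ t z) :
    ∃ (g' : σ.complex χ ⟶ τ.complex ψ) (e' : kˣ), Nonempty (Homotopy g g') ∧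
      HasComponents χ ψ g' fun z => (e' : k) • φ.rightComponents χ ψ t z := by
  obtain ⟨g', h, hg'⟩ := φ.exists_homotopy χ ψ g hg e ht
  refine ⟨g', -e, h, hg'.congr χ ψ fun z => ?_⟩
  rw [smul_add, sub_add_cancel_left, Units.val_neg]
  exact (neg_smul _ _).symm

/-- Induction on the distance `s` to the end of `ρ`: the right components at `t` are a multiple of
the left components at `t + 1`, which are homotopic to a multiple of the right components at `t +
1`. -/
lemma exists_rightComponents (s : ℕ) : ∀ (g : σ.complex χ ⟶ τ.complex ψ) (e : kˣ) (t : ℕ),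
    t + s = φ.len → HasComponents χ ψ g (fun z => (e : k) • φ.rightComponents χ ψ t z) →
    ∃ (g' : σ.complex χ ⟶ τ.complex ψ) (e' : kˣ), Nonempty (Homotopy g g') ∧
      HasComponents χ ψ g' fun z => (e' : k) • φ.rightComponents χ ψ φ.len z := by
  induction s with
  | zero =>
    intro g e t ht hg
    rw [add_zero] at ht
    subst ht
    exact ⟨g, e, ⟨Homotopy.refl g⟩, hg⟩
  | succ s ih =>
    intro g e t ht hg
    obtain ⟨c, hc⟩ := φ.exists_leftComponentsAt_eq χ ψ (t := t) (by omega)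
    have hg' : HasComponents χ ψ g fun z =>
        ((e * c : kˣ) : k) • φ.leftComponentsAt χ ψ ((t + 1 : ℕ) : ℤ) z :=
      hg.congr χ ψ fun z => by rw [hc, smul_smul, Units.val_mul, Nat.cast_succ]
    obtain ⟨g₁, e₁, ⟨h₁⟩, hg₁⟩ :=
      φ.exists_rightComponents_of_left χ ψ g (e * c) (t := t + 1) (by omega) hg'
    obtain ⟨g₂, e₂, ⟨h₂⟩, hg₂⟩ := ih g₁ e₁ (t + 1) (by omega) hg₁
    exact ⟨g₂, e₂, ⟨h₁.trans h₂⟩, hg₂⟩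

/-- Every representative of the homotopy class is homotopic to a multiple of the map at the right
end of `ρ`. -/
lemma IsRepresentative.exists_homotopy {φ : QuasiGraphMap σ τ} {χ : ZMod m → kˣ}
    {ψ : ZMod n → kˣ} {f : σ.complex χ ⟶ τ.complex ψ} (hf : φ.IsRepresentative χ ψ f) :
    ∃ (g : σ.complex χ ⟶ τ.complex ψ) (e : kˣ), Nonempty (Homotopy f g) ∧
      HasComponents χ ψ g fun z => (e : k) • φ.rightComponents χ ψ φ.len z := by
  obtain ⟨g, ⟨c, h⟩, ⟨H⟩⟩ := hf
  rcases h with ⟨t, ht, hg⟩ | hg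
  · obtain ⟨g', e, ⟨H'⟩, hg'⟩ := φ.exists_rightComponents χ ψ (φ.len - t) g c t (by omega) hg
    exact ⟨g', e, ⟨H.trans H'⟩, hg'⟩
  · have hg₀ : HasComponents χ ψ g fun z => (c : k) • φ.leftComponentsAt χ ψ ((0 : ℕ) : ℤ) z :=
      hg.congr χ ψ fun z => by rw [leftComponents_eq, Nat.cast_zero]
    obtain ⟨g₁, e₁, ⟨H₁⟩, hg₁⟩ :=
      φ.exists_rightComponents_of_left χ ψ g c (t := 0) (by omega) hg₀
    obtain ⟨g₂, e₂, ⟨H₂⟩, hg₂⟩ := φ.exists_rightComponents χ ψ φ.len g₁ e₁ 0 (by omega) hg₁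
    exact ⟨g₂, e₂, ⟨(H.trans H₁).trans H₂⟩, hg₂⟩

end QuasiGraphMap

/-! ### Admissibility of the new junctions -/

lemma Letter.bar_bar (l : Letter Q) : l.bar.bar = l := by simp [Letter.bar]

lemma Letter.map_bar_map_bar (X : Option (Letter Q)) : (X.map Letter.bar).map Letter.bar = X := by
  rcases X with _ | l <;> simp [Letter.bar_bar]

/-- Letters of equal orientation allowed by an endpoint condition differ only at their far ends; a
junction on the left sees the near end, where they share an arrow. -/
lemma EndRight.junction_iff {x y : Letter Q} (h : EndRight (some x) (some y))
    (hi : x.inv = y.inv) (l : Letter Q) : l.Junction x ↔ l.Junction y := by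
  rcases h with ⟨_, _, hx, hy, p, hp, h⟩ | ⟨_, _, hx, hy, p, hp, h⟩ | ⟨_, _, hx, hy⟩
  · have : x.hd = y.hd := by simp [Letter.hd, h, List.head_append_of_ne_nil y.ne]
    rcases hl : l.inv <;> simp [Letter.Junction, hx, hy, hl, this]
  · have : x.lst = y.lst := by simp [Letter.lst, h, List.getLast_append_of_ne_nil _ x.ne]
    rcases hl : l.inv <;> simp [Letter.Junction, hx, hy, hl, this]
  · simp [hx, hy] at hi

lemma EndRight.cases_right {X : Option (Letter Q)} {y : Letter Q} (h : EndRight X (some y)) :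
    (∃ x, X = some x ∧ x.inv = y.inv) ∨ (y.inv = false ∧ ∀ x, X = some x → x.inv = true) := by
  rcases h with ⟨x, _, hx, hy, p, hp, h⟩ | ⟨x, _, hx, hy, p, hp, h⟩ | ⟨x, _, hx, hy⟩ | _ |
    ⟨_, hy⟩ <;> simp_all

lemma EndRight.cases_left {x : Letter Q} {Y : Option (Letter Q)} (h : EndRight (some x) Y) :
    (∃ y, Y = some y ∧ x.inv = y.inv) ∨ (x.inv = true ∧ ∀ y, Y = some y → y.inv = false) := by
  rcases h with ⟨_, y, hx, hy, p, hp, h⟩ | ⟨_, y, hx, hy, p, hp, h⟩ | ⟨_, y, hx, hy⟩ |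
    ⟨_, hx⟩ | _ <;> simp_all

/-- If `ρ` is trivial, the new junction `σ_L τ_R` is admissible. -/
lemma junction_of_compat {sL sR tL tR : Option (Letter Q)} (hR : EndRight sR tR)
    (hL : EndLeft sL tL) (cR : CompatRight sR tR) (cL : CompatLeft sL tL)
    (js : ∀ l l', sL = some l → sR = some l' → l.right = l'.left ∧ l.Junction l')
    (jt : ∀ l l', tL = some l → tR = some l' → l.right = l'.left ∧ l.Junction l')
    (hv : ∀ l l', sL = some l → tR = some l' → l.right = l'.left)
    (hd : sR = none → tL = none → ∀ l l', sL = some l → tR = some l' → l.inv = false →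
      l'.inv = false → Q.rel l.lst l'.hd) :
    ∀ l l', sL = some l → tR = some l' → l.Junction l' := by
  rintro l l' rfl rfl
  -- If `σ_R` and `τ_R` have the same orientation, the junction is inherited from `σ`; if `σ_L` and
  -- `τ_L` do, it is inherited from `τ`. What remains is `σ_L` and `τ_R` both direct, where a
  -- relation is needed.
  rcases hR.cases_right with ⟨x, rfl, hx⟩ | ⟨hl', hsR⟩
  · exact (hR.junction_iff hx l).1 (js l x rfl rfl).2
  rcases EndRight.cases_left hL with ⟨t', ht', hi⟩ | ⟨hl, htL⟩
  · obtain ⟨t, rfl, rfl⟩ := Option.map_eq_some_iff.1 ht'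
    have := (EndRight.junction_iff hL hi l'.bar).2
      (Letter.junction_bar.2 (jt t l' rfl rfl).2)
    exact Letter.junction_bar.1 this
  have hl : l.inv = false := by simpa [Letter.bar] using hl
  have hvl := hv l l' rfl rfl
  suffices Q.rel l.lst l'.hd by simpa [Letter.Junction, hl, hl'] using this
  simp only [Letter.left, Letter.right, hl, hl'] at hvl
  -- A letter `σ_R` or `τ_L` gives, by compatible orientation, a composite without a relation that
  -- shares an arrow with the composite `σ_L τ_R`. Non-cancellation in `σ` or `τ` makes the other
  -- arrows different, so gentleness yields the relation. If both letters are missing, only `hd` can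
  -- supply it.
  rcases sR with _ | x
  · rcases tL with _ | t
    · exact hd rfl rfl l l' rfl rfl hl hl'
    · have ht : t.inv = true := by simpa [Letter.bar] using htL t.bar rfl
      obtain ⟨hv', hj⟩ := jt t l' rfl rfl
      simp only [Letter.left, Letter.right, ht, hl', Letter.Junction] at hv' hj
      rcases cL.1 l.bar rfl (by simp [Letter.bar, hl]) with h | ⟨_, h, h'⟩
      · simp at h
      · obtain rfl : t.bar = _ := by simpa using h
        rcases h' with ⟨-, h'⟩ | ⟨h', -⟩
        · by_contra hn
          exact hj (Q.nonrel_right l.lst ⟨Eq.trans hvl hv'.symm, h'⟩ ⟨hvl, hn⟩)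
        · simp [Letter.bar, ht] at h'
  · have hx := hsR x rfl
    obtain ⟨hv', hj⟩ := js l x rfl rfl
    simp only [Letter.left, Letter.right, hx, hl, Letter.Junction] at hv' hj
    rcases cR.1 x rfl hx with h | ⟨_, h, h'⟩
    · simp at h
    · obtain rfl := Option.some.inj h
      rcases h' with ⟨-, h'⟩ | ⟨h', -⟩
      · by_contra hn
        exact hj (Q.nonrel_left l'.hd ⟨hvl, hn⟩ ⟨hv'.symm.trans hvl, h'⟩)
      · simp [hl'] at h'

-- Without a relation at the junction the concatenation would be a path avoiding the relations,
-- hence nonzero in `Λ`.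
variable (k) in
lemma Letter.rel_of_elt_mul_elt {l l' : Letter Q} (hs : Q.s l.lst = Q.e l'.hd)
    (h : l.elt k * l'.elt k = 0) : Q.rel l.lst l'.hd := by
  by_contra hn
  refine Letter.elt_ne_zero k (⟨false, l.path ++ l'.path, by simp [l.ne], ?_⟩ : Letter Q)
    (by rw [← h]; simp [Letter.elt])
  refine List.isChain_append.2 ⟨l.chain, l'.chain, fun x hx y hy => ?_⟩
  rw [List.getLast?_eq_some_getLast l.ne, Option.mem_some_iff] at hx
  rw [List.head?_eq_some_head l'.ne, Option.mem_some_iff] at hy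
  subst hx hy
  exact ⟨hs, hn⟩

lemma eq_zero_of_unit_smul {c : kˣ} {x : Alg k Q} (h : (c : k) • x = 0) : x = 0 :=
  (smul_eq_zero_iff_right c.ne_zero).1 h

lemma idem_mul_arrow (a : A) : idem k Q (Q.e a) * arrow k Q a = arrow k Q a := by
  have h := RingQuot.mkAlgHom_rel k (PathRel.target (k := k) (Q := Q) a)
  rwa [map_mul] at h

lemma idem_mul_idem (x : V) : idem k Q x * idem k Q x = idem k Q x := by
  have h := RingQuot.mkAlgHom_rel k (PathRel.idem (k := k) (Q := Q) x)
  rwa [map_mul] at h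

lemma Letter.idem_mul_elt (l : Letter Q) : idem k Q (Q.e l.hd) * l.elt k = l.elt k := by
  have h : l.elt k = arrow k Q l.hd * (l.path.tail.map (arrow k Q)).prod := by
    unfold elt hd
    conv_lhs => rw [← List.cons_head_tail l.ne, List.map_cons, List.prod_cons]
  rw [h, ← mul_assoc, idem_mul_arrow]

lemma Walk.single_idem_mem {m : ℕ} (w : Walk Q m) {i : ZMod m} (hi : w.dom i) :
    Pi.single i (idem k Q (w.vtx i)) ∈ w.term k (w.deg i) := by
  intro j
  by_cases h : j = i
  · subst h
    simp [idem_mul_idem, hi]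
  · simp [h]

namespace QuasiGraphMap

variable {m n : ℕ} {σ : Walk Q m} {τ : Walk Q n} (φ : QuasiGraphMap σ τ)
  {χ : ZMod m → kˣ} {ψ : ZMod n → kˣ}

/-- Turns the chain map property into an identity between families, to be tested on idempotents
placed at single positions. -/
lemma HasComponents.comm {g : σ.complex χ ⟶ τ.complex ψ}
    {F : (ZMod m → Alg k Q) → (ZMod n → Alg k Q)} (hg : HasComponents χ ψ g F) {d : ℤ}
    {z : ZMod m → Alg k Q} (hz : z ∈ σ.term k d) : F (σ.diff χ z) = τ.diff ψ (F z) := by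
  have h := g.comm d (d + 1)
  rw [Walk.complex_d _ _ rfl, Walk.complex_d _ _ rfl] at h
  have h' := congrArg Subtype.val (LinearMap.congr_fun (congrArg ModuleCat.Hom.hom h)
    (show (σ.complex χ).X d from ⟨z, hz⟩))
  have h1 := hg d ⟨z, hz⟩
  have h2 := hg (d + 1) ⟨σ.diff χ z, σ.diff_mem χ rfl z hz⟩
  simp only at h1 h2
  rw [← h1, ← h2]
  exact h'.symm

/-- The components at the right end of `ρ`. -/
def rightEnd (χ : ZMod m → kˣ) (ψ : ZMod n → kˣ) (e : kˣ) (z : ZMod m → Alg k Q) :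
    ZMod n → Alg k Q :=
  Pi.single (φ.pos' φ.len) ((e : k) • (z (φ.pos (φ.len + 1)) * σ.bwd χ (φ.pos φ.len))) +
    Pi.single (φ.pos' (φ.len + 1)) ((e : k) • (z (φ.pos φ.len) * τ.fwd ψ (φ.pos' φ.len)))

lemma smul_rightComponents (e : kˣ) (z : ZMod m → Alg k Q) :
    (e : k) • φ.rightComponents χ ψ φ.len z = φ.rightEnd χ ψ e z := by
  rw [rightComponents_eq, rightEnd, smul_add, ← Pi.single_smul, ← Pi.single_smul]

variable {g : σ.complex χ ⟶ τ.complex ψ} {e : kˣ}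

/-- With `σ_R` missing, the chain map identity on the generator at the left end of `σ_L` reads `σ_L
τ_R = 0` up to units: the other composite passes through two successive entries of the differential
of `τ` and vanishes. -/
lemma rel_left_of_hasComponents (hg : HasComponents χ ψ g (φ.rightEnd χ ψ e))
    (hR : σ.letter (φ.pos φ.len) = none) {l l' : Letter Q}
    (hl : σ.letter (φ.pos (φ.len - 1)) = some l) (hl' : τ.letter (φ.pos' φ.len) = some l')
    (hi : l.inv = false) (hi' : l'.inv = false) (hv : l.right = l'.left) :
    Q.rel l.lst l'.hd := by
  have hdom := ((σ.letter_isSome _).1 (by rw [hl]; rfl)).1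
  have h := congrFun (hg.comm (σ.single_idem_mem (k := k) hdom)) (φ.pos' (φ.len + 1))
  have hb : σ.bwd χ (φ.pos φ.len) = 0 := by simp [Walk.bwd_eq, hR, Letter.bw]
  have hx : φ.pos φ.len = φ.pos (φ.len - 1) + 1 := by rw [pos_add_one, sub_add_cancel]
  have e1 := Walk.fwd_mul_fwd τ ψ (φ.pos' φ.len)
  have e2 := Walk.fwd_mul_bwd τ ψ (φ.pos' φ.len)
  rw [pos'_add_one] at e1
  have hu : σ.diff χ (Pi.single (φ.pos (φ.len - 1)) (idem k Q (σ.vtx (φ.pos (φ.len - 1)))))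
      (φ.pos φ.len) = idem k Q (σ.vtx (φ.pos (φ.len - 1))) * σ.fwd χ (φ.pos (φ.len - 1)) := by
    rw [Walk.diff_apply, hb, mul_zero, add_zero, hx, add_sub_cancel_right, Pi.single_eq_same]
  generalize σ.diff χ (Pi.single (φ.pos (φ.len - 1)) _) = u at h hu
  simp only [rightEnd, hb, mul_zero, smul_zero, Pi.single_zero, zero_add, Walk.diff_single,
    smul_mul_assoc, mul_assoc, e1] at h
  rw [← pos'_add_one, add_sub_cancel_right, e2] at h
  simp only [mul_zero, smul_zero, Pi.single_zero, Pi.single_eq_same, Pi.zero_apply] at h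
  rw [hu, Walk.fwd_eq, Walk.fwd_eq, hl, hl', σ.vtx_left _ _ hl] at h
  simp only [Letter.fw, Option.elim, hi, hi', Letter.left, mul_smul_comm, smul_mul_assoc,
    Bool.false_eq_true, if_false, Letter.idem_mul_elt] at h
  refine Letter.rel_of_elt_mul_elt k ?_ (eq_zero_of_unit_smul (eq_zero_of_unit_smul
    (eq_zero_of_unit_smul h)))
  simpa [Letter.right, Letter.left, hi, hi'] using hv

/-- Here `τ_R` is missing. The generator at the far end of the inverse letter `σ_R` is tested in the
component at the left end of `τ_L`; the composite through the differential of `σ` vanishes, so the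
product of the two underlying paths is zero. -/
lemma rel_right_of_hasComponents (hg : HasComponents χ ψ g (φ.rightEnd χ ψ e))
    (hR : τ.letter (φ.pos' φ.len) = none) {l l' : Letter Q}
    (hl : σ.letter (φ.pos φ.len) = some l) (hl' : τ.letter (φ.pos' (φ.len - 1)) = some l')
    (hi : l.inv = true) (hi' : l'.inv = true) (hv : l'.right = l.left) :
    Q.rel l.lst l'.hd := by
  have hdom := ((σ.letter_isSome _).1 (by rw [hl]; rfl)).2
  rw [pos_add_one] at hdom
  have h := congrFun (hg.comm (σ.single_idem_mem (k := k) hdom)) (φ.pos' (φ.len - 1))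
  have hf : τ.fwd ψ (φ.pos' φ.len) = 0 := by simp [Walk.fwd_eq, hR, Letter.fw]
  have hf' : σ.fwd χ (φ.pos φ.len) = 0 := by simp [Walk.fwd_eq, hl, Letter.fw, hi]
  have e1 := Walk.bwd_mul_bwd σ χ (φ.pos φ.len)
  rw [pos_add_one] at e1
  have hu : σ.diff χ (Pi.single (φ.pos (φ.len + 1)) (idem k Q (σ.vtx (φ.pos (φ.len + 1)))))
      (φ.pos (φ.len + 1)) * σ.bwd χ (φ.pos φ.len) = 0 := by
    rw [Walk.diff_apply, pos_sub_one, add_sub_cancel_right, hf', mul_zero, zero_add, mul_assoc, e1,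
      mul_zero]
  generalize σ.diff χ (Pi.single (φ.pos (φ.len + 1)) _) = u at h hu
  simp only [rightEnd, hu, hf, mul_zero, smul_zero, Pi.single_zero, add_zero, Walk.diff_single,
    smul_mul_assoc, mul_assoc, zero_add, pos'_sub_one, Pi.single_eq_same, Pi.zero_apply] at h
  rw [Walk.bwd_eq, Walk.bwd_eq, hl, hl', ← pos_add_one, σ.vtx_right _ _ hl] at h
  simp only [Letter.bw, Option.elim, hi, hi', Letter.right, mul_smul_comm, smul_mul_assoc,
    if_true] at h
  rw [← mul_assoc, Letter.idem_mul_elt] at h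
  have h := h.symm
  refine Letter.rel_of_elt_mul_elt k ?_ (eq_zero_of_unit_smul (eq_zero_of_unit_smul
    (eq_zero_of_unit_smul h)))
  simpa [Letter.right, Letter.left, hi, hi'] using hv.symm

end QuasiGraphMap

/-! ### The crossed diagram and its differential -/

/-- The diagram obtained by exchanging the continuations of two walks at positions `X`, `Y` which
lie at the same vertex and in the same degree. -/
def Diagram.crossing {P : Type} [DecidableEq P] (D : Diagram Q P) (X Y : P)
    (hX : D.dom X) (hY : D.dom Y)
    (hv : D.vtx X = D.vtx Y) (hd : D.deg X = D.deg Y)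
    (h1 : ∀ i l l', D.next i = X → D.letter i = some l → D.letter Y = some l' → l.Junction l')
    (h2 : ∀ i l l', D.next i = Y → D.letter i = some l → D.letter X = some l' → l.Junction l') :
    Diagram Q P where
  next := (Equiv.swap X Y).trans D.next
  dom := D.dom
  vtx := D.vtx
  deg := D.deg
  letter i := D.letter (Equiv.swap X Y i)
  letter_isSome i := by
    rw [D.letter_isSome, Equiv.trans_apply,
      Equiv.apply_swap_eq_self (v := D.dom) (by simp [hX, hY])]
  vtx_left i l h := by
    rw [← D.vtx_left _ l h, Equiv.apply_swap_eq_self hv]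
  vtx_right i l h := D.vtx_right _ l h
  deg_step i l h := by
    rw [Equiv.trans_apply, D.deg_step _ l h, Equiv.apply_swap_eq_self hd]
  junction i l l' h h' := by
    rw [Equiv.trans_apply] at h'
    generalize Equiv.swap X Y i = j at h h'
    by_cases hjX : D.next j = X
    · rw [hjX, Equiv.swap_apply_left] at h'
      exact h1 j l l' hjX h h'
    · by_cases hjY : D.next j = Y
      · rw [hjY, Equiv.swap_apply_right] at h'
        exact h2 j l l' hjY h h'
      · rw [Equiv.swap_apply_of_ne_of_ne hjX hjY] at h'
        exact D.junction j l l' h h'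

/-- The disjoint union of two walks, with the degrees of the first one lowered by one. -/
def Walk.coneDiagram {m n : ℕ} (σ : Walk Q m) (τ : Walk Q n) : Diagram Q (ZMod m ⊕ ZMod n) where
  next := Equiv.sumCongr σ.toDiagram.next τ.toDiagram.next
  dom := Sum.elim σ.dom τ.dom
  vtx := Sum.elim σ.vtx τ.vtx
  deg := Sum.elim (fun i => σ.deg i - 1) τ.deg
  letter := Sum.elim σ.letter τ.letter
  letter_isSome i := by
    rcases i with i | i
    · exact σ.letter_isSome i
    · exact τ.letter_isSome i
  vtx_left i l h := by
    rcases i with i | i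
    · exact σ.vtx_left i l h
    · exact τ.vtx_left i l h
  vtx_right i l h := by
    rcases i with i | i
    · exact σ.vtx_right i l h
    · exact τ.vtx_right i l h
  deg_step i l h := by
    rcases i with i | i
    · change σ.deg (i + 1) - 1 = σ.deg i - 1 + _
      rw [σ.deg_step i l h]
      ring
    · exact τ.deg_step i l h
  junction i l l' h h' := by
    rcases i with i | i
    · exact σ.junction i l l' h h'
    · exact τ.junction i l l' h h'

namespace Letter

/-- The unit `u` for a direct or absent letter, and its inverse for an inverse letter. -/
def orient (X : Option (Letter Q)) (u : kˣ) : kˣ := X.elim u fun l => if l.inv then u⁻¹ else u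

lemma orient_smul_fw (X : Option (Letter Q)) (u : kˣ) :
    (orient X u : k) • fw k X = (u : k) • fw k X := by
  rcases X with _ | l
  · rfl
  · rcases hl : l.inv <;> simp [orient, fw, hl]

lemma orient_smul_bw (X : Option (Letter Q)) (u : kˣ) :
    (orient X u : k) • bw k X = ((u⁻¹ : kˣ) : k) • bw k X := by
  rcases X with _ | l
  · simp [orient, bw]
  · rcases hl : l.inv <;> simp [orient, bw, hl]

end Letter

namespace QuasiGraphMap

variable {m n : ℕ} {σ : Walk Q m} {τ : Walk Q n} (φ : QuasiGraphMap σ τ)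
  {χ : ZMod m → kˣ} {ψ : ZMod n → kˣ}

/-- Consecutive letters at the end of `ρ` which come from different walks satisfy the junction
conditions. -/
lemma crossing_junction (hc : φ.CompatiblyOriented) {g : σ.complex χ ⟶ τ.complex ψ} {e : kˣ}
    (hg : HasComponents χ ψ g (φ.rightEnd χ ψ e)) :
    (∀ l l', σ.letter (φ.pos (φ.len - 1)) = some l → τ.letter (φ.pos' φ.len) = some l' →
      l.Junction l') ∧
    (∀ l l', τ.letter (φ.pos' (φ.len - 1)) = some l → σ.letter (φ.pos φ.len) = some l' →
      l.Junction l') := by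
  have hx : φ.pos (φ.len - 1) + 1 = φ.pos φ.len := by rw [pos_add_one, sub_add_cancel]
  have hy : φ.pos' (φ.len - 1) + 1 = φ.pos' φ.len := by rw [pos'_add_one, sub_add_cancel]
  have js : ∀ l l', σ.letter (φ.pos (φ.len - 1)) = some l → σ.letter (φ.pos φ.len) = some l' →
      l.right = l'.left ∧ l.Junction l' := fun l l' h h' =>
    ⟨by rw [← σ.vtx_right _ l h, hx, σ.vtx_left _ l' h'],
      σ.junction _ l l' h (by rw [hx, h'])⟩
  have jt : ∀ l l', τ.letter (φ.pos' (φ.len - 1)) = some l → τ.letter (φ.pos' φ.len) = some l' →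
      l.right = l'.left ∧ l.Junction l' := fun l l' h h' =>
    ⟨by rw [← τ.vtx_right _ l h, hy, τ.vtx_left _ l' h'],
      τ.junction _ l l' h (by rw [hy, h'])⟩
  have hm := (φ.matched le_rfl).2.2.1
  have v1 : ∀ l l', σ.letter (φ.pos (φ.len - 1)) = some l → τ.letter (φ.pos' φ.len) = some l' →
      l.right = l'.left := fun l l' h h' => by
    rw [← σ.vtx_right _ l h, hx, hm, τ.vtx_left _ l' h']
  have v2 : ∀ l l', τ.letter (φ.pos' (φ.len - 1)) = some l → σ.letter (φ.pos φ.len) = some l' →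
      l.right = l'.left := fun l l' h h' => by
    rw [← τ.vtx_right _ l h, hy, ← hm, σ.vtx_left _ l' h']
  have hd1 : σ.letter (φ.pos φ.len) = none → τ.letter (φ.pos' (φ.len - 1)) = none →
      ∀ l l', σ.letter (φ.pos (φ.len - 1)) = some l → τ.letter (φ.pos' φ.len) = some l' →
        l.inv = false → l'.inv = false → Q.rel l.lst l'.hd := fun h _ l l' hl hl' hi hi' =>
    φ.rel_left_of_hasComponents hg h hl hl' hi hi' (v1 l l' hl hl')
  have hd2 : τ.letter (φ.pos' φ.len) = none → ∀ l l', σ.letter (φ.pos φ.len) = some l →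
      τ.letter (φ.pos' (φ.len - 1)) = some l' → l.inv = true → l'.inv = true →
      Q.rel l.lst l'.hd := fun h l l' hl hl' hi hi' =>
    φ.rel_right_of_hasComponents hg h hl hl' hi hi' (v2 l' l hl' hl)
  have hR : EndRight (σ.letter (φ.pos φ.len)) (τ.letter (φ.pos' φ.len)) := φ.end_right
  -- For nontrivial `ρ` the letter before the crossing is the same in both walks, so the new
  -- junctions already occur in `σ` and `τ`. The hypotheses on orientation are needed only for
  -- trivial `ρ`.
  rcases Nat.eq_zero_or_pos φ.len with h0 | h0
  · have hp : φ.pos (φ.len - 1) = ((φ.a - 1 : ℤ) : ZMod m) := by simp [pos, h0, sub_eq_add_neg]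
    have hp' : φ.pos' (φ.len - 1) = ((φ.b - 1 : ℤ) : ZMod n) := by simp [pos', h0, sub_eq_add_neg]
    have hq : φ.pos φ.len = (φ.a : ZMod m) := by simp [pos, h0]
    have hq' : φ.pos' φ.len = (φ.b : ZMod n) := by simp [pos', h0]
    have hL := φ.end_left
    obtain ⟨cL, cR⟩ := hc h0
    rw [← hp, ← hp'] at hL cL
    rw [← hq, ← hq'] at cR
    generalize σ.letter (φ.pos (φ.len - 1)) = sL at *
    generalize σ.letter (φ.pos φ.len) = sR at *
    generalize τ.letter (φ.pos' (φ.len - 1)) = tL at *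
    generalize τ.letter (φ.pos' φ.len) = tR at *
    refine ⟨junction_of_compat hR hL cR cL js jt v1 hd1, fun l l' h h' => ?_⟩
    have flip : ∀ {x y : Option (Letter Q)}, (∀ l l', x = some l → y = some l' →
        l.right = l'.left ∧ l.Junction l') → ∀ l l', y.map Letter.bar = some l →
        x.map Letter.bar = some l' → l.right = l'.left ∧ l.Junction l' := by
      intro x y hxy l l' hl hl'
      obtain ⟨u, rfl, rfl⟩ := Option.map_eq_some_iff.1 hl
      obtain ⟨u', rfl, rfl⟩ := Option.map_eq_some_iff.1 hl'
      rw [Letter.junction_bar, Letter.right_bar, Letter.left_bar]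
      exact ⟨(hxy u' u rfl rfl).1.symm, (hxy u' u rfl rfl).2⟩
    -- Reading the walks backwards turns the junction `τ_L σ_R` into one of the form already
    -- treated, with left and right letters interchanged and inverted.
    have key := junction_of_compat (sL := sR.map Letter.bar) (sR := sL.map Letter.bar)
      (tL := tR.map Letter.bar) (tR := tL.map Letter.bar) hL
      (by unfold EndLeft; simpa only [Letter.map_bar_map_bar] using hR) cL
      (by unfold CompatLeft; simpa only [Letter.map_bar_map_bar] using cR) (flip js) (flip jt)
      ?_ ?_
    · subst h h'
      exact Letter.junction_bar.1 (key l'.bar l.bar rfl rfl)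
    · intro l l' hl hl'
      obtain ⟨u, rfl, rfl⟩ := Option.map_eq_some_iff.1 hl
      obtain ⟨u', rfl, rfl⟩ := Option.map_eq_some_iff.1 hl'
      rw [Letter.right_bar, Letter.left_bar]
      exact (v2 u' u rfl rfl).symm
    · intro _ ht l l' hl hl' hi hi'
      obtain ⟨u, rfl, rfl⟩ := Option.map_eq_some_iff.1 hl
      obtain ⟨u', rfl, rfl⟩ := Option.map_eq_some_iff.1 hl'
      exact hd2 (by simpa using ht) u u' rfl rfl (by simpa [Letter.bar] using hi)
        (by simpa [Letter.bar] using hi')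
  · have he := φ.letter_eq (t := φ.len - 1) (by omega)
    rw [Nat.cast_sub h0, Nat.cast_one] at he
    exact ⟨fun l l' h h' => (jt l l' (he ▸ h) h').2, fun l l' h h' => (js l l' (he ▸ h) h').2⟩

/-- The positions `φ.pos len` and `φ.pos' len` at which the walks are exchanged, and the conditions
for the exchange. -/
def CrossingJunction : Prop :=
  (∀ l l', σ.letter (φ.pos (φ.len - 1)) = some l → τ.letter (φ.pos' φ.len) = some l' →
      l.Junction l') ∧
    (∀ l l', τ.letter (φ.pos' (φ.len - 1)) = some l → σ.letter (φ.pos φ.len) = some l' →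
      l.Junction l')

variable {φ} in
/-- The diagram of the mapping cone. -/
def crossing (h : φ.CrossingJunction) : Diagram Q (ZMod m ⊕ ZMod n) :=
  (σ.coneDiagram τ).crossing (Sum.inl (φ.pos φ.len)) (Sum.inr (φ.pos' φ.len))
    (φ.matched le_rfl).1 (φ.matched le_rfl).2.1 (φ.matched le_rfl).2.2.1
    (by simp [Walk.coneDiagram, (φ.matched le_rfl).2.2.2])
    (by
      rintro (i | i) l l' hi hl hl'
      · refine h.1 l l' ?_ hl'
        have e : i + 1 = φ.pos φ.len := Sum.inl.inj hi
        rw [← pos_sub_one, ← e, add_sub_cancel_right]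
        exact hl
      · exact absurd hi (by simp [Walk.coneDiagram]))
    (by
      rintro (i | i) l l' hi hl hl'
      · exact absurd hi (by simp [Walk.coneDiagram])
      · refine h.2 l l' ?_ hl'
        have e : i + 1 = φ.pos' φ.len := Sum.inr.inj hi
        rw [← pos'_sub_one, ← e, add_sub_cancel_right]
        exact hl)

/-- The coefficients of the letters of the diagram `crossing`. -/
def crossingCoeff (χ : ZMod m → kˣ) (ψ : ZMod n → kˣ) (e : kˣ) : ZMod m ⊕ ZMod n → kˣ :=
  Sum.elim
    -- The letters of `σ` get the sign of the shift. A direct `τ_R` or an inverse `σ_R` is now a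
    -- component of `g` and carries `e`; with the opposite orientation the entry goes from the `τ`
    -- part to the `σ` part and carries `e⁻¹`, the value of `N` at the crossing.
    (fun j => if j = φ.pos φ.len then
      Letter.orient (τ.letter (φ.pos' φ.len)) e * ψ (φ.pos' φ.len) else -χ j)
    (fun j => if j = φ.pos' φ.len then
      Letter.orient (σ.letter (φ.pos φ.len)) e⁻¹ * χ (φ.pos φ.len) else ψ j)

section

variable {φ} (h : φ.CrossingJunction) (e : kˣ)

lemma crossing_next_inl (j : ZMod m) : (crossing h).next (Sum.inl j) =
    if j = φ.pos φ.len then Sum.inr (φ.pos' φ.len + 1) else Sum.inl (j + 1) := by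
  by_cases hj : j = φ.pos φ.len
  · subst hj
    simp [crossing, Diagram.crossing, Walk.coneDiagram, Walk.toDiagram]
  · have : Equiv.swap (Sum.inl (φ.pos φ.len)) (Sum.inr (φ.pos' φ.len)) (Sum.inl j) =
      (Sum.inl j : ZMod m ⊕ ZMod n) := Equiv.swap_apply_of_ne_of_ne (by simpa using hj) (by simp)
    simp [crossing, Diagram.crossing, Walk.coneDiagram, Walk.toDiagram, hj, this]

lemma crossing_next_inr (j : ZMod n) : (crossing h).next (Sum.inr j) =
    if j = φ.pos' φ.len then Sum.inl (φ.pos φ.len + 1) else Sum.inr (j + 1) := by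
  by_cases hj : j = φ.pos' φ.len
  · subst hj
    simp [crossing, Diagram.crossing, Walk.coneDiagram, Walk.toDiagram]
  · have : Equiv.swap (Sum.inl (φ.pos φ.len)) (Sum.inr (φ.pos' φ.len)) (Sum.inr j) =
      (Sum.inr j : ZMod m ⊕ ZMod n) := Equiv.swap_apply_of_ne_of_ne (by simp) (by simpa using hj)
    simp [crossing, Diagram.crossing, Walk.coneDiagram, Walk.toDiagram, hj, this]

lemma crossing_next_symm_inl (j : ZMod m) : (crossing h).next.symm (Sum.inl j) =
    if j = φ.pos φ.len + 1 then Sum.inr (φ.pos' φ.len) else Sum.inl (j - 1) := by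
  rw [Equiv.symm_apply_eq]
  split_ifs with hj
  · rw [crossing_next_inr, if_pos rfl, hj]
  · rw [crossing_next_inl, if_neg fun h' => hj (by rw [← h', sub_add_cancel]), sub_add_cancel]

lemma crossing_next_symm_inr (j : ZMod n) : (crossing h).next.symm (Sum.inr j) =
    if j = φ.pos' φ.len + 1 then Sum.inl (φ.pos φ.len) else Sum.inr (j - 1) := by
  rw [Equiv.symm_apply_eq]
  split_ifs with hj
  · rw [crossing_next_inl, if_pos rfl, hj]
  · rw [crossing_next_inr, if_neg fun h' => hj (by rw [← h', sub_add_cancel]), sub_add_cancel]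

lemma crossing_letter_inl (j : ZMod m) : (crossing h).letter (Sum.inl j) =
    if j = φ.pos φ.len then τ.letter (φ.pos' φ.len) else σ.letter j := by
  by_cases hj : j = φ.pos φ.len
  · subst hj
    simp [crossing, Diagram.crossing, Walk.coneDiagram]
  · have : Equiv.swap (Sum.inl (φ.pos φ.len)) (Sum.inr (φ.pos' φ.len)) (Sum.inl j) =
      (Sum.inl j : ZMod m ⊕ ZMod n) := Equiv.swap_apply_of_ne_of_ne (by simpa using hj) (by simp)
    simp [crossing, Diagram.crossing, Walk.coneDiagram, hj, this]

lemma crossing_letter_inr (j : ZMod n) : (crossing h).letter (Sum.inr j) =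
    if j = φ.pos' φ.len then σ.letter (φ.pos φ.len) else τ.letter j := by
  by_cases hj : j = φ.pos' φ.len
  · subst hj
    simp [crossing, Diagram.crossing, Walk.coneDiagram]
  · have : Equiv.swap (Sum.inl (φ.pos φ.len)) (Sum.inr (φ.pos' φ.len)) (Sum.inr j) =
      (Sum.inr j : ZMod m ⊕ ZMod n) := Equiv.swap_apply_of_ne_of_ne (by simp) (by simpa using hj)
    simp [crossing, Diagram.crossing, Walk.coneDiagram, hj, this]

end

end QuasiGraphMap

lemma Diagram.fwd_eq {P : Type} (D : Diagram Q P) (χ : P → kˣ) (i : P) :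
    D.fwd χ i = (χ i : k) • Letter.fw k (D.letter i) := by
  unfold fwd Letter.fw
  rcases D.letter i with _ | l
  · simp
  · rcases hl : l.inv <;> simp [hl]

lemma Diagram.bwd_eq {P : Type} (D : Diagram Q P) (χ : P → kˣ) (i : P) :
    D.bwd χ i = (χ i : k) • Letter.bw k (D.letter i) := by
  unfold bwd Letter.bw
  rcases D.letter i with _ | l
  · simp
  · rcases hl : l.inv <;> simp [hl]

namespace QuasiGraphMap

variable {m n : ℕ} {σ : Walk Q m} {τ : Walk Q n} {φ : QuasiGraphMap σ τ}
  (χ : ZMod m → kˣ) (ψ : ZMod n → kˣ) (h : φ.CrossingJunction) (e : kˣ)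

lemma crossing_fwd_inl (j : ZMod m) : (crossing h).fwd (φ.crossingCoeff χ ψ e) (Sum.inl j) =
    if j = φ.pos φ.len then (e : k) • τ.fwd ψ (φ.pos' φ.len) else -σ.fwd χ j := by
  rw [Diagram.fwd_eq, crossing_letter_inl, crossingCoeff, Sum.elim_inl]
  split_ifs with hj
  · rw [mul_comm, Units.val_mul, ← smul_smul, Letter.orient_smul_fw, smul_comm, τ.fwd_eq]
  · rw [σ.fwd_eq, Units.val_neg]
    exact neg_smul (χ j : k) (_ : Alg k Q)

lemma crossing_bwd_inl (j : ZMod m) : (crossing h).bwd (φ.crossingCoeff χ ψ e) (Sum.inl j) =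
    if j = φ.pos φ.len then ((e⁻¹ : kˣ) : k) • τ.bwd ψ (φ.pos' φ.len) else -σ.bwd χ j := by
  rw [Diagram.bwd_eq, crossing_letter_inl, crossingCoeff, Sum.elim_inl]
  split_ifs with hj
  · rw [mul_comm, Units.val_mul, ← smul_smul, Letter.orient_smul_bw, smul_comm, τ.bwd_eq]
  · rw [σ.bwd_eq, Units.val_neg]
    exact neg_smul (χ j : k) (_ : Alg k Q)

lemma crossing_fwd_inr (j : ZMod n) : (crossing h).fwd (φ.crossingCoeff χ ψ e) (Sum.inr j) =
    if j = φ.pos' φ.len then ((e⁻¹ : kˣ) : k) • σ.fwd χ (φ.pos φ.len) else τ.fwd ψ j := by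
  rw [Diagram.fwd_eq, crossing_letter_inr, crossingCoeff, Sum.elim_inr]
  split_ifs with hj
  · rw [mul_comm, Units.val_mul, ← smul_smul, Letter.orient_smul_fw, smul_comm, σ.fwd_eq]
  · rw [τ.fwd_eq]

lemma crossing_bwd_inr (j : ZMod n) : (crossing h).bwd (φ.crossingCoeff χ ψ e) (Sum.inr j) =
    if j = φ.pos' φ.len then (e : k) • σ.bwd χ (φ.pos φ.len) else τ.bwd ψ j := by
  rw [Diagram.bwd_eq, crossing_letter_inr, crossingCoeff, Sum.elim_inr]
  split_ifs with hj
  · rw [mul_comm, Units.val_mul, ← smul_smul, Letter.orient_smul_bw, smul_comm, σ.bwd_eq, inv_inv]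
  · rw [τ.bwd_eq]

lemma crossing_diff_inl (z : ZMod m ⊕ ZMod n → Alg k Q) (j : ZMod m) :
    (crossing h).diff (φ.crossingCoeff χ ψ e) z (Sum.inl j) =
      (if j = φ.pos φ.len + 1 then
        z (Sum.inr (φ.pos' φ.len)) * ((e⁻¹ : kˣ) : k) • σ.fwd χ (φ.pos φ.len)
        else -(z (Sum.inl (j - 1)) * σ.fwd χ (j - 1))) +
      (if j = φ.pos φ.len then
        z (Sum.inr (φ.pos' φ.len + 1)) * ((e⁻¹ : kˣ) : k) • τ.bwd ψ (φ.pos' φ.len)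
        else -(z (Sum.inl (j + 1)) * σ.bwd χ j)) := by
  change z _ * (crossing h).fwd _ _ + z _ * (crossing h).bwd _ _ = _
  rw [crossing_next_symm_inl, crossing_next_inl, crossing_bwd_inl]
  congr 1
  · split_ifs with hj
    · rw [crossing_fwd_inr, if_pos rfl]
    · rw [crossing_fwd_inl, if_neg fun h' => hj (by rw [← h', sub_add_cancel])]
      exact mul_neg (α := Alg k Q) _ _
  · split_ifs with hj
    · rfl
    · exact mul_neg (α := Alg k Q) _ _

lemma crossing_diff_inr (z : ZMod m ⊕ ZMod n → Alg k Q) (j : ZMod n) :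
    (crossing h).diff (φ.crossingCoeff χ ψ e) z (Sum.inr j) =
      (if j = φ.pos' φ.len + 1 then
        z (Sum.inl (φ.pos φ.len)) * (e : k) • τ.fwd ψ (φ.pos' φ.len)
        else z (Sum.inr (j - 1)) * τ.fwd ψ (j - 1)) +
      (if j = φ.pos' φ.len then
        z (Sum.inl (φ.pos φ.len + 1)) * (e : k) • σ.bwd χ (φ.pos φ.len)
        else z (Sum.inr (j + 1)) * τ.bwd ψ j) := by
  change z _ * (crossing h).fwd _ _ + z _ * (crossing h).bwd _ _ = _
  rw [crossing_next_symm_inr, crossing_next_inr, crossing_bwd_inr]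
  congr 1
  · split_ifs with hj
    · rw [crossing_fwd_inl, if_pos rfl]
    · rw [crossing_fwd_inr, if_neg fun h' => hj (by rw [← h', sub_add_cancel])]
  · split_ifs with hj <;> rfl

end QuasiGraphMap

/-! ### The nilpotent map from the terms of `τ` to those of `σ` -/

namespace QuasiGraphMap

variable {m n : ℕ} {σ : Walk Q m} {τ : Walk Q n} (φ : QuasiGraphMap σ τ)
  (χ : ZMod m → kˣ) (ψ : ZMod n → kˣ)

/-- The data of a nilpotent map from the terms of `τ` to those of `σ`: scalars `c t` for the
components from `φ.pos' t` to `φ.pos t`, and elements `L`, `R` of `Λ` for the components at the far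
ends of the letters next to `ρ`. -/
structure Conjugator (e : kˣ) where
  c : ℕ → kˣ
  L : Alg k Q
  R : Alg k Q
  c_len : c φ.len = e⁻¹
  c_fwd : ∀ t : ℕ, t < φ.len →
    (c t : k) • σ.fwd χ (φ.pos t) + (c (t + 1) : k) • τ.fwd ψ (φ.pos' t) = 0
  c_bwd : ∀ t : ℕ, t < φ.len →
    (c t : k) • τ.bwd ψ (φ.pos' t) + (c (t + 1) : k) • σ.bwd χ (φ.pos t) = 0
  -- The signs at the two ends differ on purpose: at the left end `L` cancels the scalar `c 0`,
  -- whereas at the right end `R` agrees with `c len = e⁻¹` and the two contributions add up.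
  fwd_R : τ.fwd ψ (φ.pos' φ.len) * R = ((e⁻¹ : kˣ) : k) • σ.fwd χ (φ.pos φ.len)
  R_bwd : R * σ.bwd χ (φ.pos φ.len) = ((e⁻¹ : kˣ) : k) • τ.bwd ψ (φ.pos' φ.len)
  bwd_R : τ.bwd ψ (φ.pos' (φ.len + 1)) * R = 0
  R_fwd : R * σ.fwd χ (φ.pos (φ.len + 1)) = 0
  bwd_L : τ.bwd ψ (φ.pos' (-1)) * L + (c 0 : k) • σ.bwd χ (φ.pos (-1)) = 0
  L_fwd : L * σ.fwd χ (φ.pos (-1)) + (c 0 : k) • τ.fwd ψ (φ.pos' (-1)) = 0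
  fwd_L : τ.fwd ψ (φ.pos' (-2)) * L = 0
  L_bwd : L * σ.bwd χ (φ.pos (-2)) = 0
  R_mem : R ≠ 0 → R * idem k Q (σ.vtx (φ.pos (φ.len + 1))) = R ∧ σ.dom (φ.pos (φ.len + 1)) ∧
    σ.deg (φ.pos (φ.len + 1)) = τ.deg (φ.pos' (φ.len + 1)) + 1
  L_mem : L ≠ 0 → L * idem k Q (σ.vtx (φ.pos (-1))) = L ∧ σ.dom (φ.pos (-1)) ∧
    σ.deg (φ.pos (-1)) = τ.deg (φ.pos' (-1)) + 1

/-- Each letter of `ρ` fixes the ratio of consecutive scalars: minus the ratio of its coefficients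
in `σ` and `τ`, inverted for an inverse letter. The remaining common factor is chosen so that the
value at the end of `ρ` is `e⁻¹`. -/
lemma exists_coefficients (e : kˣ) : ∃ c : ℕ → kˣ, c φ.len = e⁻¹ ∧ ∀ t : ℕ, t < φ.len →
    (c t : k) • σ.fwd χ (φ.pos t) + (c (t + 1) : k) • τ.fwd ψ (φ.pos' t) = 0 ∧
    (c t : k) • τ.bwd ψ (φ.pos' t) + (c (t + 1) : k) • σ.bwd χ (φ.pos t) = 0 := by
  let r : ℕ → kˣ := fun t => Letter.orient (σ.letter (φ.pos t)) (χ (φ.pos t) / ψ (φ.pos' t))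
  let d : ℕ → kˣ := fun t => ∏ i ∈ Finset.range t, -r i
  refine ⟨fun t => e⁻¹ * (d φ.len)⁻¹ * d t, by simp, fun t ht => ?_⟩
  generalize e⁻¹ * (d φ.len)⁻¹ = u
  have hd : d (t + 1) = d t * -r t := Finset.prod_range_succ _ t
  obtain ⟨l, h, h'⟩ := φ.letter_overlap ht
  have hr : r t = if l.inv then (χ (φ.pos t) / ψ (φ.pos' t))⁻¹ else χ (φ.pos t) / ψ (φ.pos' t) := by
    simp [r, h, Letter.orient]
  have key : ∀ (a b : kˣ) (x : Alg k Q), b = -a → (a : k) • x + (b : k) • x = 0 := by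
    rintro a _ x rfl
    rw [← add_smul, Units.val_neg, add_neg_cancel]
    exact zero_smul k x
  beta_reduce
  rw [hd, hr, σ.fwd_eq, τ.fwd_eq, σ.bwd_eq, τ.bwd_eq, h, h']
  rcases hl : l.inv
  · refine ⟨?_, by simp [Letter.bw, hl]⟩
    simp only [smul_smul, ← Units.val_mul]
    refine key _ _ _ ?_
    rw [if_neg (by simp), mul_neg, mul_neg, neg_mul, ← mul_assoc, mul_assoc, div_mul_cancel]
  · refine ⟨by simp [Letter.fw, hl], ?_⟩
    simp only [smul_smul, ← Units.val_mul]
    refine key _ _ _ ?_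
    rw [if_pos trivial, inv_div, mul_neg, mul_neg, neg_mul, ← mul_assoc, mul_assoc, div_mul_cancel]

end QuasiGraphMap

/-- The connecting element between the far ends of the letters at the right positions `i` of `σ`
and `j` of `τ`. -/
lemma exists_right_element {m n : ℕ} {σ : Walk Q m} {τ : Walk Q n} (χ : ZMod m → kˣ)
    (ψ : ZMod n → kˣ) {i : ZMod m} {j : ZMod n} (h : EndRight (σ.letter i) (τ.letter j))
    (hd : σ.deg i = τ.deg j + 1) : ∃ r : Alg k Q,
      τ.fwd ψ j * r = σ.fwd χ i ∧ r * σ.bwd χ i = τ.bwd ψ j ∧ τ.bwd ψ (j + 1) * r = 0 ∧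
      r * σ.fwd χ (i + 1) = 0 ∧
      (r ≠ 0 → r * idem k Q (σ.vtx (i + 1)) = r ∧ σ.dom (i + 1) ∧
        σ.deg (i + 1) = τ.deg (j + 1) + 1) := by
  obtain ⟨r, h1, h2, h3⟩ := h.exists_connector (χ i) (ψ j)
  refine ⟨r, by rw [τ.fwd_eq, σ.fwd_eq, h1], by rw [τ.bwd_eq, σ.bwd_eq, h2], ?_⟩
  rcases h3 with rfl | ⟨x, y, hx, hy, hi, h4, h5, h6⟩
  · simp
  · refine ⟨?_, ?_, fun _ => ⟨?_, ?_, ?_⟩⟩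
    · rw [τ.bwd_eq]
      rcases hl : τ.letter (j + 1) with _ | l
      · simp [Letter.bw]
      · rw [smul_mul_assoc, h5 l (by rw [← τ.vtx_right _ _ hy, τ.vtx_left _ _ hl])
          (τ.junction _ _ _ hy hl), smul_zero]
    · rw [σ.fwd_eq]
      rcases hl : σ.letter (i + 1) with _ | l
      · simp [Letter.fw]
      · rw [mul_smul_comm, h6 l (by rw [← σ.vtx_right _ _ hx, σ.vtx_left _ _ hl])
          (σ.junction _ _ _ hx hl), smul_zero]
    · rw [σ.vtx_right _ _ hx, h4]
    · exact ((σ.letter_isSome i).1 (by rw [hx]; rfl)).2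
    · rw [σ.deg_step _ _ hx, τ.deg_step _ _ hy, hd, hi]
      ring

/-- The connecting element between the far ends of the letters at the left positions `i` of `σ`
and `j` of `τ`. -/
lemma exists_left_element {m n : ℕ} {σ : Walk Q m} {τ : Walk Q n} (χ : ZMod m → kˣ)
    (ψ : ZMod n → kˣ) {i : ZMod m} {j : ZMod n} (h : EndLeft (σ.letter i) (τ.letter j))
    (hd : σ.deg (i + 1) = τ.deg (j + 1) + 1) : ∃ r : Alg k Q,
      τ.bwd ψ j * r = σ.bwd χ i ∧ r * σ.fwd χ i = τ.fwd ψ j ∧ τ.fwd ψ (j - 1) * r = 0 ∧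
      r * σ.bwd χ (i - 1) = 0 ∧
      (r ≠ 0 → r * idem k Q (σ.vtx i) = r ∧ σ.dom i ∧ σ.deg i = τ.deg j + 1) := by
  obtain ⟨r, h1, h2, h3⟩ := EndRight.exists_connector h (χ i) (ψ j)
  rw [Letter.fw_bar, Letter.fw_bar] at h1
  rw [Letter.bw_bar, Letter.bw_bar] at h2
  refine ⟨r, by rw [τ.bwd_eq, σ.bwd_eq, h1], by rw [τ.fwd_eq, σ.fwd_eq, h2], ?_⟩
  rcases h3 with rfl | ⟨x', y', hx', hy', hi, h4, h5, h6⟩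
  · simp
  · obtain ⟨x, hx, rfl⟩ := Option.map_eq_some_iff.1 hx'
    obtain ⟨y, hy, rfl⟩ := Option.map_eq_some_iff.1 hy'
    rw [Letter.right_bar] at h4 h5 h6
    have hi : x.inv = y.inv := by simpa [Letter.bar] using hi
    refine ⟨?_, ?_, fun _ => ⟨?_, ?_, ?_⟩⟩
    · rw [τ.fwd_eq]
      rcases hl : τ.letter (j - 1) with _ | l
      · simp [Letter.fw]
      · have := h5 l.bar (by
          rw [Letter.left_bar, ← τ.vtx_right _ _ hl, sub_add_cancel, τ.vtx_left _ _ hy])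
          (Letter.junction_bar.2 (τ.junction _ _ _ hl (by rw [sub_add_cancel, hy])))
        rw [← Option.map_some, Letter.bw_bar] at this
        rw [smul_mul_assoc, this, smul_zero]
    · rw [σ.bwd_eq]
      rcases hl : σ.letter (i - 1) with _ | l
      · simp [Letter.bw]
      · have := h6 l.bar (by
          rw [Letter.left_bar, ← σ.vtx_right _ _ hl, sub_add_cancel, σ.vtx_left _ _ hx])
          (Letter.junction_bar.2 (σ.junction _ _ _ hl (by rw [sub_add_cancel, hx])))
        rw [← Option.map_some, Letter.fw_bar] at this
        rw [mul_smul_comm, this, smul_zero]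
    · rw [σ.vtx_left _ _ hx, h4]
    · exact ((σ.letter_isSome i).1 (by rw [hx]; rfl)).1
    · have h7 := σ.deg_step _ _ hx
      have h8 := τ.deg_step _ _ hy
      rw [hi] at h7
      omega

namespace QuasiGraphMap

variable {m n : ℕ} {σ : Walk Q m} {τ : Walk Q n} (φ : QuasiGraphMap σ τ)
  (χ : ZMod m → kˣ) (ψ : ZMod n → kˣ)

/-- `R` and `L` are the connecting elements of the two endpoint conditions, scaled by `e⁻¹` and `-c
0`. -/
lemma exists_conjugator (e : kˣ) : Nonempty (φ.Conjugator χ ψ e) := by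
  obtain ⟨c, hc, hc'⟩ := φ.exists_coefficients χ ψ e
  have hm := φ.matched le_rfl
  obtain ⟨r, h1, h2, h3, h4, h5⟩ := exists_right_element χ ψ (i := φ.pos φ.len)
    (j := φ.pos' φ.len) φ.end_right hm.2.2.2
  have hm0 := φ.matched (Nat.zero_le _)
  have e1 : φ.pos (-1) + 1 = φ.pos ((0 : ℕ) : ℤ) := by rw [pos_add_one]; rfl
  have e2 : φ.pos' (-1) + 1 = φ.pos' ((0 : ℕ) : ℤ) := by rw [pos'_add_one]; rfl
  obtain ⟨s, g1, g2, g3, g4, g5⟩ := exists_left_element χ ψ (i := φ.pos (-1)) (j := φ.pos' (-1))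
    φ.end_left (by rw [e1, e2]; exact hm0.2.2.2)
  rw [pos_add_one] at h4 h5
  rw [pos'_add_one] at h3 h5
  rw [pos_sub_one] at g4
  rw [pos'_sub_one] at g3
  have unit_smul : ∀ {u : kˣ} {x : Alg k Q}, (u : k) • x ≠ 0 → x ≠ 0 :=
    fun h hx => h (by rw [hx, smul_zero])
  have neg_smul_add : ∀ (u : k) (x : Alg k Q), (-u) • x + u • x = 0 := fun u x => by
    rw [← add_smul, neg_add_cancel]
    exact zero_smul k x
  exact ⟨{
    c := c
    L := ((-c 0 : kˣ) : k) • s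
    R := ((e⁻¹ : kˣ) : k) • r
    c_len := hc
    c_fwd := fun t ht => (hc' t ht).1
    c_bwd := fun t ht => (hc' t ht).2
    fwd_R := by rw [mul_smul_comm, h1]
    R_bwd := by rw [smul_mul_assoc, h2]
    bwd_R := by rw [mul_smul_comm, h3, smul_zero]
    R_fwd := by rw [smul_mul_assoc, h4, smul_zero]
    bwd_L := by rw [mul_smul_comm, g1]; exact neg_smul_add _ _
    L_fwd := by rw [smul_mul_assoc, g2]; exact neg_smul_add _ _
    fwd_L := by rw [mul_smul_comm]; exact (congrArg _ g3).trans (smul_zero _)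
    L_bwd := by rw [smul_mul_assoc]; exact (congrArg _ g4).trans (smul_zero _)
    R_mem := fun h => by
      rw [smul_mul_assoc, (h5 (unit_smul h)).1]
      exact ⟨rfl, (h5 (unit_smul h)).2⟩
    L_mem := fun h => by
      rw [smul_mul_assoc, (g5 (unit_smul h)).1]; exact ⟨rfl, (g5 (unit_smul h)).2⟩ }⟩

/-- A turn of a closed `σ` has at least `len + 2` positions. Hence all positions from `-1` to `len +
1` are distinct, except that the two extreme ones may coincide. -/
lemma pos_ne {s t : ℤ} (h : s < t) (h' : t < s + φ.len + 2) : φ.pos s ≠ φ.pos t := by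
  intro he
  rw [pos, pos, ZMod.intCast_eq_intCast_iff_dvd_sub] at he
  have h2 := Int.le_of_dvd (by omega) he
  rcases Nat.eq_zero_or_pos m with rfl | hm
  · rw [Nat.cast_zero, zero_dvd_iff] at he
    omega
  · have := φ.fits_left hm
    omega

lemma pos'_ne {s t : ℤ} (h : s < t) (h' : t < s + φ.len + 2) : φ.pos' s ≠ φ.pos' t := by
  intro he
  rw [pos', pos', ZMod.intCast_eq_intCast_iff_dvd_sub] at he
  have h2 := Int.le_of_dvd (by omega) he
  rcases Nat.eq_zero_or_pos n with rfl | hm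
  · rw [Nat.cast_zero, zero_dvd_iff] at he
    omega
  · have := φ.fits_right hm
    omega

namespace Conjugator

variable {φ χ ψ} {e : kˣ} (N : φ.Conjugator χ ψ e)

/-- The nilpotent map. -/
def map : (ZMod n → Alg k Q) →ₗ[Alg k Q] (ZMod m → Alg k Q) where
  toFun z := ∑ t ∈ Finset.range (φ.len + 1), Pi.single (φ.pos t) ((N.c t : k) • z (φ.pos' t)) +
    (Pi.single (φ.pos (-1)) (z (φ.pos' (-1)) * N.L) +
      Pi.single (φ.pos (φ.len + 1)) (z (φ.pos' (φ.len + 1)) * N.R))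
  map_add' x y := by
    simp only [Pi.add_apply, smul_add, add_mul, Pi.single_add, Finset.sum_add_distrib]
    abel
  map_smul' a x := by
    simp only [Pi.smul_apply, smul_eq_mul, RingHom.id_apply, smul_add, Finset.smul_sum,
      ← Pi.single_smul, mul_assoc, mul_smul_comm]

lemma map_apply (z : ZMod n → Alg k Q) : N.map z =
    ∑ t ∈ Finset.range (φ.len + 1), Pi.single (φ.pos t) ((N.c t : k) • z (φ.pos' t)) +
    (Pi.single (φ.pos (-1)) (z (φ.pos' (-1)) * N.L) +
      Pi.single (φ.pos (φ.len + 1)) (z (φ.pos' (φ.len + 1)) * N.R)) := rfl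

lemma map_apply_len (z : ZMod n → Alg k Q) :
    N.map z (φ.pos φ.len) = ((e⁻¹ : kˣ) : k) • z (φ.pos' φ.len) := by
  rw [map_apply, Finset.sum_range_succ, Pi.add_apply, Pi.add_apply, Pi.add_apply,
    Finset.sum_apply, Finset.sum_eq_zero, Pi.single_eq_same,
    Pi.single_eq_of_ne (φ.pos_ne (by omega) (by omega)).symm,
    Pi.single_eq_of_ne (φ.pos_ne (by omega) (by omega)), N.c_len]
  · simp
  · intro t ht
    rw [Finset.mem_range] at ht
    exact Pi.single_eq_of_ne (φ.pos_ne (by omega) (by omega)).symm _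

/-- The factor `σ.bwd` is needed because the positions `-1` and `len + 1` of `σ` may coincide. Then
`pos len = pos (-2)`, and the unwanted contribution of `L` is killed by `L_bwd`. -/
lemma map_apply_len_add_one (z : ZMod n → Alg k Q) :
    N.map z (φ.pos (φ.len + 1)) * σ.bwd χ (φ.pos φ.len) =
      ((e⁻¹ : kˣ) : k) • (z (φ.pos' (φ.len + 1)) * τ.bwd ψ (φ.pos' φ.len)) := by
  rw [map_apply, Pi.add_apply, Pi.add_apply, Finset.sum_apply, Finset.sum_eq_zero,
    Pi.single_eq_same, zero_add, add_mul, mul_assoc _ N.R, N.R_bwd, mul_smul_comm]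
  · by_cases h : φ.pos (φ.len + 1) = φ.pos (-1)
    · have h2 : φ.pos φ.len = φ.pos (-2) := by
        have := congrArg (· - 1) h
        simpa [pos_sub_one] using this
      rw [h, Pi.single_eq_same, h2, mul_assoc, N.L_bwd, mul_zero, zero_add]
    · rw [Pi.single_eq_of_ne h, zero_mul, zero_add]
  · intro t ht
    rw [Finset.mem_range] at ht
    exact Pi.single_eq_of_ne (φ.pos_ne (by omega) (by omega)).symm _

lemma map_single_len (u : Alg k Q) : N.map (Pi.single (φ.pos' φ.len) u) =
    Pi.single (φ.pos φ.len) (((e⁻¹ : kˣ) : k) • u) := by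
  rw [map_apply, Finset.sum_range_succ, Finset.sum_eq_zero, Pi.single_eq_same, N.c_len,
    Pi.single_eq_of_ne (φ.pos'_ne (by omega) (by omega)),
    Pi.single_eq_of_ne (φ.pos'_ne (by omega) (by omega)).symm]
  · simp
  · intro t ht
    rw [Finset.mem_range] at ht
    rw [Pi.single_eq_of_ne (φ.pos'_ne (by omega) (by omega)), smul_zero, Pi.single_zero]

/-- As above, but for a coincidence of the positions `-1` and `len + 1` of `τ`: the factor `τ.fwd`
lets `fwd_L` remove the contribution of `L`. -/
lemma map_single_len_add_one (u : Alg k Q) :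
    N.map (Pi.single (φ.pos' (φ.len + 1)) (u * τ.fwd ψ (φ.pos' φ.len))) =
      Pi.single (φ.pos (φ.len + 1)) (((e⁻¹ : kˣ) : k) • (u * σ.fwd χ (φ.pos φ.len))) := by
  rw [map_apply, Finset.sum_eq_zero, Pi.single_eq_same, zero_add, mul_assoc, N.fwd_R,
    mul_smul_comm]
  · by_cases h : φ.pos' (φ.len + 1) = φ.pos' (-1)
    · have h2 : φ.pos' φ.len = φ.pos' (-2) := by
        have := congrArg (· - 1) h
        simpa [pos'_sub_one] using this
      rw [h, Pi.single_eq_same, h2, mul_assoc, N.fwd_L, mul_zero, Pi.single_zero, zero_add]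
    · rw [Pi.single_eq_of_ne (Ne.symm h), zero_mul, Pi.single_zero, zero_add]
  · intro t ht
    rw [Finset.mem_range] at ht
    rw [Pi.single_eq_of_ne (φ.pos'_ne (by omega) (by omega)), smul_zero, Pi.single_zero]

/-- The composition of the map at the right end of `ρ` with the nilpotent map is the part of the
differential of `σ` between the positions `φ.pos len` and `φ.pos (len + 1)`. -/
lemma map_rightEnd (z : ZMod m → Alg k Q) : N.map (φ.rightEnd χ ψ e z) =
    Pi.single (φ.pos φ.len) (z (φ.pos (φ.len + 1)) * σ.bwd χ (φ.pos φ.len)) +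
      Pi.single (φ.pos (φ.len + 1)) (z (φ.pos φ.len) * σ.fwd χ (φ.pos φ.len)) := by
  rw [rightEnd, map_add, map_single_len, ← smul_mul_assoc (e : k) (z _) (τ.fwd ψ _),
    map_single_len_add_one]
  simp [smul_smul]

/-- Contributions along `ρ` cancel in pairs and those at the left end cancel against `L`, while at
the right end the contributions of `c len` and `R` coincide. Of the two copies left over, one
replaces the part of the differential of `σ` along `σ_R` that the crossed diagram omits, and the
other is the entry of a new letter. -/
lemma map_diff_add_diff_map (z : ZMod n → Alg k Q) : N.map (τ.diff ψ z) + σ.diff χ (N.map z) =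
    Pi.single (φ.pos φ.len)
      ((2 : k) • ((e⁻¹ : kˣ) : k) • (z (φ.pos' (φ.len + 1)) * τ.bwd ψ (φ.pos' φ.len))) +
    Pi.single (φ.pos (φ.len + 1))
      ((2 : k) • ((e⁻¹ : kˣ) : k) • (z (φ.pos' φ.len) * σ.fwd χ (φ.pos φ.len))) := by
  -- `S t` and `T t` collect what `c t` contributes through the letters to the right and to the left
  -- of the matched positions. Since `S t` cancels `T (t + 1)`, the sum telescopes to `S len + T 0`.
  let S : ℕ → ZMod m → Alg k Q := fun t =>
    Pi.single (φ.pos (t + 1)) ((N.c t : k) • (z (φ.pos' t) * σ.fwd χ (φ.pos t))) +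
      Pi.single (φ.pos t) ((N.c t : k) • (z (φ.pos' (t + 1)) * τ.bwd ψ (φ.pos' t)))
  let T : ℕ → ZMod m → Alg k Q := fun t =>
    Pi.single (φ.pos (t - 1)) ((N.c t : k) • (z (φ.pos' t) * σ.bwd χ (φ.pos (t - 1)))) +
      Pi.single (φ.pos t) ((N.c t : k) • (z (φ.pos' (t - 1)) * τ.fwd ψ (φ.pos' (t - 1))))
  have hST : ∀ t < φ.len, S t + T (t + 1) = 0 := by
    intro t ht
    have h1 := N.c_fwd t ht
    have h2 := N.c_bwd t ht
    have e1 : S t + T (t + 1) = Pi.single (φ.pos (t + 1)) (z (φ.pos' t) *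
        ((N.c t : k) • σ.fwd χ (φ.pos t) + (N.c (t + 1) : k) • τ.fwd ψ (φ.pos' t))) +
        Pi.single (φ.pos t) (z (φ.pos' (t + 1)) *
          ((N.c t : k) • τ.bwd ψ (φ.pos' t) + (N.c (t + 1) : k) • σ.bwd χ (φ.pos t))) := by
      simp only [S, T, Nat.cast_succ, add_sub_cancel_right, mul_add, mul_smul_comm, Pi.single_add]
      abel
    rw [e1, h1, h2, mul_zero, mul_zero, Pi.single_zero, Pi.single_zero, add_zero]
  have hsum : ∑ t ∈ Finset.range (φ.len + 1), (S t + T t) = S φ.len + T 0 := by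
    rw [Finset.sum_add_distrib, Finset.sum_range_succ, Finset.sum_range_succ' T]
    have : ∑ t ∈ Finset.range φ.len, S t + ∑ t ∈ Finset.range φ.len, T (t + 1) = 0 := by
      rw [← Finset.sum_add_distrib]
      exact Finset.sum_eq_zero fun t ht => hST t (Finset.mem_range.1 ht)
    calc _ = (∑ t ∈ Finset.range φ.len, S t + ∑ t ∈ Finset.range φ.len, T (t + 1)) +
          (S φ.len + T 0) := by abel
      _ = _ := by rw [this, zero_add]
  have hL : T 0 + (Pi.single (φ.pos (-1)) (z (φ.pos' 0) * (τ.bwd ψ (φ.pos' (-1)) * N.L)) +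
      Pi.single (φ.pos 0) (z (φ.pos' (-1)) * (N.L * σ.fwd χ (φ.pos (-1))))) = 0 := by
    have e1 : T 0 + (Pi.single (φ.pos (-1)) (z (φ.pos' 0) * (τ.bwd ψ (φ.pos' (-1)) * N.L)) +
      Pi.single (φ.pos 0) (z (φ.pos' (-1)) * (N.L * σ.fwd χ (φ.pos (-1))))) =
        Pi.single (φ.pos (-1)) (z (φ.pos' 0) *
          (τ.bwd ψ (φ.pos' (-1)) * N.L + (N.c 0 : k) • σ.bwd χ (φ.pos (-1)))) +
        Pi.single (φ.pos 0) (z (φ.pos' (-1)) *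
          (N.L * σ.fwd χ (φ.pos (-1)) + (N.c 0 : k) • τ.fwd ψ (φ.pos' (-1)))) := by
      simp only [T, Nat.cast_zero, zero_sub, mul_add, mul_smul_comm, Pi.single_add]
      abel
    rw [e1, N.bwd_L, N.L_fwd, mul_zero, mul_zero, Pi.single_zero, Pi.single_zero, add_zero]
  have hR : S φ.len + (Pi.single (φ.pos φ.len)
      (z (φ.pos' (φ.len + 1)) * (N.R * σ.bwd χ (φ.pos φ.len))) +
      Pi.single (φ.pos (φ.len + 1)) (z (φ.pos' φ.len) * (τ.fwd ψ (φ.pos' φ.len) * N.R))) =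
      Pi.single (φ.pos φ.len)
        ((2 : k) • ((e⁻¹ : kˣ) : k) • (z (φ.pos' (φ.len + 1)) * τ.bwd ψ (φ.pos' φ.len))) +
      Pi.single (φ.pos (φ.len + 1))
        ((2 : k) • ((e⁻¹ : kˣ) : k) • (z (φ.pos' φ.len) * σ.fwd χ (φ.pos φ.len))) := by
    rw [N.fwd_R, N.R_bwd]
    simp only [S, N.c_len, mul_smul_comm, two_smul, Pi.single_add]
    abel
  have e1 : σ.diff χ (N.map z) = ∑ t ∈ Finset.range (φ.len + 1),
      (Pi.single (φ.pos (t + 1)) ((N.c t : k) • (z (φ.pos' t) * σ.fwd χ (φ.pos t))) +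
        Pi.single (φ.pos (t - 1)) ((N.c t : k) • (z (φ.pos' t) * σ.bwd χ (φ.pos (t - 1))))) +
      (Pi.single (φ.pos 0) (z (φ.pos' (-1)) * (N.L * σ.fwd χ (φ.pos (-1)))) +
        Pi.single (φ.pos φ.len) (z (φ.pos' (φ.len + 1)) * (N.R * σ.bwd χ (φ.pos φ.len)))) := by
    rw [map_apply, map_add, map_add, map_sum]
    simp only [Walk.diff_single, pos_add_one, pos_sub_one, smul_mul_assoc, mul_assoc, N.R_fwd,
      add_sub_cancel_right, mul_zero, Pi.single_zero, zero_add]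
    have : φ.pos (-1 - 1) = φ.pos (-2) := rfl
    rw [this, N.L_bwd, mul_zero, Pi.single_zero, add_zero]
    rfl
  have e2 : N.map (τ.diff ψ z) = ∑ t ∈ Finset.range (φ.len + 1),
      (Pi.single (φ.pos t) ((N.c t : k) • (z (φ.pos' (t + 1)) * τ.bwd ψ (φ.pos' t))) +
        Pi.single (φ.pos t) ((N.c t : k) • (z (φ.pos' (t - 1)) * τ.fwd ψ (φ.pos' (t - 1))))) +
      (Pi.single (φ.pos (-1)) (z (φ.pos' 0) * (τ.bwd ψ (φ.pos' (-1)) * N.L)) +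
        Pi.single (φ.pos (φ.len + 1)) (z (φ.pos' φ.len) * (τ.fwd ψ (φ.pos' φ.len) * N.R))) := by
    rw [map_apply]
    simp only [Walk.diff_apply, pos'_add_one, pos'_sub_one, add_mul, mul_assoc, N.bwd_R,
      add_sub_cancel_right, mul_zero, add_zero]
    have : φ.pos' (-1 - 1) = φ.pos' (-2) := rfl
    rw [this, N.fwd_L, mul_zero, zero_add]
    congr 1
    refine Finset.sum_congr rfl fun t _ => ?_
    rw [smul_add, Pi.single_add, add_comm]
  rw [e1, e2, ← hR]
  have e3 : ∀ a b a' b' c d c' d' : ZMod m → Alg k Q, a + b = a' + c' →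
      c' + (c + d) = 0 → (a + (c + d')) + (b + (d + b')) = a' + (b' + d') := by
    intro a b a' b' c d c' d' h h'
    calc _ = (a + b) + (c + d) + (b' + d') := by abel
      _ = a' + (c' + (c + d)) + (b' + d') := by rw [h]; abel
      _ = _ := by rw [h']; abel
  refine e3 _ _ _ _ _ _ _ _ ?_ hL
  rw [← hsum, ← Finset.sum_add_distrib]
  refine Finset.sum_congr rfl fun t _ => ?_
  simp only [S, T]
  abel

lemma map_mem {d d' : ℤ} (h : d + 1 = d') : ∀ z ∈ τ.term k d, N.map z ∈ σ.term k d' := by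
  have single_mem : ∀ (i : ZMod m) (u : Alg k Q), (u ≠ 0 → u * idem k Q (σ.vtx i) = u ∧
      σ.dom i ∧ σ.deg i = d') → Pi.single i u ∈ σ.term k d' := by
    intro i u hu j
    by_cases hj : j = i
    · subst hj
      rw [Pi.single_eq_same]
      by_cases hu' : u = 0
      · simp [hu']
      · exact ⟨(hu hu').1, fun _ => (hu hu').2⟩
    · simp [hj]
  intro z hz
  rw [map_apply]
  refine add_mem (sum_mem fun t ht => single_mem _ _ fun hu => ?_)
    (add_mem (single_mem _ _ fun hu => ?_) (single_mem _ _ fun hu => ?_))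
  · obtain ⟨h1, h2, h3, h4⟩ := φ.matched (Nat.lt_succ_iff.1 (Finset.mem_range.1 ht))
    have := ((hz (φ.pos' t)).2 fun h' => hu (by rw [h', smul_zero])).2
    exact ⟨by rw [h3, smul_mul_assoc, (hz _).1], h1, by omega⟩
  · obtain ⟨h1, h2, h3⟩ := N.L_mem (right_ne_zero_of_mul hu)
    have := ((hz _).2 (left_ne_zero_of_mul hu)).2
    exact ⟨by rw [mul_assoc, h1], h2, by omega⟩
  · obtain ⟨h1, h2, h3⟩ := N.R_mem (right_ne_zero_of_mul hu)
    have := ((hz _).2 (left_ne_zero_of_mul hu)).2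
    exact ⟨by rw [mul_assoc, h1], h2, by omega⟩

end Conjugator

end QuasiGraphMap

/-! ### The cone is isomorphic to the complex of the crossed diagram -/

namespace QuasiGraphMap

namespace Conjugator

variable {m n : ℕ} {σ : Walk Q m} {τ : Walk Q n} {φ : QuasiGraphMap σ τ}
  {χ : ZMod m → kˣ} {ψ : ZMod n → kˣ} {e : kˣ} (N : φ.Conjugator χ ψ e)

variable (m n Q k) in
/-- The inclusion of the terms of `σ` into those of the diagram `crossing`. -/
def inl : (ZMod m → Alg k Q) →ₗ[Alg k Q] (ZMod m ⊕ ZMod n → Alg k Q) where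
  toFun z := Sum.elim z 0
  map_add' x y := by ext (i | i) <;> simp
  map_smul' a x := by ext (i | i) <;> simp

/-- The map from the terms of `τ` to those of the diagram `crossing`. -/
def inr : (ZMod n → Alg k Q) →ₗ[Alg k Q] (ZMod m ⊕ ZMod n → Alg k Q) where
  toFun z := Sum.elim (N.map z) z
  map_add' x y := by ext (i | i) <;> simp
  map_smul' a x := by ext (i | i) <;> simp

/-- The projection to the terms of `σ`. -/
def fst : (ZMod m ⊕ ZMod n → Alg k Q) →ₗ[Alg k Q] (ZMod m → Alg k Q) :=
  LinearMap.funLeft _ _ Sum.inl - N.map.comp (LinearMap.funLeft _ _ Sum.inr)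

variable (m n Q k) in
/-- The projection to the terms of `τ`. -/
def snd : (ZMod m ⊕ ZMod n → Alg k Q) →ₗ[Alg k Q] (ZMod n → Alg k Q) :=
  LinearMap.funLeft _ _ Sum.inr

lemma fst_inl (z : ZMod m → Alg k Q) : N.fst (inl k Q m n z) = z := by
  have : LinearMap.funLeft (Alg k Q) (Alg k Q) Sum.inr (inl k Q m n z) = 0 := rfl
  rw [fst, LinearMap.sub_apply, LinearMap.comp_apply, this, map_zero, sub_zero]
  rfl

lemma fst_inr (z : ZMod n → Alg k Q) : N.fst (N.inr z) = 0 := by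
  rw [fst, LinearMap.sub_apply, LinearMap.comp_apply]
  exact sub_self (N.map z)

lemma inl_fst_add_inr_snd (w : ZMod m ⊕ ZMod n → Alg k Q) :
    inl k Q m n (N.fst w) + N.inr (snd k Q m n w) = w := by
  ext (i | i)
  · exact sub_add_cancel (w (Sum.inl i)) _
  · exact zero_add (w (Sum.inr i))

/-- In the `σ` part this is `map_diff_add_diff_map`. In the `τ` part, the crossed diagram has lost
the entries along `τ_R` within `τ`, and they are recovered from `N z` through the new letters, the
factors `e` and `e⁻¹` cancelling. -/
lemma diff_inr (h : φ.CrossingJunction) (z : ZMod n → Alg k Q) :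
    (crossing h).diff (φ.crossingCoeff χ ψ e) (N.inr z) = N.inr (τ.diff ψ z) := by
  have hx := φ.pos_add_one φ.len
  have hy := φ.pos'_add_one φ.len
  ext (j | j)
  · have key := congrFun (N.map_diff_add_diff_map z) j
    have hs : φ.pos φ.len ≠ φ.pos (φ.len + 1) := φ.pos_ne (by omega) (by omega)
    rw [crossing_diff_inl, hx, hy]
    change _ = N.map (τ.diff ψ z) j
    rw [Pi.add_apply, Pi.add_apply, Walk.diff_apply, Pi.single_apply, Pi.single_apply] at key
    rw [eq_sub_of_add_eq key]
    simp only [inr, LinearMap.coe_mk, AddHom.coe_mk, Sum.elim_inl, Sum.elim_inr]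
    by_cases h1 : j = φ.pos φ.len
    · subst h1
      rw [if_neg hs, if_pos rfl, if_pos rfl, if_neg hs, hx, N.map_apply_len_add_one,
        mul_smul_comm, two_smul]
      abel
    · by_cases h2 : j = φ.pos (φ.len + 1)
      · subst h2
        rw [if_pos rfl, if_neg hs.symm, if_neg hs.symm, if_pos rfl, pos_sub_one,
          add_sub_cancel_right, N.map_apply_len, mul_smul_comm, two_smul, smul_mul_assoc]
        abel
      · rw [if_neg h1, if_neg h1, if_neg h2, if_neg h2]
        abel
  · have hs : φ.pos' φ.len ≠ φ.pos' (φ.len + 1) := φ.pos'_ne (by omega) (by omega)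
    rw [crossing_diff_inr, hx, hy]
    change _ = τ.diff ψ z j
    rw [Walk.diff_apply]
    simp only [inr, LinearMap.coe_mk, AddHom.coe_mk, Sum.elim_inl, Sum.elim_inr]
    congr 1
    · split_ifs with h1
      · subst h1
        rw [N.map_apply_len, pos'_sub_one, add_sub_cancel_right]
        simp [smul_smul]
      · rfl
    · split_ifs with h1
      · subst h1
        rw [mul_smul_comm, N.map_apply_len_add_one, hy]
        simp [smul_smul]
      · rfl

/-- On the terms of `σ` the crossed differential is `-d` without the entries along `σ_R`, plus the
components of `g`. The missing entries are `N g` by `map_rightEnd`, so the correction is the image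
of `g z`. -/
lemma diff_inl_add (h : φ.CrossingJunction) (z : ZMod m → Alg k Q) :
    (crossing h).diff (φ.crossingCoeff χ ψ e) (inl k Q m n z) + inl k Q m n (σ.diff χ z) =
      N.inr (φ.rightEnd χ ψ e z) := by
  have hx := φ.pos_add_one φ.len
  have hy := φ.pos'_add_one φ.len
  ext (j | j)
  · have hs : φ.pos φ.len ≠ φ.pos (φ.len + 1) := φ.pos_ne (by omega) (by omega)
    rw [Pi.add_apply, crossing_diff_inl, hx, hy]
    change _ + σ.diff χ z j = N.map (φ.rightEnd χ ψ e z) j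
    rw [map_rightEnd, Pi.add_apply, Pi.single_apply, Pi.single_apply, Walk.diff_apply]
    simp only [inl, LinearMap.coe_mk, AddHom.coe_mk, Sum.elim_inl, Sum.elim_inr, Pi.zero_apply,
      zero_mul]
    by_cases h1 : j = φ.pos φ.len
    · subst h1
      rw [if_neg hs, if_pos rfl, if_pos rfl, if_neg hs, hx]
      abel
    · by_cases h2 : j = φ.pos (φ.len + 1)
      · subst h2
        rw [if_pos rfl, if_neg hs.symm, if_neg hs.symm, if_pos rfl, pos_sub_one,
          add_sub_cancel_right]
        abel
      · rw [if_neg h1, if_neg h1, if_neg h2, if_neg h2]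
        abel
  · rw [Pi.add_apply, crossing_diff_inr, hx, hy]
    change _ + 0 = φ.rightEnd χ ψ e z j
    rw [rightEnd, Pi.add_apply, Pi.single_apply, Pi.single_apply]
    simp only [inl, LinearMap.coe_mk, AddHom.coe_mk, Sum.elim_inl, Sum.elim_inr, Pi.zero_apply,
      zero_mul, mul_smul_comm]
    rw [add_zero, add_comm]

lemma inl_mem (h : φ.CrossingJunction) {d d' : ℤ} (hd : d + 1 = d') :
    ∀ z ∈ σ.term k d', inl k Q m n z ∈ (crossing h).term k d := by
  rintro z hz (i | i)
  · refine ⟨(hz i).1, fun h' => ⟨((hz i).2 h').1, ?_⟩⟩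
    change σ.deg i - 1 = d
    rw [((hz i).2 h').2]
    omega
  · simp [inl]

lemma inr_mem (h : φ.CrossingJunction) (d : ℤ) :
    ∀ z ∈ τ.term k d, N.inr z ∈ (crossing h).term k d := by
  rintro z hz (i | i)
  · exact inl_mem h rfl _ (N.map_mem rfl z hz) (Sum.inl i)
  · exact hz i

lemma snd_mem (h : φ.CrossingJunction) (d : ℤ) :
    ∀ w ∈ (crossing h).term k d, snd k Q m n w ∈ τ.term k d :=
  fun _ hw i => hw (Sum.inr i)

lemma fst_mem (h : φ.CrossingJunction) {d d' : ℤ} (hd : d + 1 = d') :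
    ∀ w ∈ (crossing h).term k d, N.fst w ∈ σ.term k d' := by
  intro w hw
  refine sub_mem (fun i => ?_) (N.map_mem hd _ (snd_mem h d w hw))
  refine ⟨(hw (Sum.inl i)).1, fun h' => ⟨((hw (Sum.inl i)).2 h').1, ?_⟩⟩
  have : σ.deg i - 1 = d := ((hw (Sum.inl i)).2 h').2
  omega

open CochainComplex HomComplex in
/-- The mapping cone of the map at the right end of `ρ` is isomorphic to the complex of the diagram
`crossing`. -/
lemma nonempty_iso (N : φ.Conjugator χ ψ e) (h : φ.CrossingJunction) (g : σ.complex χ ⟶ τ.complex ψ)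
    (hg : HasComponents χ ψ g (φ.rightEnd χ ψ e)) :
    Nonempty (mappingCone g ≅ (crossing h).complex (φ.crossingCoeff χ ψ e)) := by
  let Y := (crossing h).complex (φ.crossingCoeff χ ψ e)
  let α : Cochain (σ.complex χ) Y (-1) := Cochain.mk fun p q hpq =>
    ModuleCat.ofHom ((inl k Q m n).restrict (inl_mem h (by omega)))
  let β : τ.complex ψ ⟶ Y := Diagram.homOf τ.toDiagram (crossing h) ψ (φ.crossingCoeff χ ψ e)
    N.inr (N.inr_mem h) fun d z _ => N.diff_inr h z
  -- This is the condition for the cochain `α` and the chain map `β` to define a map out of the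
  -- cone; for degree `-1` the two terms of the coboundary enter with the same sign, as in
  -- `diff_inl_add`.
  have eq : δ (-1) 0 α = Cochain.ofHom (g ≫ β) := by
    refine Cochain.ext₀ _ _ fun p => ?_
    rw [δ_v (-1) 0 (by omega) α p p (by omega) (p - 1) (p + 1) (by omega) rfl, Cochain.ofHom_v,
      Int.negOnePow_zero, one_smul, Walk.complex_d _ _ rfl]
    have e1 : Y.d (p - 1) p = _ := Diagram.complex_d _ _ (sub_add_cancel p 1)
    rw [e1]
    ext z
    refine Subtype.ext ((N.diff_inl_add h z.1).trans ?_)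
    exact congrArg N.inr (hg p z).symm
  let F := mappingCone.desc g α β eq
  let p : ∀ d : ℤ, Y.X d ⟶ (σ.complex χ).X (d + 1) := fun d =>
    ModuleCat.ofHom (N.fst.restrict (N.fst_mem h rfl))
  let q : ∀ d : ℤ, Y.X d ⟶ (τ.complex ψ).X d := fun d =>
    ModuleCat.ofHom ((snd k Q m n).restrict (snd_mem h d))
  -- The inverse of the unipotent matrix, `w ↦ (w_σ - N w_τ, w_τ)`. A degreewise inverse is enough,
  -- since `F` is a chain map.
  let G : ∀ d : ℤ, Y.X d ⟶ (mappingCone g).X d := fun d =>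
    p d ≫ (mappingCone.inl g).v (d + 1) d (by omega) + q d ≫ (mappingCone.inr g).f d
  have hG : ∀ d, G d = p d ≫ (mappingCone.inl g).v (d + 1) d (by omega) +
    q d ≫ (mappingCone.inr g).f d := fun d => rfl
  have hFG : ∀ d, F.f d ≫ G d = 𝟙 _ := by
    intro d
    refine mappingCone.ext_from g (d + 1) d rfl ?_ ?_
    · have e1 : α.v (d + 1) d (by omega) ≫ p d = 𝟙 _ := by
        ext z
        exact Subtype.ext (N.fst_inl z.1)
      have e2 : α.v (d + 1) d (by omega) ≫ q d = 0 := by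
        ext z
        rfl
      rw [← Category.assoc, mappingCone.inl_v_desc_f, hG, Preadditive.comp_add, ← Category.assoc,
        ← Category.assoc, Category.comp_id, e1, e2, zero_comp, add_zero, Category.id_comp]
    · have e1 : β.f d ≫ p d = 0 := by
        ext z
        exact Subtype.ext (N.fst_inr z.1)
      have e2 : β.f d ≫ q d = 𝟙 _ := by
        ext z
        rfl
      rw [← Category.assoc, mappingCone.inr_f_desc_f, hG, Preadditive.comp_add, ← Category.assoc,
        ← Category.assoc, Category.comp_id, e1, e2, zero_comp, zero_add, Category.id_comp]
  have hGF : ∀ d, G d ≫ F.f d = 𝟙 _ := by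
    intro d
    rw [hG, Preadditive.add_comp, Category.assoc, Category.assoc, mappingCone.inl_v_desc_f,
      mappingCone.inr_f_desc_f]
    ext w
    exact Subtype.ext (N.inl_fst_add_inr_snd w.1)
  exact ⟨HomologicalComplex.Hom.isoOfComponents
    (fun d => ⟨F.f d, G d, hFG d, hGF d⟩) fun i j _ => F.comm i j⟩

end Conjugator

end QuasiGraphMap

/-! ### Replacing a representative by a homotopic one -/

open CochainComplex Pretriangulated in
/-- The mapping cones of homotopic maps are isomorphic in the homotopy category. -/
lemma isoK_mappingCone_of_homotopy {R : Type*} [Ring R]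
    {X Y : CochainComplex (ModuleCat R) ℤ} {f g : X ⟶ Y} (H : Homotopy f g) :
    IsoK (mappingCone f) (mappingCone g) := by
  have H' : Homotopy (f ≫ 𝟙 Y) (𝟙 X ≫ g) :=
    (Homotopy.ofEq (Category.comp_id f)).trans (H.trans (Homotopy.ofEq (Category.id_comp g).symm))
  have := isIso₃_of_isIso₁₂ (mappingCone.trianglehMapOfHomotopy H')
    (HomotopyCategory.mappingCone_triangleh_distinguished f)
    (HomotopyCategory.mappingCone_triangleh_distinguished g)
    (by rw [mappingCone.trianglehMapOfHomotopy_hom₁]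
        exact ((HomotopyCategory.quotient _ _).mapIso (Iso.refl X)).isIso_hom)
    (by rw [mappingCone.trianglehMapOfHomotopy_hom₂]
        exact ((HomotopyCategory.quotient _ _).mapIso (Iso.refl Y)).isIso_hom)
  rw [mappingCone.trianglehMapOfHomotopy_hom₃] at this
  exact ⟨@asIso _ _ _ _ ((HomotopyCategory.quotient _ _).map (mappingCone.mapOfHomotopy H')) this⟩

lemma IsoK.of_iso {R : Type*} [Ring R] {X Y : CochainComplex (ModuleCat R) ℤ} (i : X ≅ Y) :
    IsoK X Y := ⟨(HomotopyCategory.quotient _ _).mapIso i⟩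

lemma IsoK.trans {R : Type*} [Ring R] {X Y Z : CochainComplex (ModuleCat R) ℤ} (h : IsoK X Y)
    (h' : IsoK Y Z) : IsoK X Z := ⟨h.some ≪≫ h'.some⟩

/-- The mapping cone of a representative of the homotopy class of a quasi-graph map is the complex
of the diagram `crossing`. -/
lemma QuasiGraphMap.exists_isoK_crossing {m n : ℕ} {σ : Walk Q m} {τ : Walk Q n}
    {φ : QuasiGraphMap σ τ} (hφ : φ.CompatiblyOriented) {χ : ZMod m → kˣ} {ψ : ZMod n → kˣ}
    {f : σ.complex χ ⟶ τ.complex ψ} (hf : φ.IsRepresentative χ ψ f) :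
    ∃ (h : φ.CrossingJunction) (e : kˣ), IsoK (CochainComplex.mappingCone f)
      ((crossing h).complex (φ.crossingCoeff χ ψ e)) := by
  obtain ⟨g, e, ⟨H⟩, hg⟩ := hf.exists_homotopy
  have hg := hg.congr χ ψ (fun z => φ.smul_rightComponents e z)
  obtain ⟨N⟩ := φ.exists_conjugator χ ψ e
  have h := φ.crossing_junction hφ hg
  obtain ⟨i⟩ := N.nonempty_iso h g hg
  exact ⟨h, e, (isoK_mappingCone_of_homotopy H).trans (IsoK.of_iso i)⟩

/-! ### Decomposing a diagram into walks -/

namespace Diagram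

variable {P : Type} (D : Diagram Q P)

/-- The walk in a diagram along a map `θ` compatible with the successor functions. -/
def toWalk {r : ℕ} (θ : ZMod r → P) (hθ : ∀ i, θ (i + 1) = D.next (θ i)) : Walk Q r where
  dom i := D.dom (θ i)
  vtx i := D.vtx (θ i)
  deg i := D.deg (θ i)
  letter i := D.letter (θ i)
  letter_isSome i := by rw [hθ, D.letter_isSome]
  vtx_left i := D.vtx_left (θ i)
  vtx_right i := by rw [hθ]; exact D.vtx_right (θ i)
  deg_step i := by rw [hθ]; exact D.deg_step (θ i)
  junction i := by rw [hθ]; exact D.junction (θ i)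

lemma next_symm_apply {r : ℕ} {θ : ZMod r → P} (hθ : ∀ i, θ (i + 1) = D.next (θ i)) (i : ZMod r) :
    D.next.symm (θ i) = θ (i - 1) := by
  rw [Equiv.symm_apply_eq, ← hθ, sub_add_cancel]

lemma toWalk_diff {r : ℕ} (θ : ZMod r → P) (hθ : ∀ i, θ (i + 1) = D.next (θ i)) (χ : P → kˣ)
    (z : P → Alg k Q) : (D.toWalk θ hθ).diff (χ ∘ θ) (z ∘ θ) = D.diff χ z ∘ θ := by
  ext i
  change z (θ (i - 1)) * D.fwd χ (θ (i - 1)) + z (θ (i + 1)) * D.bwd χ (θ i) =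
    z (D.next.symm (θ i)) * D.fwd χ (D.next.symm (θ i)) + z (D.next (θ i)) * D.bwd χ (θ i)
  rw [D.next_symm_apply hθ, hθ]

lemma comp_mem_term {r : ℕ} (θ : ZMod r → P) (hθ : ∀ i, θ (i + 1) = D.next (θ i)) (d : ℤ) :
    ∀ z ∈ D.term k d, z ∘ θ ∈ (D.toWalk θ hθ).term k d := fun _ hz i => hz (θ i)

/-- Restriction to a walk in a diagram. -/
def restrictHom {r : ℕ} (θ : ZMod r → P) (hθ : ∀ i, θ (i + 1) = D.next (θ i)) (χ : P → kˣ) :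
    D.complex χ ⟶ (D.toWalk θ hθ).complex (χ ∘ θ) :=
  homOf D (D.toWalk θ hθ).toDiagram χ (χ ∘ θ) (LinearMap.funLeft _ _ θ) (D.comp_mem_term θ hθ)
    fun _ z _ => D.toWalk_diff θ hθ χ z

/-- A diagram which consists of a single walk has the complex of this walk. -/
def isoToWalk {r : ℕ} (θ : ZMod r ≃ P) (hθ : ∀ i, θ (i + 1) = D.next (θ i)) (χ : P → kˣ) :
    D.complex χ ≅ (D.toWalk θ hθ).complex (χ ∘ θ) :=
  isoOf D (D.toWalk θ hθ).toDiagram χ (χ ∘ θ) (LinearMap.funLeft _ _ θ)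
    (LinearMap.funLeft _ _ θ.symm) (D.comp_mem_term θ hθ)
    (fun d z hz i => by
      have := hz (θ.symm i)
      simpa [Walk.toDiagram, toWalk] using this)
    (fun _ z _ => D.toWalk_diff θ hθ χ z)
    (fun z => by ext i; simp [LinearMap.funLeft_apply])
    (fun z => by ext i; simp [LinearMap.funLeft_apply])

section Biproduct

variable {r₁ r₂ : ℕ} (Θ : ZMod r₁ ⊕ ZMod r₂ ≃ P)

/-- Extension by zero from the first of two walks. -/
def extendLeft : (ZMod r₁ → Alg k Q) →ₗ[Alg k Q] (P → Alg k Q) where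
  toFun z := Sum.elim z 0 ∘ Θ.symm
  map_add' x y := by
    ext p
    rcases h : Θ.symm p with i | i <;> simp [h]
  map_smul' a x := by
    ext p
    rcases h : Θ.symm p with i | i <;> simp [h]

lemma extendLeft_inl (z : ZMod r₁ → Alg k Q) (i : ZMod r₁) :
    extendLeft (k := k) (Q := Q) Θ z (Θ (Sum.inl i)) = z i := by
  simp [extendLeft]

lemma extendLeft_inr (z : ZMod r₁ → Alg k Q) (i : ZMod r₂) :
    extendLeft (k := k) (Q := Q) Θ z (Θ (Sum.inr i)) = 0 := by
  simp [extendLeft]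

/-- Extension by zero as a chain map. -/
def extendHom (h₁ : ∀ i, Θ (Sum.inl (i + 1)) = D.next (Θ (Sum.inl i)))
    (h₂ : ∀ i, Θ (Sum.inr (i + 1)) = D.next (Θ (Sum.inr i))) (χ : P → kˣ) :
    (D.toWalk (fun i => Θ (Sum.inl i)) h₁).complex (χ ∘ fun i => Θ (Sum.inl i)) ⟶ D.complex χ :=
  homOf (D.toWalk (fun i => Θ (Sum.inl i)) h₁).toDiagram D _ χ (extendLeft Θ)
    (fun d z hz p => by
      obtain ⟨i | i, rfl⟩ := Θ.surjective p
      · rw [extendLeft_inl]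
        exact hz i
      · simp [extendLeft_inr])
    (fun d z _ => by
      ext p
      change extendLeft Θ z _ * D.fwd χ _ + extendLeft Θ z _ * D.bwd χ _ = _
      obtain ⟨i | i, rfl⟩ := Θ.surjective p
      · rw [D.next_symm_apply (θ := fun i => Θ (Sum.inl i)) h₁, ← h₁, extendLeft_inl,
          extendLeft_inl, extendLeft_inl]
        rfl
      · rw [D.next_symm_apply (θ := fun i => Θ (Sum.inr i)) h₂, ← h₂, extendLeft_inr,
          extendLeft_inr, extendLeft_inr]
        simp)

/-- A diagram which consists of two walks has the direct sum of the complexes of these walks. -/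
lemma nonempty_iso_biprod (h₁ : ∀ i, Θ (Sum.inl (i + 1)) = D.next (Θ (Sum.inl i)))
    (h₂ : ∀ i, Θ (Sum.inr (i + 1)) = D.next (Θ (Sum.inr i))) (χ : P → kˣ) :
    Nonempty (D.complex χ ≅
      (D.toWalk (fun i => Θ (Sum.inl i)) h₁).complex (χ ∘ fun i => Θ (Sum.inl i)) ⊞
      (D.toWalk (fun i => Θ (Sum.inr i)) h₂).complex (χ ∘ fun i => Θ (Sum.inr i))) := by
  -- With the two walks exchanged, extension from the first walk also serves for the second.
  let Ψ : ZMod r₂ ⊕ ZMod r₁ ≃ P := (Equiv.sumComm _ _).trans Θ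
  let b : BinaryBicone
      ((D.toWalk (fun i => Θ (Sum.inl i)) h₁).complex (χ ∘ fun i => Θ (Sum.inl i)))
      ((D.toWalk (fun i => Θ (Sum.inr i)) h₂).complex (χ ∘ fun i => Θ (Sum.inr i))) :=
    { pt := D.complex χ
      fst := D.restrictHom _ h₁ χ
      snd := D.restrictHom _ h₂ χ
      inl := D.extendHom Θ h₁ h₂ χ
      inr := D.extendHom Ψ h₂ h₁ χ
      inl_fst := by
        ext d z
        exact Subtype.ext (funext fun i => extendLeft_inl Θ z.1 i)
      inl_snd := by
        ext d z
        exact Subtype.ext (funext fun i => extendLeft_inr Θ z.1 i)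
      inr_fst := by
        ext d z
        exact Subtype.ext (funext fun i => extendLeft_inr Ψ z.1 i)
      inr_snd := by
        ext d z
        exact Subtype.ext (funext fun i => extendLeft_inl Ψ z.1 i) }
  refine ⟨biprod.uniqueUpToIso _ _ (isBinaryBilimitOfTotal b ?_)⟩
  ext d z
  refine Subtype.ext (funext fun p => ?_)
  change extendLeft Θ (fun i => z.1 (Θ (Sum.inl i))) p +
    extendLeft Ψ (fun i => z.1 (Θ (Sum.inr i))) p = z.1 p
  obtain ⟨i | i, rfl⟩ := Θ.surjective p
  · rw [extendLeft_inl, show Θ (Sum.inl i) = Ψ (Sum.inr i) from rfl, extendLeft_inr, add_zero]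
  · rw [extendLeft_inr, show Θ (Sum.inr i) = Ψ (Sum.inl i) from rfl, extendLeft_inl, zero_add]
    rfl

end Biproduct

end Diagram

/-! ### Rescaling coefficients on lines and cycles -/

namespace Letter

lemma orient_mul (X : Option (Letter Q)) (u v : kˣ) :
    orient X (u * v) = orient X u * orient X v := by
  rcases X with _ | l
  · rfl
  · rcases hl : l.inv <;> simp [orient, hl, mul_comm]

lemma orient_orient (X : Option (Letter Q)) (u : kˣ) : orient X (orient X u) = u := by
  rcases X with _ | l
  · rfl
  · rcases hl : l.inv <;> simp [orient, hl]

lemma orient_neg (X : Option (Letter Q)) (u : kˣ) : orient X (-u) = -orient X u := by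
  rcases X with _ | l
  · rfl
  · rcases hl : l.inv <;> simp [orient, hl]

lemma orient_one (X : Option (Letter Q)) : orient X (1 : kˣ) = 1 := by
  rcases X with _ | l <;> simp [orient]

end Letter

namespace Walk

variable {r : ℕ} (w : Walk Q r)

/-- Inverting the coefficients of inverse letters makes the base change condition the same for both
orientations: the oriented coefficient changes by `u (i + 1) / u i`. -/
lemma smul_fwd {χ χ' u : ZMod r → kˣ} (i : ZMod r)
    (h : Letter.orient (w.letter i) (χ' i) * u i = Letter.orient (w.letter i) (χ i) * u (i + 1)) :
    (u i : k) • w.fwd χ' i = (u (i + 1) : k) • w.fwd χ i := by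
  rw [fwd_eq, fwd_eq]
  rcases hl : w.letter i with _ | l
  · simp [Letter.fw]
  · rcases hi : l.inv
    · simp only [hl, Letter.orient, Option.elim, hi, Bool.false_eq_true, if_false] at h
      rw [smul_smul, smul_smul, ← Units.val_mul, ← Units.val_mul, mul_comm, h, mul_comm]
    · simp [Letter.fw, hi]

lemma smul_bwd {χ χ' u : ZMod r → kˣ} (i : ZMod r)
    (h : Letter.orient (w.letter i) (χ' i) * u i = Letter.orient (w.letter i) (χ i) * u (i + 1)) :
    (u (i + 1) : k) • w.bwd χ' i = (u i : k) • w.bwd χ i := by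
  rw [bwd_eq, bwd_eq]
  rcases hl : w.letter i with _ | l
  · simp [Letter.bw]
  · rcases hi : l.inv
    · simp [Letter.bw, hi]
    · simp only [hl, Letter.orient, Option.elim, hi, if_true] at h
      have : u (i + 1) * χ' i = u i * χ i := by
        rw [inv_mul_eq_iff_eq_mul, mul_left_comm, eq_inv_mul_iff_mul_eq] at h
        rw [mul_comm (u i), h, mul_comm]
      rw [smul_smul, smul_smul, ← Units.val_mul, ← Units.val_mul, this]

lemma smul_mem_term (u : ZMod r → kˣ) (d : ℤ) {z : ZMod r → Alg k Q} (hz : z ∈ w.term k d) :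
    (fun i => (u i : k) • z i) ∈ w.term k d := fun i =>
  ⟨by rw [smul_mul_assoc, (hz i).1], fun h => (hz i).2 fun h' => h (by simp only [h', smul_zero])⟩

/-- The complexes of a walk with two systems of coefficients are isomorphic if these differ by a
change of bases. -/
lemma nonempty_iso_of_gauge {χ χ' u : ZMod r → kˣ}
    (h : ∀ i, Letter.orient (w.letter i) (χ' i) * u i =
      Letter.orient (w.letter i) (χ i) * u (i + 1)) :
    Nonempty (w.complex χ ≅ w.complex χ') := by
  let F : (ZMod r → kˣ) → (ZMod r → Alg k Q) →ₗ[Alg k Q] (ZMod r → Alg k Q) := fun u =>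
    { toFun := fun z i => (u i : k) • z i
      map_add' := fun x y => by ext i; simp
      map_smul' := fun a x => by ext i; simp }
  refine ⟨Diagram.isoOf w.toDiagram w.toDiagram χ χ' (F u) (F u⁻¹)
    (fun d z hz => w.smul_mem_term u d hz) (fun d z hz => w.smul_mem_term u⁻¹ d hz)
    (fun d z hz => ?_) (fun z => ?_) (fun z => ?_)⟩
  · ext j
    change ((u (j - 1) : k) • z (j - 1)) * w.fwd χ' (j - 1) +
      ((u (j + 1) : k) • z (j + 1)) * w.bwd χ' j =
      (u j : k) • (z (j - 1) * w.fwd χ (j - 1) + z (j + 1) * w.bwd χ j)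
    have e1 := w.smul_fwd (j - 1) (h (j - 1))
    have e2 := w.smul_bwd j (h j)
    rw [sub_add_cancel] at e1
    rw [smul_mul_assoc, smul_mul_assoc, ← mul_smul_comm, ← mul_smul_comm, e1, e2, mul_smul_comm,
      mul_smul_comm, smul_add]
  · ext j
    simp [F, smul_smul]
  · ext j
    simp [F, smul_smul]

end Walk

/-- The recursion has to run in both directions from `0`. It is encoded as a permutation of `ℤ × G`,
whose integer powers give the solution in the second coordinate. -/
lemma exists_int_potential {G : Type*} [CommGroup G] (s : ℤ → G) :
    ∃ u : ℤ → G, ∀ i, u (i + 1) = u i * s i := by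
  let E : Equiv.Perm (ℤ × G) :=
    { toFun := fun x => (x.1 + 1, x.2 * s x.1)
      invFun := fun x => (x.1 - 1, x.2 * (s (x.1 - 1))⁻¹)
      left_inv := fun x => by simp
      right_inv := fun x => by simp }
  have h1 : ∀ i : ℤ, ((E ^ (i + 1)) (0, 1)) = E ((E ^ i) (0, 1)) := fun i => by
    rw [add_comm, zpow_add, zpow_one, Equiv.Perm.mul_apply]
  have h2 : ∀ i : ℤ, ((E ^ i) (0, 1)).1 = i := by
    intro i
    induction i using Int.induction_on with
    | zero => simp
    | succ i ih => rw [h1]; change _ + 1 = _; rw [ih]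
    | pred i ih =>
      have := congrArg Prod.fst (h1 (-i - 1))
      rw [sub_add_cancel, ih] at this
      change _ = _ + 1 at this
      omega
  refine ⟨fun i => ((E ^ i) (0, 1)).2, fun i => ?_⟩
  beta_reduce
  rw [h1]
  change _ * s _ = _
  rw [h2]

lemma prod_range_zmod {G : Type*} [CommMonoid G] {r : ℕ} [NeZero r] (s : ZMod r → G) :
    ∏ v ∈ Finset.range r, s (v : ZMod r) = ∏ i, s i := by
  refine Finset.prod_bij (fun v _ => (v : ZMod r)) (fun _ _ => Finset.mem_univ _) ?_ ?_
    (fun _ _ => rfl)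
  · intro a ha b hb h
    have := congrArg ZMod.val h
    rwa [ZMod.val_cast_of_lt (Finset.mem_range.1 ha), ZMod.val_cast_of_lt (Finset.mem_range.1 hb)]
      at this
  · intro i _
    exact ⟨i.val, Finset.mem_range.2 (ZMod.val_lt i), ZMod.natCast_zmod_val i⟩

/-- Partial products solve the recursion; the condition on the full product is what makes them close
up after one turn. -/
lemma exists_cyclic_potential {G : Type*} [CommGroup G] {r : ℕ} [NeZero r] (s : ZMod r → G)
    (hs : ∏ i, s i = 1) : ∃ u : ZMod r → G, ∀ i, u (i + 1) = u i * s i := by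
  refine ⟨fun i => ∏ v ∈ Finset.range i.val, s (v : ZMod r), fun i => ?_⟩
  have h1 : (∏ v ∈ Finset.range i.val, s (v : ZMod r)) * s i =
      ∏ v ∈ Finset.range (i.val + 1), s (v : ZMod r) := by
    rw [Finset.prod_range_succ, ZMod.natCast_zmod_val]
  beta_reduce
  rw [h1]
  have hi : i + 1 = ((i.val + 1 : ℕ) : ZMod r) := by
    rw [Nat.cast_succ, ZMod.natCast_zmod_val]
  rcases Nat.lt_or_ge (i.val + 1) r with h | h
  · rw [hi, ZMod.val_cast_of_lt h]
  · have : i.val + 1 = r := le_antisymm (ZMod.val_lt i) h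
    rw [hi, this, ZMod.natCast_self, ZMod.val_zero, Finset.range_zero, Finset.prod_empty,
      prod_range_zmod, hs]

namespace Walk

/-- All choices of coefficients on a linear walk give isomorphic complexes. -/
lemma nonempty_iso_linear (w : Walk Q 0) (χ χ' : ZMod 0 → kˣ) :
    Nonempty (w.complex χ ≅ w.complex χ') := by
  obtain ⟨u, hu⟩ : ∃ u : ZMod 0 → kˣ, ∀ i, u (i + 1) =
      u i * (Letter.orient (w.letter i) (χ' i) / Letter.orient (w.letter i) (χ i)) :=
    exists_int_potential fun i : ℤ =>
      Letter.orient (w.letter (i : ZMod 0)) (χ' (i : ZMod 0)) /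
        Letter.orient (w.letter (i : ZMod 0)) (χ (i : ZMod 0))
  refine w.nonempty_iso_of_gauge (u := u) fun i => ?_
  rw [hu, mul_comm, mul_left_comm]
  exact congrArg _ (mul_div_cancel _ _).symm

/-- Two choices of coefficients on a closed walk give isomorphic complexes if their products agree,
where the coefficients of inverse letters are inverted. -/
lemma nonempty_iso_closed {r : ℕ} [NeZero r] (w : Walk Q r) (χ χ' : ZMod r → kˣ)
    (h : ∏ i, Letter.orient (w.letter i) (χ i) = ∏ i, Letter.orient (w.letter i) (χ' i)) :
    Nonempty (w.complex χ ≅ w.complex χ') := by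
  obtain ⟨u, hu⟩ := exists_cyclic_potential (fun i =>
    Letter.orient (w.letter i) (χ' i) / Letter.orient (w.letter i) (χ i))
    (by rw [Finset.prod_div_distrib, h, div_self'])
  refine w.nonempty_iso_of_gauge (u := u) fun i => ?_
  rw [hu, mul_comm, mul_left_comm]
  exact congrArg _ (mul_div_cancel _ _).symm

lemma prod_orient_scalarAt {r : ℕ} [NeZero r] (w : Walk Q r) (i : ZMod r) (c : kˣ) :
    ∏ j, Letter.orient (w.letter j) (scalarAt i c j) = Letter.orient (w.letter i) c := by
  rw [Finset.prod_eq_single i]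
  · simp [scalarAt]
  · intro j _ hj
    rw [scalarAt, Pi.mulSingle_eq_of_ne hj, Letter.orient_one]
  · simp

/-- A closed walk has an even number of letters. -/
lemma IsClosed.even {r : ℕ} {w : Walk Q r} (h : w.IsClosed) : Even r := by
  have : NeZero r := ⟨h.1.ne'⟩
  have h1 : ∑ i, (w.deg (i + 1) - w.deg i) = 0 := by
    rw [Finset.sum_sub_distrib, sub_eq_zero]
    exact Equiv.sum_comp (Equiv.addRight (1 : ZMod r)) w.deg
  have h2 : ((∑ i, (w.deg (i + 1) - w.deg i) : ℤ) : ZMod 2) = (r : ZMod 2) := by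
    rw [Int.cast_sum, Finset.sum_congr rfl (g := fun _ => (1 : ZMod 2)), Finset.sum_const,
      Finset.card_univ, ZMod.card, nsmul_one]
    intro i _
    obtain ⟨l, hl⟩ := Option.isSome_iff_exists.1 ((w.letter_isSome i).2 ⟨h.2 _, h.2 _⟩)
    rw [w.deg_step i l hl, add_sub_cancel_left]
    split_ifs
    · rfl
    · rfl
  rw [h1, Int.cast_zero] at h2
  exact even_iff_two_dvd.2 ((ZMod.natCast_eq_zero_iff r 2).1 h2.symm)

end Walk

lemma prod_ite_eq_mul_div {G ι : Type*} [CommGroup G] [Fintype ι] [DecidableEq ι] (f : ι → G)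
    (x : ι) (a : G) : ∏ j, (if j = x then a else f j) = (∏ j, f j) * (a / f x) := by
  have : ∀ j, (if j = x then a else f j) = f j * if j = x then a / f x else 1 := by
    intro j
    split_ifs with h
    · rw [h, mul_div_cancel]
    · rw [mul_one]
  rw [Finset.prod_congr rfl fun j _ => this j, Finset.prod_mul_distrib, Finset.prod_ite_eq']
  simp

/-- The product of the coefficients of the diagram `crossing` of two closed walks. -/
lemma QuasiGraphMap.prod_orient_crossingCoeff {m n : ℕ} [NeZero m] [NeZero n] {σ : Walk Q m}
    {τ : Walk Q n} {φ : QuasiGraphMap σ τ} (h : φ.CrossingJunction) (hm : Even m)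
    (χ : ZMod m → kˣ) (ψ : ZMod n → kˣ) (e : kˣ) :
    ∏ p, Letter.orient ((crossing h).letter p) (φ.crossingCoeff χ ψ e p) =
      -((∏ i, Letter.orient (σ.letter i) (χ i)) * ∏ j, Letter.orient (τ.letter j) (ψ j)) := by
  set f : ZMod m → kˣ := fun i => Letter.orient (σ.letter i) (χ i) with hf
  set g : ZMod n → kˣ := fun j => Letter.orient (τ.letter j) (ψ j) with hg
  rw [Fintype.prod_sum_type]
  have h1 : ∀ i, Letter.orient ((crossing h).letter (Sum.inl i))
      (φ.crossingCoeff χ ψ e (Sum.inl i)) =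
      if i = φ.pos φ.len then e * g (φ.pos' φ.len) else -f i := by
    intro i
    rw [crossing_letter_inl, crossingCoeff, Sum.elim_inl]
    split_ifs
    · rw [Letter.orient_mul, Letter.orient_orient]
    · rw [Letter.orient_neg]
  have h2 : ∀ j, Letter.orient ((crossing h).letter (Sum.inr j))
      (φ.crossingCoeff χ ψ e (Sum.inr j)) =
      if j = φ.pos' φ.len then e⁻¹ * f (φ.pos φ.len) else g j := by
    intro j
    rw [crossing_letter_inr, crossingCoeff, Sum.elim_inr]
    split_ifs
    · rw [Letter.orient_mul, Letter.orient_orient]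
    · rfl
  -- Signs on all `m` letters would cancel because `m` is even; `σ_R` has no sign after moving to
  -- `Y`, and `τ_R` has none at `X`, so one `-1` survives.
  have h3 : ∏ i, -f i = ∏ i, f i := by
    rw [Finset.prod_neg, Finset.card_univ, ZMod.card, hm.neg_one_pow, one_mul]
  rw [Finset.prod_congr rfl fun i _ => h1 i, Finset.prod_congr rfl fun j _ => h2 j,
    prod_ite_eq_mul_div, prod_ite_eq_mul_div, h3]
  generalize f (φ.pos φ.len) = x
  generalize g (φ.pos' φ.len) = y
  have : (e * y / -x) * (e⁻¹ * x / y) = -1 := by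
    ext
    push_cast
    field_simp
  calc _ = (∏ i, f i) * (∏ j, g j) * ((e * y / -x) * (e⁻¹ * x / y)) := by
        rw [mul_mul_mul_comm]
    _ = _ := by rw [this, mul_neg_one]

/-- A linear walk which agrees with two homotopy strings at its two ends is a homotopy string. -/
lemma Walk.isString_of_agree {c w₁ w₂ : Walk Q 0} (hw₁ : w₁.IsString) (hw₂ : w₂.IsString)
    {p₀ p₁ s₁ s₂ : ℤ} (hp : p₀ ≤ p₁)
    (h₁ : ∀ p : ℤ, p ≤ p₀ → (c.dom (p : ZMod 0) ↔ w₁.dom ((p + s₁ : ℤ) : ZMod 0)))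
    (l₁ : ∀ p : ℤ, p < p₀ → c.letter (p : ZMod 0) = w₁.letter ((p + s₁ : ℤ) : ZMod 0))
    (h₂ : ∀ p : ℤ, p₁ ≤ p → (c.dom (p : ZMod 0) ↔ w₂.dom ((p + s₂ : ℤ) : ZMod 0)))
    (l₂ : ∀ p : ℤ, p₁ ≤ p → c.letter (p : ZMod 0) = w₂.letter ((p + s₂ : ℤ) : ZMod 0))
    (hm : ∀ p : ℤ, p₀ ≤ p → p ≤ p₁ → c.dom (p : ZMod 0)) : c.IsString where
  nonempty := ⟨p₀, hm p₀ le_rfl hp⟩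
  interval i j l hij hjl hi hl := by
    rcases le_total j p₀ with hj | hj
    · rw [h₁ j hj]
      exact hw₁.interval (i + s₁) (j + s₁) (p₀ + s₁) (by omega) (by omega)
        ((h₁ i (by omega)).1 hi) ((h₁ p₀ le_rfl).1 (hm p₀ le_rfl hp))
    · rcases le_total j p₁ with hj' | hj'
      · exact hm j hj hj'
      · rw [h₂ j hj']
        exact hw₂.interval (p₁ + s₂) (j + s₂) (l + s₂) (by omega) (by omega)
          ((h₂ p₁ le_rfl).1 (hm p₁ hp le_rfl)) ((h₂ l (by omega)).1 hl)
  left_tail h := by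
    obtain ⟨N, hN⟩ := hw₁.left_tail fun N => by
      obtain ⟨i, hi, hi'⟩ := h (min (N - s₁) p₀)
      exact ⟨i + s₁, by omega, (h₁ i (by omega)).1 hi'⟩
    refine ⟨min (N - s₁) p₀, fun i hi => ?_⟩
    rw [l₁ i (by omega)]
    exact hN _ (by omega)
  right_tail h := by
    obtain ⟨N, hN⟩ := hw₂.right_tail fun N => by
      obtain ⟨i, hi, hi'⟩ := h (max (N - s₂) p₁)
      exact ⟨i + s₂, by omega, (h₂ i (by omega)).1 hi'⟩
    refine ⟨max (N - s₂) p₁, fun i hi => ?_⟩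
    rw [l₂ i (by omega)]
    exact hN _ (by omega)

/-! ### Parametrizing the orbits of the crossed diagram -/

namespace QuasiGraphMap

section Coordinates

variable {m n : ℕ} {σ : Walk Q m} {τ : Walk Q n} (φ : QuasiGraphMap σ τ)

lemma pos_injOn {s t : ℤ} (h : φ.pos s = φ.pos t) (h' : m = 0 ∨ t - s < m ∧ s - t < m) :
    s = t := by
  rw [pos, pos, ZMod.intCast_eq_intCast_iff_dvd_sub] at h
  rcases h' with rfl | h'
  · rw [Nat.cast_zero, zero_dvd_iff] at h
    omega
  · have := Int.eq_zero_of_abs_lt_dvd h (by rw [abs_lt]; omega)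
    omega

lemma pos'_injOn {s t : ℤ} (h : φ.pos' s = φ.pos' t) (h' : n = 0 ∨ t - s < n ∧ s - t < n) :
    s = t := by
  rw [pos', pos', ZMod.intCast_eq_intCast_iff_dvd_sub] at h
  rcases h' with rfl | h'
  · rw [Nat.cast_zero, zero_dvd_iff] at h
    omega
  · have := Int.eq_zero_of_abs_lt_dvd h (by rw [abs_lt]; omega)
    omega

lemma pos_add_self (t : ℤ) : φ.pos (t + m) = φ.pos t := by
  simp [pos, ← add_assoc]

lemma pos'_add_self (t : ℤ) : φ.pos' (t + n) = φ.pos' t := by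
  simp [pos', ← add_assoc]

lemma exists_zmod_cast_eq {r : ℕ} (hr : 0 < r) (c s : ℤ) (i : ZMod r) :
    ∃ t : ℤ, s < t ∧ t ≤ s + r ∧ ((c + t : ℤ) : ZMod r) = i := by
  obtain ⟨z, rfl⟩ := ZMod.intCast_surjective i
  refine ⟨s + 1 + (z - c - (s + 1)) % r, ?_, ?_, ?_⟩
  · have := Int.emod_nonneg (z - c - (s + 1)) (b := r) (by omega)
    omega
  · have := Int.emod_lt_of_pos (z - c - (s + 1)) (b := r) (by omega)
    omega
  · rw [ZMod.intCast_eq_intCast_iff_dvd_sub]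
    refine ⟨(z - c - (s + 1)) / r, ?_⟩
    have := Int.emod_add_mul_ediv (z - c - (s + 1)) r
    linarith

lemma exists_pos (hm : 0 < m) (i : ZMod m) (s : ℤ) : ∃ t, s < t ∧ t ≤ s + m ∧ φ.pos t = i :=
  exists_zmod_cast_eq hm φ.a s i

lemma exists_pos' (hn : 0 < n) (i : ZMod n) (s : ℤ) : ∃ t, s < t ∧ t ≤ s + n ∧ φ.pos' t = i :=
  exists_zmod_cast_eq hn φ.b s i

lemma pos_surjective : Function.Surjective φ.pos := by
  intro i
  obtain ⟨z, rfl⟩ := ZMod.intCast_surjective i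
  exact ⟨z - φ.a, by simp [pos]⟩

lemma pos'_surjective : Function.Surjective φ.pos' := by
  intro i
  obtain ⟨z, rfl⟩ := ZMod.intCast_surjective i
  exact ⟨z - φ.b, by simp [pos']⟩

variable {φ} (h : φ.CrossingJunction)

lemma next_inl_pos {t : ℤ} (ht : φ.pos t ≠ φ.pos φ.len) :
    (crossing h).next (Sum.inl (φ.pos t)) = Sum.inl (φ.pos (t + 1)) := by
  rw [crossing_next_inl, if_neg ht, pos_add_one]

lemma next_inl_len :
    (crossing h).next (Sum.inl (φ.pos φ.len)) = Sum.inr (φ.pos' (φ.len + 1)) := by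
  rw [crossing_next_inl, if_pos rfl, pos'_add_one]

lemma next_inr_pos' {t : ℤ} (ht : φ.pos' t ≠ φ.pos' φ.len) :
    (crossing h).next (Sum.inr (φ.pos' t)) = Sum.inr (φ.pos' (t + 1)) := by
  rw [crossing_next_inr, if_neg ht, pos'_add_one]

lemma next_inr_len :
    (crossing h).next (Sum.inr (φ.pos' φ.len)) = Sum.inl (φ.pos (φ.len + 1)) := by
  rw [crossing_next_inr, if_pos rfl, pos_add_one]

lemma letter_inl_pos {t : ℤ} (ht : φ.pos t ≠ φ.pos φ.len) :
    (crossing h).letter (Sum.inl (φ.pos t)) = σ.letter (φ.pos t) := by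
  rw [crossing_letter_inl, if_neg ht]

lemma letter_inl_len : (crossing h).letter (Sum.inl (φ.pos φ.len)) = τ.letter (φ.pos' φ.len) := by
  rw [crossing_letter_inl, if_pos rfl]

lemma letter_inr_pos' {t : ℤ} (ht : φ.pos' t ≠ φ.pos' φ.len) :
    (crossing h).letter (Sum.inr (φ.pos' t)) = τ.letter (φ.pos' t) := by
  rw [crossing_letter_inr, if_neg ht]

lemma letter_inr_len : (crossing h).letter (Sum.inr (φ.pos' φ.len)) = σ.letter (φ.pos φ.len) := by
  rw [crossing_letter_inr, if_pos rfl]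

variable (φ)

/-- The walk which follows `σ` up to the end of `ρ`, and then `τ`. -/
def joinLeft (t : ℤ) : ZMod m ⊕ ZMod n :=
  if t ≤ φ.len then Sum.inl (φ.pos t) else Sum.inr (φ.pos' t)

/-- The walk which follows `τ` up to the end of `ρ`, and then `σ`. -/
def joinRight (t : ℤ) : ZMod m ⊕ ZMod n :=
  if t ≤ φ.len then Sum.inr (φ.pos' t) else Sum.inl (φ.pos t)

/-- The walk which follows `τ` up to the end of `ρ`, then one turn of `σ`, and then `τ`. -/
def insertLeft (t : ℤ) : ZMod m ⊕ ZMod n :=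
  if t ≤ φ.len then Sum.inr (φ.pos' t)
  else if t ≤ φ.len + m then Sum.inl (φ.pos t) else Sum.inr (φ.pos' (t - m))

/-- The walk which follows `σ` up to the end of `ρ`, then one turn of `τ`, and then `σ`. -/
def insertRight (t : ℤ) : ZMod m ⊕ ZMod n :=
  if t ≤ φ.len then Sum.inl (φ.pos t)
  else if t ≤ φ.len + n then Sum.inr (φ.pos' t) else Sum.inl (φ.pos (t - n))

variable {φ}

lemma joinLeft_add_one (hm : m = 0) (hn : n = 0) (t : ℤ) :
    φ.joinLeft (t + 1) = (crossing h).next (φ.joinLeft t) := by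
  unfold joinLeft
  rcases lt_trichotomy t φ.len with ht | rfl | ht
  · rw [if_pos (by omega), if_pos ht.le, next_inl_pos h fun h' => ht.ne (φ.pos_injOn h' (.inl hm))]
  · rw [if_neg (by omega), if_pos le_rfl, next_inl_len]
  · rw [if_neg (by omega), if_neg ht.not_ge,
      next_inr_pos' h fun h' => ht.ne' (φ.pos'_injOn h' (.inl hn))]

/-- Letters change walk one index before positions do: `len` is still a position of `σ`, but the
letter leaving it is already `τ_R`. The same shift occurs in the other parametrizations. -/
lemma letter_joinLeft (hm : m = 0) (hn : n = 0) (t : ℤ) : (crossing h).letter (φ.joinLeft t) =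
    if t < φ.len then σ.letter (φ.pos t) else τ.letter (φ.pos' t) := by
  unfold joinLeft
  rcases lt_trichotomy t φ.len with ht | rfl | ht
  · rw [if_pos ht.le, if_pos ht, letter_inl_pos h fun h' => ht.ne (φ.pos_injOn h' (.inl hm))]
  · rw [if_pos le_rfl, if_neg (lt_irrefl _), letter_inl_len]
  · rw [if_neg ht.not_ge, if_neg ht.not_gt,
      letter_inr_pos' h fun h' => ht.ne' (φ.pos'_injOn h' (.inl hn))]

lemma joinRight_add_one (hm : m = 0) (hn : n = 0) (t : ℤ) :
    φ.joinRight (t + 1) = (crossing h).next (φ.joinRight t) := by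
  unfold joinRight
  rcases lt_trichotomy t φ.len with ht | rfl | ht
  · rw [if_pos (by omega), if_pos ht.le,
      next_inr_pos' h fun h' => ht.ne (φ.pos'_injOn h' (.inl hn))]
  · rw [if_neg (by omega), if_pos le_rfl, next_inr_len]
  · rw [if_neg (by omega), if_neg ht.not_ge,
      next_inl_pos h fun h' => ht.ne' (φ.pos_injOn h' (.inl hm))]

lemma letter_joinRight (hm : m = 0) (hn : n = 0) (t : ℤ) : (crossing h).letter (φ.joinRight t) =
    if t < φ.len then τ.letter (φ.pos' t) else σ.letter (φ.pos t) := by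
  unfold joinRight
  rcases lt_trichotomy t φ.len with ht | rfl | ht
  · rw [if_pos ht.le, if_pos ht, letter_inr_pos' h fun h' => ht.ne (φ.pos'_injOn h' (.inl hn))]
  · rw [if_pos le_rfl, if_neg (lt_irrefl _), letter_inr_len]
  · rw [if_neg ht.not_ge, if_neg ht.not_gt,
      letter_inl_pos h fun h' => ht.ne' (φ.pos_injOn h' (.inl hm))]

/-- The two joined lines use complementary halves: the part of each walk up to the end of `ρ` in one
of them, the rest in the other. -/
lemma join_bijective (hm : m = 0) (hn : n = 0) :
    Function.Bijective (Sum.elim φ.joinLeft φ.joinRight) := by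
  constructor
  · rintro (s | s) (t | t) hst <;>
    · simp only [Sum.elim_inl, Sum.elim_inr, joinLeft, joinRight] at hst
      split_ifs at hst with h1 h2 h2 <;>
      first
      | exact (Sum.inl_ne_inr hst).elim
      | exact (Sum.inr_ne_inl hst).elim
      | (have := φ.pos_injOn (Sum.inl.inj hst) (.inl hm)
         first
         | omega
         | rw [this])
      | (have := φ.pos'_injOn (Sum.inr.inj hst) (.inl hn)
         first
         | omega
         | rw [this])
  · rintro (i | j)
    · obtain ⟨t, rfl⟩ := φ.pos_surjective i
      by_cases ht : t ≤ φ.len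
      · exact ⟨Sum.inl t, by simp [joinLeft, ht]⟩
      · exact ⟨Sum.inr t, by simp [joinRight, ht]⟩
    · obtain ⟨t, rfl⟩ := φ.pos'_surjective j
      by_cases ht : t ≤ φ.len
      · exact ⟨Sum.inr t, by simp [joinRight, ht]⟩
      · exact ⟨Sum.inl t, by simp [joinLeft, ht]⟩

lemma insertLeft_add_one (hm : 0 < m) (hn : n = 0) (t : ℤ) :
    φ.insertLeft (t + 1) = (crossing h).next (φ.insertLeft t) := by
  unfold insertLeft
  rcases lt_trichotomy t φ.len with ht | rfl | ht
  · rw [if_pos (by omega), if_pos ht.le,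
      next_inr_pos' h fun h' => ht.ne (φ.pos'_injOn h' (.inl hn))]
  · rw [if_neg (by omega), if_pos (by omega), if_pos le_rfl, next_inr_len]
  · rw [if_neg (by omega), if_neg ht.not_ge]
    rcases lt_trichotomy t (φ.len + m) with ht' | rfl | ht'
    · rw [if_pos (by omega), if_pos ht'.le,
        next_inl_pos h fun h' => ht.ne' (φ.pos_injOn h' (.inr (by omega)))]
    · rw [if_neg (by omega), if_pos le_rfl, pos_add_self, next_inl_len]
      congr 2
      ring
    · rw [if_neg (by omega), if_neg ht'.not_ge, next_inr_pos' h fun h' => ?_]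
      · congr 2
        ring
      · have := φ.pos'_injOn h' (.inl hn)
        omega

lemma letter_insertLeft (hm : 0 < m) (hn : n = 0) (t : ℤ) :
    (crossing h).letter (φ.insertLeft t) =
      if t < φ.len then τ.letter (φ.pos' t)
      else if t < φ.len + m then σ.letter (φ.pos t) else τ.letter (φ.pos' (t - m)) := by
  unfold insertLeft
  rcases lt_trichotomy t φ.len with ht | rfl | ht
  · rw [if_pos ht.le, if_pos ht, letter_inr_pos' h fun h' => ht.ne (φ.pos'_injOn h' (.inl hn))]
  · rw [if_pos le_rfl, if_neg (lt_irrefl _), if_pos (by omega), letter_inr_len]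
  · rw [if_neg ht.not_ge, if_neg ht.not_gt]
    rcases lt_trichotomy t (φ.len + m) with ht' | rfl | ht'
    · rw [if_pos ht'.le, if_pos ht',
        letter_inl_pos h fun h' => ht.ne' (φ.pos_injOn h' (.inr (by omega)))]
    · rw [if_pos le_rfl, if_neg (lt_irrefl _), pos_add_self, letter_inl_len, add_sub_cancel_right]
    · rw [if_neg ht'.not_ge, if_neg ht'.not_gt, letter_inr_pos' h fun h' => ?_]
      have := φ.pos'_injOn h' (.inl hn)
      omega

lemma insertLeft_bijective (hm : 0 < m) (hn : n = 0) : Function.Bijective φ.insertLeft := by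
  constructor
  · intro s t hst
    unfold insertLeft at hst
    split_ifs at hst <;>
    first
    | exact (Sum.inl_ne_inr hst).elim
    | exact (Sum.inr_ne_inl hst).elim
    | (have := φ.pos_injOn (Sum.inl.inj hst) (.inr (by omega)); omega)
    | (have := φ.pos'_injOn (Sum.inr.inj hst) (.inl hn); omega)
  · rintro (i | j)
    · obtain ⟨t, h1, h2, rfl⟩ := φ.exists_pos hm i φ.len
      exact ⟨t, by rw [insertLeft, if_neg (by omega), if_pos h2]⟩
    · obtain ⟨t, rfl⟩ := φ.pos'_surjective j
      by_cases ht : t ≤ φ.len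
      · exact ⟨t, by rw [insertLeft, if_pos ht]⟩
      · exact ⟨t + m, by
          rw [insertLeft, if_neg (by omega), if_neg (by omega), add_sub_cancel_right]⟩

/-- The hypotheses cover two uses. For a line `σ` every `t` is allowed. For a cycle `σ` the formula
holds from the end of `ρ` through one turn of each walk, until the crossing position of `σ` is met
again at `len + n + m`. -/
lemma insertRight_add_one (hn : 0 < n) {t : ℤ} (h₁ : t < φ.len → m = 0)
    (h₂ : m = 0 ∨ t < φ.len + n + m) :
    φ.insertRight (t + 1) = (crossing h).next (φ.insertRight t) := by
  unfold insertRight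
  rcases lt_trichotomy t φ.len with ht | rfl | ht
  · rw [if_pos (by omega), if_pos ht.le,
      next_inl_pos h fun h' => ht.ne (φ.pos_injOn h' (.inl (h₁ ht)))]
  · rw [if_neg (by omega), if_pos (by omega), if_pos le_rfl, next_inl_len]
  · rw [if_neg (by omega), if_neg ht.not_ge]
    rcases lt_trichotomy t (φ.len + n) with ht' | rfl | ht'
    · rw [if_pos (by omega), if_pos ht'.le,
        next_inr_pos' h fun h' => ht.ne' (φ.pos'_injOn h' (.inr (by omega)))]
    · rw [if_neg (by omega), if_pos le_rfl, pos'_add_self, next_inr_len]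
      congr 2
      ring
    · rw [if_neg (by omega), if_neg ht'.not_ge, next_inl_pos h fun h' => ?_]
      · congr 2
        ring
      · have := φ.pos_injOn h' (by omega)
        omega

lemma letter_insertRight (hn : 0 < n) {t : ℤ} (h₁ : t < φ.len → m = 0)
    (h₂ : m = 0 ∨ t < φ.len + n + m) : (crossing h).letter (φ.insertRight t) =
      if t < φ.len then σ.letter (φ.pos t)
      else if t < φ.len + n then τ.letter (φ.pos' t) else σ.letter (φ.pos (t - n)) := by
  unfold insertRight
  rcases lt_trichotomy t φ.len with ht | rfl | ht
  · rw [if_pos ht.le, if_pos ht, letter_inl_pos h fun h' => ht.ne (φ.pos_injOn h' (.inl (h₁ ht)))]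
  · rw [if_pos le_rfl, if_neg (lt_irrefl _), if_pos (by omega), letter_inl_len]
  · rw [if_neg ht.not_ge, if_neg ht.not_gt]
    rcases lt_trichotomy t (φ.len + n) with ht' | rfl | ht'
    · rw [if_pos ht'.le, if_pos ht',
        letter_inr_pos' h fun h' => ht.ne' (φ.pos'_injOn h' (.inr (by omega)))]
    · rw [if_pos le_rfl, if_neg (lt_irrefl _), pos'_add_self, letter_inr_len, add_sub_cancel_right]
    · rw [if_neg ht'.not_ge, if_neg ht'.not_gt, letter_inl_pos h fun h' => ?_]
      have := φ.pos_injOn h' (by omega)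
      omega

lemma insertRight_bijective (hm : m = 0) (hn : 0 < n) : Function.Bijective φ.insertRight := by
  constructor
  · intro s t hst
    unfold insertRight at hst
    split_ifs at hst <;>
    first
    | exact (Sum.inl_ne_inr hst).elim
    | exact (Sum.inr_ne_inl hst).elim
    | (have := φ.pos'_injOn (Sum.inr.inj hst) (.inr (by omega)); omega)
    | (have := φ.pos_injOn (Sum.inl.inj hst) (.inl hm); omega)
  · rintro (i | j)
    · obtain ⟨t, rfl⟩ := φ.pos_surjective i
      by_cases ht : t ≤ φ.len
      · exact ⟨t, by rw [insertRight, if_pos ht]⟩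
      · exact ⟨t + n, by
          rw [insertRight, if_neg (by omega), if_neg (by omega), add_sub_cancel_right]⟩
    · obtain ⟨t, h1, h2, rfl⟩ := φ.exists_pos' hn j φ.len
      exact ⟨t, by rw [insertRight, if_neg (by omega), if_pos h2]⟩

lemma insertRight_turn (hm : 0 < m) : φ.insertRight (φ.len + (n + m)) = φ.insertRight φ.len := by
  have : (φ.len : ℤ) + (n + m) - n = φ.len + m := by ring
  rw [insertRight, insertRight, if_neg (by omega), if_neg (by omega), if_pos le_rfl, this,
    pos_add_self]

variable (φ) in
/-- The closed walk which follows one turn of `τ` and one turn of `σ`, from the end of `ρ`. -/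
def turns (v : ZMod (n + m)) : ZMod m ⊕ ZMod n := φ.insertRight (φ.len + v.val)

lemma turns_add_one (hm : 0 < m) (hn : 0 < n) (v : ZMod (n + m)) :
    φ.turns (v + 1) = (crossing h).next (φ.turns v) := by
  have : NeZero (n + m) := ⟨by omega⟩
  have hv := ZMod.val_lt v
  have hv1 : v + 1 = ((v.val + 1 : ℕ) : ZMod (n + m)) := by
    rw [Nat.cast_succ, ZMod.natCast_zmod_val]
  unfold turns
  rw [← insertRight_add_one h hn (by omega) (by omega), hv1]
  rcases Nat.lt_or_ge (v.val + 1) (n + m) with hlt | hge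
  · rw [ZMod.val_cast_of_lt hlt, Nat.cast_succ, add_assoc]
  · have : v.val + 1 = n + m := by omega
    rw [this, ZMod.natCast_self, ZMod.val_zero, Nat.cast_zero, add_zero, add_assoc,
      ← insertRight_turn hm]
    congr 2
    exact_mod_cast this.symm

lemma turns_bijective (hm : 0 < m) (hn : 0 < n) : Function.Bijective φ.turns := by
  have : NeZero (n + m) := ⟨by omega⟩
  have : NeZero n := ⟨by omega⟩
  have : NeZero m := ⟨by omega⟩
  rw [Fintype.bijective_iff_surjective_and_card]
  refine ⟨?_, by rw [Fintype.card_sum, ZMod.card, ZMod.card, ZMod.card, add_comm]⟩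
  -- Both sides have `n + m` elements, so it suffices to reach every position within one window of
  -- this length starting at the end of `ρ`.
  have key : ∀ t : ℤ, φ.len ≤ t → t < φ.len + (n + m) → ∃ v, φ.turns v = φ.insertRight t := by
    intro t h1 h2
    refine ⟨((t - φ.len).toNat : ZMod (n + m)), ?_⟩
    rw [turns, ZMod.val_cast_of_lt (by omega)]
    congr 1
    omega
  rintro (i | j)
  · obtain ⟨t, h1, h2, rfl⟩ := φ.exists_pos hm i (φ.len - 1)
    by_cases ht : t = φ.len
    · obtain ⟨v, hv⟩ := key t (by omega) (by omega)
      exact ⟨v, by rw [hv, insertRight, if_pos ht.le]⟩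
    · obtain ⟨v, hv⟩ := key (t + n) (by omega) (by omega)
      exact ⟨v, by
        rw [hv, insertRight, if_neg (by omega), if_neg (by omega), add_sub_cancel_right]⟩
  · obtain ⟨t, h1, h2, rfl⟩ := φ.exists_pos' hn j φ.len
    obtain ⟨v, hv⟩ := key t (by omega) (by omega)
    exact ⟨v, by rw [hv, insertRight, if_neg (by omega), if_pos h2]⟩

end Coordinates

end QuasiGraphMap

/-! ### The four cases -/

namespace QuasiGraphMap

/-- The mapping cone of a map between two string complexes. -/
lemma exists_strings {σ τ : Walk Q 0} (hσ : σ.IsString) (hτ : τ.IsString)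
    {φ : QuasiGraphMap σ τ} (hφ : φ.CompatiblyOriented) {χ ψ : ZMod 0 → kˣ}
    {f : σ.complex χ ⟶ τ.complex ψ} (hf : φ.IsRepresentative χ ψ f) :
    ∃ c₁ c₂ : Walk Q 0, c₁.IsString ∧ c₂.IsString ∧
      c₁.Through (φ.a + φ.len) (σ.vtx ((φ.a + φ.len : ℤ) : ZMod 0))
        (σ.deg ((φ.a + φ.len : ℤ) : ZMod 0) - 1) ∧
      (∀ p : ℤ, c₁.letter (p : ZMod 0) =
        if p < φ.a + φ.len then σ.letter (p : ZMod 0)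
        else τ.letter ((p - (φ.a + φ.len) + (φ.b + φ.len) : ℤ) : ZMod 0)) ∧
      c₂.Through (φ.b + φ.len) (τ.vtx ((φ.b + φ.len : ℤ) : ZMod 0))
        (τ.deg ((φ.b + φ.len : ℤ) : ZMod 0)) ∧
      (∀ p : ℤ, c₂.letter (p : ZMod 0) =
        if p < φ.b + φ.len then τ.letter (p : ZMod 0)
        else σ.letter ((p - (φ.b + φ.len) + (φ.a + φ.len) : ℤ) : ZMod 0)) ∧
      IsoK (CochainComplex.mappingCone f) (c₁.stringComplex k ⊞ c₂.stringComplex k) := by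
  obtain ⟨h, e, hK⟩ := exists_isoK_crossing hφ hf
  obtain ⟨hdσ, hdτ, -, -⟩ := φ.matched le_rfl
  let Θ : ZMod 0 ⊕ ZMod 0 ≃ ZMod 0 ⊕ ZMod 0 :=
    -- The shifts by `a` and `b` convert distances from the beginning of `ρ` into the original
    -- indices, so each new walk keeps the numbering of the walk it follows on the left.
    (Equiv.sumCongr (Equiv.subRight φ.a) (Equiv.subRight φ.b)).trans
      (Equiv.ofBijective _ (φ.join_bijective rfl rfl))
  have h₁ : ∀ p : ZMod 0, Θ (Sum.inl (p + 1)) = (crossing h).next (Θ (Sum.inl p)) := by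
    intro (p : ℤ)
    change φ.joinLeft (p + 1 - φ.a) = (crossing h).next (φ.joinLeft (p - φ.a))
    rw [← joinLeft_add_one h rfl rfl, add_sub_right_comm]
  have h₂ : ∀ p : ZMod 0, Θ (Sum.inr (p + 1)) = (crossing h).next (Θ (Sum.inr p)) := by
    intro (p : ℤ)
    change φ.joinRight (p + 1 - φ.b) = (crossing h).next (φ.joinRight (p - φ.b))
    rw [← joinRight_add_one h rfl rfl, add_sub_right_comm]
  let c₁ := (crossing h).toWalk (fun p => Θ (Sum.inl p)) h₁
  let c₂ := (crossing h).toWalk (fun p => Θ (Sum.inr p)) h₂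
  have t₁ : ∀ p : ℤ, p ≤ φ.a + φ.len → Θ (Sum.inl (p : ZMod 0)) = Sum.inl (p : ZMod 0) := by
    intro p hp
    change φ.joinLeft (p - φ.a) = _
    rw [joinLeft, if_pos (by omega), pos, add_sub_cancel]
    rfl
  have t₁' : ∀ p : ℤ, φ.a + φ.len < p →
      Θ (Sum.inl (p : ZMod 0)) = Sum.inr ((p + (φ.b - φ.a) : ℤ) : ZMod 0) := by
    intro p hp
    change φ.joinLeft (p - φ.a) = _
    rw [joinLeft, if_neg (by omega), pos', add_sub_left_comm]
    rfl
  have t₂ : ∀ p : ℤ, p ≤ φ.b + φ.len → Θ (Sum.inr (p : ZMod 0)) = Sum.inr (p : ZMod 0) := by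
    intro p hp
    change φ.joinRight (p - φ.b) = _
    rw [joinRight, if_pos (by omega), pos', add_sub_cancel]
    rfl
  have t₂' : ∀ p : ℤ, φ.b + φ.len < p →
      Θ (Sum.inr (p : ZMod 0)) = Sum.inl ((p + (φ.a - φ.b) : ℤ) : ZMod 0) := by
    intro p hp
    change φ.joinRight (p - φ.b) = _
    rw [joinRight, if_neg (by omega), pos, add_sub_left_comm]
    rfl
  have l₁ : ∀ p : ℤ, c₁.letter (p : ZMod 0) = if p < φ.a + φ.len then σ.letter (p : ZMod 0)
      else τ.letter ((p + (φ.b - φ.a) : ℤ) : ZMod 0) := by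
    intro p
    refine (letter_joinLeft h rfl rfl (p - φ.a)).trans ?_
    rw [pos, pos', add_sub_cancel, add_sub_left_comm]
    exact if_congr sub_lt_iff_lt_add' rfl rfl
  have l₂ : ∀ p : ℤ, c₂.letter (p : ZMod 0) = if p < φ.b + φ.len then τ.letter (p : ZMod 0)
      else σ.letter ((p + (φ.a - φ.b) : ℤ) : ZMod 0) := by
    intro p
    refine (letter_joinRight h rfl rfl (p - φ.b)).trans ?_
    rw [pos, pos', add_sub_cancel, add_sub_left_comm]
    exact if_congr sub_lt_iff_lt_add' rfl rfl
  refine ⟨c₁, c₂, ?_, ?_, ⟨?_, ?_, ?_⟩, ?_, ⟨?_, ?_, ?_⟩, ?_, ?_⟩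
  · refine Walk.isString_of_agree hσ hτ (p₀ := φ.a + φ.len) (p₁ := φ.a + φ.len) (s₁ := 0)
      (s₂ := φ.b - φ.a) le_rfl (fun p hp => ?_) (fun p hp => ?_) (fun p hp => ?_) (fun p hp => ?_)
      (fun p hp hp' => ?_)
    · change (crossing h).dom (Θ (Sum.inl _)) ↔ _
      rw [t₁ p hp, add_zero]
      rfl
    · rw [l₁, if_pos hp, add_zero]
    · rcases hp.eq_or_lt with rfl | hp
      · change (crossing h).dom (Θ (Sum.inl _)) ↔ _
        rw [t₁ _ le_rfl, show φ.a + φ.len + (φ.b - φ.a) = φ.b + φ.len by ring]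
        exact iff_of_true hdσ hdτ
      · change (crossing h).dom (Θ (Sum.inl _)) ↔ _
        rw [t₁' p hp]
        rfl
    · rw [l₁, if_neg hp.not_gt]
    · change (crossing h).dom (Θ (Sum.inl _))
      rw [le_antisymm hp' hp, t₁ _ le_rfl]
      exact hdσ
  · refine Walk.isString_of_agree hτ hσ (p₀ := φ.b + φ.len) (p₁ := φ.b + φ.len) (s₁ := 0)
      (s₂ := φ.a - φ.b) le_rfl (fun p hp => ?_) (fun p hp => ?_) (fun p hp => ?_) (fun p hp => ?_)
      (fun p hp hp' => ?_)
    · change (crossing h).dom (Θ (Sum.inr _)) ↔ _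
      rw [t₂ p hp, add_zero]
      rfl
    · rw [l₂, if_pos hp, add_zero]
    · rcases hp.eq_or_lt with rfl | hp
      · change (crossing h).dom (Θ (Sum.inr _)) ↔ _
        rw [t₂ _ le_rfl, show φ.b + φ.len + (φ.a - φ.b) = φ.a + φ.len by ring]
        exact iff_of_true hdτ hdσ
      · change (crossing h).dom (Θ (Sum.inr _)) ↔ _
        rw [t₂' p hp]
        rfl
    · rw [l₂, if_neg hp.not_gt]
    · change (crossing h).dom (Θ (Sum.inr _))
      rw [le_antisymm hp' hp, t₂ _ le_rfl]
      exact hdτ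
  · change (crossing h).dom (Θ (Sum.inl _))
    rw [t₁ _ le_rfl]
    exact hdσ
  · change (crossing h).vtx (Θ (Sum.inl _)) = _
    rw [t₁ _ le_rfl]
    rfl
  · change (crossing h).deg (Θ (Sum.inl _)) = _
    rw [t₁ _ le_rfl]
    rfl
  · intro p
    rw [l₁, show p - (φ.a + φ.len) + (φ.b + φ.len) = p + (φ.b - φ.a) by ring]
  · change (crossing h).dom (Θ (Sum.inr _))
    rw [t₂ _ le_rfl]
    exact hdτ
  · change (crossing h).vtx (Θ (Sum.inr _)) = _
    rw [t₂ _ le_rfl]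
    rfl
  · change (crossing h).deg (Θ (Sum.inr _)) = _
    rw [t₂ _ le_rfl]
    rfl
  · intro p
    rw [l₂, show p - (φ.b + φ.len) + (φ.a + φ.len) = p + (φ.a - φ.b) by ring]
  · obtain ⟨i⟩ := (crossing h).nonempty_iso_biprod Θ h₁ h₂ (φ.crossingCoeff χ ψ e)
    obtain ⟨i₁⟩ := c₁.nonempty_iso_linear
      (φ.crossingCoeff χ ψ e ∘ fun p => Θ (Sum.inl p)) (1 : ZMod 0 → kˣ)
    obtain ⟨i₂⟩ := c₂.nonempty_iso_linear
      (φ.crossingCoeff χ ψ e ∘ fun p => Θ (Sum.inr p)) (1 : ZMod 0 → kˣ)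
    exact hK.trans (IsoK.of_iso (i ≪≫ biprod.mapIso i₁ i₂))

/-- The mapping cone of a map from a band complex to a string complex. -/
lemma exists_string_of_band_string {m : ℕ} {σ : Walk Q m} {τ : Walk Q 0} (hσ : σ.IsClosed)
    (hτ : τ.IsString) {φ : QuasiGraphMap σ τ} (hφ : φ.CompatiblyOriented) {χ : ZMod m → kˣ}
    {ψ : ZMod 0 → kˣ} {f : σ.complex χ ⟶ τ.complex ψ} (hf : φ.IsRepresentative χ ψ f) :
    ∃ c : Walk Q 0, c.IsString ∧
      c.Through (φ.b + φ.len) (τ.vtx ((φ.b + φ.len : ℤ) : ZMod 0))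
        (τ.deg ((φ.b + φ.len : ℤ) : ZMod 0)) ∧
      (∀ p : ℤ, c.letter (p : ZMod 0) =
        if p < φ.b + φ.len then τ.letter (p : ZMod 0)
        else if p < φ.b + φ.len + m then
          σ.letter ((p - (φ.b + φ.len) + (φ.a + φ.len) : ℤ) : ZMod m)
        else τ.letter ((p - m : ℤ) : ZMod 0)) ∧
      IsoK (CochainComplex.mappingCone f) (c.stringComplex k) := by
  obtain ⟨h, e, hK⟩ := exists_isoK_crossing hφ hf
  obtain ⟨-, hdτ, -, -⟩ := φ.matched le_rfl
  let Θ : ZMod 0 ≃ ZMod m ⊕ ZMod 0 :=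
    (Equiv.subRight φ.b).trans (Equiv.ofBijective _ (φ.insertLeft_bijective hσ.1 rfl))
  have h₁ : ∀ p : ZMod 0, Θ (p + 1) = (crossing h).next (Θ p) := by
    intro (p : ℤ)
    change φ.insertLeft (p + 1 - φ.b) = (crossing h).next (φ.insertLeft (p - φ.b))
    rw [← insertLeft_add_one h hσ.1 rfl, add_sub_right_comm]
  let c := (crossing h).toWalk Θ h₁
  have t₁ : ∀ p : ℤ, p ≤ φ.b + φ.len → Θ (p : ZMod 0) = Sum.inr (p : ZMod 0) := by
    intro p hp
    change φ.insertLeft (p - φ.b) = _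
    rw [insertLeft, if_pos (by omega), pos', add_sub_cancel]
    rfl
  have t₂ : ∀ p : ℤ, φ.b + φ.len + m < p → Θ (p : ZMod 0) = Sum.inr ((p - m : ℤ) : ZMod 0) := by
    intro p hp
    change φ.insertLeft (p - φ.b) = _
    rw [insertLeft, if_neg (by omega), if_neg (by omega), pos', sub_right_comm, add_sub_cancel]
    rfl
  have l : ∀ p : ℤ, c.letter (p : ZMod 0) = if p < φ.b + φ.len then τ.letter (p : ZMod 0)
        else if p < φ.b + φ.len + m then
          σ.letter ((p - (φ.b + φ.len) + (φ.a + φ.len) : ℤ) : ZMod m)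
        else τ.letter ((p - m : ℤ) : ZMod 0) := by
    intro p
    refine (letter_insertLeft h hσ.1 rfl (p - φ.b)).trans ?_
    rw [pos, pos', pos', add_sub_cancel, sub_right_comm, add_sub_cancel,
      show φ.a + (p - φ.b) = p - (φ.b + φ.len) + (φ.a + φ.len) by ring]
    exact if_congr sub_lt_iff_lt_add' rfl
      (if_congr (by rw [sub_lt_iff_lt_add', add_assoc]) rfl rfl)
  have hmid : ∀ p : ℤ, φ.b + φ.len ≤ p → p ≤ φ.b + φ.len + m → c.dom (p : ZMod 0) := by
    intro p hp hp'
    change (crossing h).dom (Θ _)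
    rcases hp.eq_or_lt with rfl | hp
    · rw [t₁ _ le_rfl]
      exact hdτ
    · change (crossing h).dom (φ.insertLeft (p - φ.b))
      rw [insertLeft, if_neg (by omega), if_pos (by omega)]
      exact hσ.2 _
  refine ⟨c, ?_, ⟨hmid _ le_rfl (by omega), ?_, ?_⟩, l, ?_⟩
  · refine Walk.isString_of_agree hτ hτ (p₀ := φ.b + φ.len) (p₁ := φ.b + φ.len + m) (s₁ := 0)
      (s₂ := -m) (by omega) (fun p hp => ?_) (fun p hp => ?_) (fun p hp => ?_) (fun p hp => ?_)
      hmid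
    · change (crossing h).dom (Θ _) ↔ _
      rw [t₁ p hp, add_zero]
      rfl
    · rw [l, if_pos hp, add_zero]
    · rcases hp.eq_or_lt with rfl | hp
      · rw [add_neg_cancel_right]
        exact iff_of_true (hmid _ (by omega) le_rfl) hdτ
      · change (crossing h).dom (Θ _) ↔ _
        rw [t₂ p hp]
        rfl
    · rw [l, if_neg (by omega), if_neg hp.not_gt]
      rfl
  · change (crossing h).vtx (Θ _) = _
    rw [t₁ _ le_rfl]
    rfl
  · change (crossing h).deg (Θ _) = _
    rw [t₁ _ le_rfl]
    rfl
  · obtain ⟨i⟩ := c.nonempty_iso_linear (φ.crossingCoeff χ ψ e ∘ Θ) (1 : ZMod 0 → kˣ)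
    exact hK.trans (IsoK.of_iso ((crossing h).isoToWalk Θ h₁ _ ≪≫ i))

/-- The mapping cone of a map from a string complex to a band complex. -/
lemma exists_string_of_string_band {n : ℕ} {σ : Walk Q 0} {τ : Walk Q n} (hσ : σ.IsString)
    (hτ : τ.IsClosed) {φ : QuasiGraphMap σ τ} (hφ : φ.CompatiblyOriented) {χ : ZMod 0 → kˣ}
    {ψ : ZMod n → kˣ} {f : σ.complex χ ⟶ τ.complex ψ} (hf : φ.IsRepresentative χ ψ f) :
    ∃ c : Walk Q 0, c.IsString ∧
      c.Through (φ.a + φ.len) (σ.vtx ((φ.a + φ.len : ℤ) : ZMod 0))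
        (σ.deg ((φ.a + φ.len : ℤ) : ZMod 0) - 1) ∧
      (∀ p : ℤ, c.letter (p : ZMod 0) =
        if p < φ.a + φ.len then σ.letter (p : ZMod 0)
        else if p < φ.a + φ.len + n then
          τ.letter ((p - (φ.a + φ.len) + (φ.b + φ.len) : ℤ) : ZMod n)
        else σ.letter ((p - n : ℤ) : ZMod 0)) ∧
      IsoK (CochainComplex.mappingCone f) (c.stringComplex k) := by
  obtain ⟨h, e, hK⟩ := exists_isoK_crossing hφ hf
  obtain ⟨hdσ, -, -, -⟩ := φ.matched le_rfl
  let Θ : ZMod 0 ≃ ZMod 0 ⊕ ZMod n :=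
    (Equiv.subRight φ.a).trans (Equiv.ofBijective _ (φ.insertRight_bijective rfl hτ.1))
  have h₁ : ∀ p : ZMod 0, Θ (p + 1) = (crossing h).next (Θ p) := by
    intro (p : ℤ)
    change φ.insertRight (p + 1 - φ.a) = (crossing h).next (φ.insertRight (p - φ.a))
    rw [← insertRight_add_one h hτ.1 (fun _ => rfl) (.inl rfl), add_sub_right_comm]
  let c := (crossing h).toWalk Θ h₁
  have t₁ : ∀ p : ℤ, p ≤ φ.a + φ.len → Θ (p : ZMod 0) = Sum.inl (p : ZMod 0) := by
    intro p hp
    change φ.insertRight (p - φ.a) = _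
    rw [insertRight, if_pos (by omega), pos, add_sub_cancel]
    rfl
  have t₂ : ∀ p : ℤ, φ.a + φ.len + n < p → Θ (p : ZMod 0) = Sum.inl ((p - n : ℤ) : ZMod 0) := by
    intro p hp
    change φ.insertRight (p - φ.a) = _
    rw [insertRight, if_neg (by omega), if_neg (by omega), pos, sub_right_comm, add_sub_cancel]
    rfl
  have l : ∀ p : ℤ, c.letter (p : ZMod 0) = if p < φ.a + φ.len then σ.letter (p : ZMod 0)
        else if p < φ.a + φ.len + n then
          τ.letter ((p - (φ.a + φ.len) + (φ.b + φ.len) : ℤ) : ZMod n)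
        else σ.letter ((p - n : ℤ) : ZMod 0) := by
    intro p
    refine (letter_insertRight h hτ.1 (t := p - φ.a) (fun _ => rfl) (.inl rfl)).trans ?_
    rw [pos, pos, pos', add_sub_cancel, sub_right_comm, add_sub_cancel,
      show φ.b + (p - φ.a) = p - (φ.a + φ.len) + (φ.b + φ.len) by ring]
    exact if_congr sub_lt_iff_lt_add' rfl
      (if_congr (by rw [sub_lt_iff_lt_add', add_assoc]) rfl rfl)
  have hmid : ∀ p : ℤ, φ.a + φ.len ≤ p → p ≤ φ.a + φ.len + n → c.dom (p : ZMod 0) := by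
    intro p hp hp'
    change (crossing h).dom (Θ _)
    rcases hp.eq_or_lt with rfl | hp
    · rw [t₁ _ le_rfl]
      exact hdσ
    · change (crossing h).dom (φ.insertRight (p - φ.a))
      rw [insertRight, if_neg (by omega), if_pos (by omega)]
      exact hτ.2 _
  refine ⟨c, ?_, ⟨hmid _ le_rfl (by omega), ?_, ?_⟩, l, ?_⟩
  · refine Walk.isString_of_agree hσ hσ (p₀ := φ.a + φ.len) (p₁ := φ.a + φ.len + n) (s₁ := 0)
      (s₂ := -n) (by omega) (fun p hp => ?_) (fun p hp => ?_) (fun p hp => ?_) (fun p hp => ?_)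
      hmid
    · change (crossing h).dom (Θ _) ↔ _
      rw [t₁ p hp, add_zero]
      rfl
    · rw [l, if_pos hp, add_zero]
    · rcases hp.eq_or_lt with rfl | hp
      · rw [add_neg_cancel_right]
        exact iff_of_true (hmid _ (by omega) le_rfl) hdσ
      · change (crossing h).dom (Θ _) ↔ _
        rw [t₂ p hp]
        rfl
    · rw [l, if_neg (by omega), if_neg hp.not_gt]
      rfl
  · change (crossing h).vtx (Θ _) = _
    rw [t₁ _ le_rfl]
    rfl
  · change (crossing h).deg (Θ _) = _
    rw [t₁ _ le_rfl]
    rfl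
  · obtain ⟨i⟩ := c.nonempty_iso_linear (φ.crossingCoeff χ ψ e ∘ Θ) (1 : ZMod 0 → kˣ)
    exact hK.trans (IsoK.of_iso ((crossing h).isoToWalk Θ h₁ _ ≪≫ i))

/-- The mapping cone of a map between two band complexes. -/
lemma exists_closed {m n : ℕ} {σ : Walk Q m} {τ : Walk Q n} (hσ : σ.IsClosed) (hτ : τ.IsClosed)
    {φ : QuasiGraphMap σ τ} (hφ : φ.CompatiblyOriented) {i : ZMod m} {j : ZMod n} {lam mu : kˣ}
    (hi : σ.DirectAt i) (hj : τ.InverseAt j) {f : σ.bandComplex i lam ⟶ τ.bandComplex j mu}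
    (hf : φ.IsRepresentative (Walk.scalarAt i lam) (Walk.scalarAt j mu) f) :
    ∃ c : Walk Q (n + m), c.IsClosed ∧
      c.vtx 0 = τ.vtx ((φ.b + φ.len : ℤ) : ZMod n) ∧
      c.deg 0 = τ.deg ((φ.b + φ.len : ℤ) : ZMod n) ∧
      (∀ p : ℕ, p < n → c.letter (p : ZMod (n + m)) =
        τ.letter ((φ.b + φ.len + p : ℤ) : ZMod n)) ∧
      (∀ p : ℕ, p < m → c.letter ((n + p : ℕ) : ZMod (n + m)) =
        σ.letter ((φ.a + φ.len + p : ℤ) : ZMod m)) ∧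
      (∀ l, c.DirectAt l →
        IsoK (CochainComplex.mappingCone f) (c.bandComplex l (-(lam * mu⁻¹)))) ∧
      (∀ l, c.InverseAt l →
        IsoK (CochainComplex.mappingCone f) (c.bandComplex l (-(lam * mu⁻¹))⁻¹)) := by
  have : NeZero m := ⟨hσ.1.ne'⟩
  have : NeZero n := ⟨hτ.1.ne'⟩
  have : NeZero (n + m) := ⟨by have := hσ.1; omega⟩
  obtain ⟨h, e, hK⟩ := exists_isoK_crossing hφ hf
  obtain ⟨-, -, hv, hd⟩ := φ.matched le_rfl
  let Θ : ZMod (n + m) ≃ ZMod m ⊕ ZMod n := Equiv.ofBijective _ (φ.turns_bijective hσ.1 hτ.1)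
  have h₁ : ∀ p, Θ (p + 1) = (crossing h).next (Θ p) := turns_add_one h hσ.1 hτ.1
  let c := (crossing h).toWalk Θ h₁
  -- Index `0` is the crossing position taken in `σ`; it has the same vertex and cone degree as its
  -- partner in `τ`, and the letter after it is `τ_R`.
  have t₀ : Θ 0 = Sum.inl (φ.pos φ.len) := by
    change φ.insertRight (φ.len + ((0 : ZMod (n + m)).val : ℤ)) = _
    rw [ZMod.val_zero, Nat.cast_zero, add_zero, insertRight, if_pos le_rfl]
  have l : ∀ p : ℕ, p < n + m → c.letter (p : ZMod (n + m)) =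
      if p < n then τ.letter (φ.pos' (φ.len + p)) else σ.letter (φ.pos (φ.len + p - n)) := by
    intro p hp
    change (crossing h).letter (φ.insertRight (φ.len + ((p : ZMod (n + m)).val : ℤ))) = _
    rw [ZMod.val_cast_of_lt hp, letter_insertRight h hτ.1 (by omega) (by omega),
      if_neg (by omega)]
    exact if_congr (by omega) rfl rfl
  -- A scalar `x` may sit on any letter, provided its oriented value is `-λμ⁻¹`: `x` itself for a
  -- direct letter, `x⁻¹` for an inverse one. In the product for the crossed diagram, `λ` sits on a
  -- direct letter and counts as `λ`, while `μ` sits on an inverse letter and counts as `μ⁻¹`.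
  have key : ∀ q x, Letter.orient (c.letter q) x = -(lam * mu⁻¹) →
      IsoK (CochainComplex.mappingCone f) (c.bandComplex q x) := by
    intro q x hx
    obtain ⟨i'⟩ := c.nonempty_iso_closed
      (φ.crossingCoeff (Walk.scalarAt i lam) (Walk.scalarAt j mu) e ∘ Θ) (Walk.scalarAt q x) (by
        rw [c.prod_orient_scalarAt, hx]
        refine (Equiv.prod_comp Θ fun p => Letter.orient ((crossing h).letter p)
          (φ.crossingCoeff (Walk.scalarAt i lam) (Walk.scalarAt j mu) e p)).trans ?_
        obtain ⟨l, hl, hl'⟩ := hi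
        obtain ⟨l', hk, hk'⟩ := hj
        rw [prod_orient_crossingCoeff h hσ.even, σ.prod_orient_scalarAt, τ.prod_orient_scalarAt,
          hl, hk]
        simp [Letter.orient, hl', hk'])
    exact hK.trans (IsoK.of_iso ((crossing h).isoToWalk Θ h₁ _ ≪≫ i'))
  refine ⟨c, ⟨by have := hσ.1; omega, fun p => ?_⟩, ?_, ?_, fun p hp => ?_, fun p hp => ?_,
    fun q hq => ?_, fun q hq => ?_⟩
  · change (crossing h).dom (Θ p)
    rcases Θ p with u | u
    · exact hσ.2 u
    · exact hτ.2 u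
  · change (crossing h).vtx (Θ 0) = _
    rw [t₀]
    exact hv
  · change (crossing h).deg (Θ 0) = _
    rw [t₀]
    change σ.deg (φ.pos φ.len) - 1 = _
    rw [hd, add_sub_cancel_right]
    rfl
  · rw [l p (by omega), if_pos hp, pos', add_assoc]
  · rw [l (n + p) (by omega), if_neg (by omega), pos, Nat.cast_add]
    congr 2
    ring
  · obtain ⟨y, hy, hy'⟩ := hq
    refine key q _ ?_
    rw [hy]
    simp [Letter.orient, hy']
  · obtain ⟨y, hy, hy'⟩ := hq
    refine key q _ ?_
    rw [hy]
    simp [Letter.orient, hy']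

end QuasiGraphMap

end Gentle

end

theorem mainTheorem4 {k : Type*} [Field k] [IsAlgClosed k] {V A : Type*} [Fintype V] [Fintype A]
    (Q : Gentle.GentleQuiver V A) :
    -- (1) two homotopy strings
    (∀ (σ τ : Gentle.Walk Q 0), σ.IsString → τ.IsString →
      ∀ (φ : Gentle.QuasiGraphMap σ τ), φ.CompatiblyOriented →
      ∀ (f : σ.stringComplex k ⟶ τ.stringComplex k), φ.IsRepresentative 1 1 f →
      ∃ c₁ c₂ : Gentle.Walk Q 0, c₁.IsString ∧ c₂.IsString ∧
        -- `c₁ = β σ_L ρ τ_R γ`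
        c₁.Through (φ.a + φ.len) (σ.vtx ((φ.a + φ.len : ℤ) : ZMod 0))
          (σ.deg ((φ.a + φ.len : ℤ) : ZMod 0) - 1) ∧
        (∀ p : ℤ, c₁.letter (p : ZMod 0) =
          if p < φ.a + φ.len then σ.letter (p : ZMod 0)
          else τ.letter ((p - (φ.a + φ.len) + (φ.b + φ.len) : ℤ) : ZMod 0)) ∧
        -- `c₂ = δ τ_L ρ σ_R α`
        c₂.Through (φ.b + φ.len) (τ.vtx ((φ.b + φ.len : ℤ) : ZMod 0))
          (τ.deg ((φ.b + φ.len : ℤ) : ZMod 0)) ∧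
        (∀ p : ℤ, c₂.letter (p : ZMod 0) =
          if p < φ.b + φ.len then τ.letter (p : ZMod 0)
          else σ.letter ((p - (φ.b + φ.len) + (φ.a + φ.len) : ℤ) : ZMod 0)) ∧
        Gentle.IsoK (CochainComplex.mappingCone f) (c₁.stringComplex k ⊞ c₂.stringComplex k)) ∧
    -- (2) two homotopy bands
    (∀ (m n : ℕ) (σ : Gentle.Walk Q m) (τ : Gentle.Walk Q n), σ.IsBand → τ.IsBand →
      ∀ (i : ZMod m) (j : ZMod n) (lam mu : kˣ), σ.DirectAt i → τ.InverseAt j →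
      ∀ (φ : Gentle.QuasiGraphMap σ τ), φ.CompatiblyOriented →
      ∀ (f : σ.bandComplex i lam ⟶ τ.bandComplex j mu),
        φ.IsRepresentative (Gentle.Walk.scalarAt i lam) (Gentle.Walk.scalarAt j mu) f →
      ∃ c : Gentle.Walk Q (n + m), c.IsClosed ∧
        -- up to rotation `c = β σ_L ρ τ_R γ δ τ_L ρ σ_R α`, read from `τ_R`
        c.vtx 0 = τ.vtx ((φ.b + φ.len : ℤ) : ZMod n) ∧
        c.deg 0 = τ.deg ((φ.b + φ.len : ℤ) : ZMod n) ∧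
        (∀ p : ℕ, p < n → c.letter (p : ZMod (n + m)) =
          τ.letter ((φ.b + φ.len + p : ℤ) : ZMod n)) ∧
        (∀ p : ℕ, p < m → c.letter ((n + p : ℕ) : ZMod (n + m)) =
          σ.letter ((φ.a + φ.len + p : ℤ) : ZMod m)) ∧
        (∀ l, c.DirectAt l →
          Gentle.IsoK (CochainComplex.mappingCone f) (c.bandComplex l (-(lam * mu⁻¹)))) ∧
        (∀ l, c.InverseAt l →
          Gentle.IsoK (CochainComplex.mappingCone f) (c.bandComplex l (-(lam * mu⁻¹))⁻¹))) ∧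
    -- (3) `σ` a homotopy band, `τ` a homotopy string
    (∀ (m : ℕ) (σ : Gentle.Walk Q m) (τ : Gentle.Walk Q 0), σ.IsBand → τ.IsString →
      ∀ (i : ZMod m) (lam : kˣ) (φ : Gentle.QuasiGraphMap σ τ), φ.CompatiblyOriented →
      ∀ (f : σ.bandComplex i lam ⟶ τ.stringComplex k),
        φ.IsRepresentative (Gentle.Walk.scalarAt i lam) 1 f →
      ∃ c : Gentle.Walk Q 0, c.IsString ∧
        -- `c = δ τ_L ρ σ_R α β σ_L ρ τ_R γ`
        c.Through (φ.b + φ.len) (τ.vtx ((φ.b + φ.len : ℤ) : ZMod 0))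
          (τ.deg ((φ.b + φ.len : ℤ) : ZMod 0)) ∧
        (∀ p : ℤ, c.letter (p : ZMod 0) =
          if p < φ.b + φ.len then τ.letter (p : ZMod 0)
          else if p < φ.b + φ.len + m then
            σ.letter ((p - (φ.b + φ.len) + (φ.a + φ.len) : ℤ) : ZMod m)
          else τ.letter ((p - m : ℤ) : ZMod 0)) ∧
        Gentle.IsoK (CochainComplex.mappingCone f) (c.stringComplex k)) ∧
    -- (4) `σ` a homotopy string, `τ` a homotopy band
    (∀ (n : ℕ) (σ : Gentle.Walk Q 0) (τ : Gentle.Walk Q n), σ.IsString → τ.IsBand →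
      ∀ (j : ZMod n) (mu : kˣ) (φ : Gentle.QuasiGraphMap σ τ), φ.CompatiblyOriented →
      ∀ (f : σ.stringComplex k ⟶ τ.bandComplex j mu),
        φ.IsRepresentative 1 (Gentle.Walk.scalarAt j mu) f →
      ∃ c : Gentle.Walk Q 0, c.IsString ∧
        -- `c = β σ_L ρ τ_R γ δ τ_L ρ σ_R α`
        c.Through (φ.a + φ.len) (σ.vtx ((φ.a + φ.len : ℤ) : ZMod 0))
          (σ.deg ((φ.a + φ.len : ℤ) : ZMod 0) - 1) ∧
        (∀ p : ℤ, c.letter (p : ZMod 0) =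
          if p < φ.a + φ.len then σ.letter (p : ZMod 0)
          else if p < φ.a + φ.len + n then
            τ.letter ((p - (φ.a + φ.len) + (φ.b + φ.len) : ℤ) : ZMod n)
          else σ.letter ((p - n : ℤ) : ZMod 0)) ∧
        Gentle.IsoK (CochainComplex.mappingCone f) (c.stringComplex k)) := by
  exact
    ⟨fun _ _ hσ hτ _ hφ _ hf => Gentle.QuasiGraphMap.exists_strings hσ hτ hφ hf,
      fun _ _ _ _ hσ hτ _ _ _ _ hi hj _ hφ _ hf =>
        Gentle.QuasiGraphMap.exists_closed hσ.1 hτ.1 hφ hi hj hf,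
      fun _ _ _ hσ hτ _ _ _ hφ _ hf =>
        Gentle.QuasiGraphMap.exists_string_of_band_string hσ.1 hτ hφ hf,
      fun _ _ _ hσ hτ _ _ _ hφ _ hf =>
        Gentle.QuasiGraphMap.exists_string_of_string_band hσ hτ.1 hφ hf⟩
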